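/- **Components.** Fix a set of values containing two distinct constants $\mathtt{inl},\mathtt{inr}$, and countably infinite sets of ports, roles, labels and variables. A *local binder* $y\langle\tilde\sigma\rangle f(\tilde x)$ has an output port $y$, parameters $\tilde x$, a partial function $f$ on values and a queue $\tilde\sigma$ of finite partial maps from ports to values. If $\tilde x$ is empty it can always output $f()$ on $y$ (its queue being empty); otherwise it can output $f(\sigma(\tilde x))$ on $y$ and remove the first store $\sigma$ when $\mathrm{dom}\,\sigma=\{\tilde x\}$. On input $x?v$ with $x\in\tilde x$ it records $x\mapsto v$ in the first store undefined at $x$, or in a new last store if there is none; if $x\notin\tilde x$ it discards the input. A collection $L$ of local binders outputs through one of them and inputs through all of them simultaneously. *Protocols* are $G::= p\to\tilde q:\ell;G \mid p\to\tilde q:\ell\,(G,G)\mid \mu X.G\mid X\mid\mathbf{end}\mid (\ell,v\to\tilde q);G\mid(\ell,v\to\tilde q)(G,G)$, where $\tilde q$ is a finite set of roles and the last two are runtime terms with $v$ in transit. Transitions $G\xrightarrow{\alpha}G'$, where $\alpha$ is $p!\ell\langle v\rangle$ or $q?\ell\langle v\rangle$: the sender $p$ of a communication puts any $v$ in transit,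 the sender of a choice puts $v\in\{\mathtt{inl},\mathtt{inr}\}$; each role in $\tilde q$ of a runtime term receives $v$ and is removed from $\tilde q$, the last receiver leading to the continuation (to the branch selected by $v$ for a choice); recursion is unfolded; and a continuation may act below a prefix if the role of $\alpha$ does not occur in that prefix (in both branches simultaneously, and with the same $\alpha$, for a choice not yet made; in the selected branch for a choice in transit). *Components* are base components $[\tilde x\rangle\tilde y]\{L\}$ and composites $[\tilde x\rangle\tilde y]\{G;R;D;r[F]\}$. Here $R$ assigns components to roles, $D$ consists of connection binders $\ell:q.w\leftarrow p.z$ (output port $z$ of $p$ connected to input port $w$ of $q$ for label $\ell$), and $F$ of input forwarders $w\leftarrow x$ and output forwarders $y\leftarrow z$ between the interface and the ports of role $r$. A base component inputs on $\tilde x$ and outputs on $\tilde y$ as $L$ does. A composite moves by $\tau$ if a component assigned to some role does; if, for some $\ell:q.w\leftarrow p.z$ in $D$, a component of $p$ outputs $v$ on $z$ and $G$ does $p!\ell\langle v\rangle$; or if, for such a binder, a component of $q$ inputs $v$ on $w$ and $G$ does $q?\ell\langle v\rangle$. It outputs on $y\in\tilde y$ (inputs on $x\in\tilde x$) when a component of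 $r$ does so on the port linked by $F$. A *well-formed program* is a component without queued values and runtime protocol terms such that, at every level: the ports $\tilde x,\tilde y$ of the interface are pairwise distinct; a port is the output port of at most one local binder of a base component; the external ports of the forwarders are pairwise distinct and so are their internal ports; each $(q,w)$ occurs as receiver in at most one connection binder, each $(\ell,q)$ belongs to at most one binder with label $\ell$ and receiver $q$, and two binders have the same sender $(p,z)$ iff they have the same label; $G$ is closed; in each communication or choice $p\to\tilde q:\ell$ of $G$, $\tilde q$ is nonempty, $p\notin\tilde q$, and every binder of $D$ labelled $\ell$ has its sender at $p$ and its receiver in $\tilde q$; and whenever $\mu Y.H$ occurs in the body $K$ of $\mu X.K$ in $G$ and contains this $X$ free, every role of $K$ occurs in $H$. **Processes.** $P::=\mathbf 0\mid P|P\mid(\nu z)P\mid\mu X.P\mid X\mid z!o.P\mid z?(a).P\mid z\&(P,P)\mid \lfloor L\rfloor\mid(z\Leftarrow w)P\mid(z\Rightarrow w)P$, where $o$ is a variable or value, $\lfloor L\rfloor$ is a box of local binders, and $(z\Leftarrow w)P$ ($(z\Rightarrow w)P$) forwards inputs (outputs) of $P$ on $w$ as inputs (outputs) on $z$, blocks all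 other actions on $z,w$, and lets everything else pass. Boxes act as their binders (queue actions); the prefixes $z!v.P$, $z?(a).P$ and $z\&(P,Q)$ (which inputs $\mathtt{inl}$ and becomes $P$, or $\mathtt{inr}$ and becomes $Q$) perform primitive actions. A $\tau$ step arises between parallel processes from a queue action and the complementary primitive action on the same port with the same value. Transitions are closed under parallel composition, restriction of ports other than the subject, and unfolding of recursion; processes are taken up to $\alpha$-conversion. Structural congruence $\equiv$ is the least congruence with $\alpha$-conversion, the commutative monoid laws of $|$ and $\mathbf 0$, $(\nu z)\mathbf 0\equiv\mathbf 0$, $(\nu z)(\nu w)P\equiv(\nu w)(\nu z)P$, $(\nu z)P|Q\equiv(\nu z)(P|Q)$ for $z$ not free in $Q$, $\mu X.P\equiv P\{\mu X.P/X\}$, reordering of local binders in a box, and swapping of adjacent forwarders whose ports are distinct. **Encoding.** It is a partial operation, determined up to the choice of fresh names and the order of restrictions and of parallel components. Each component uses a mapping $\gamma$, injective on the relevant role-port pairs and role-label pairs, whose image $\tilde z$ on them is disjoint from $\tilde x,\tilde y$ and (for composites) from the interfaces of the assigned components. For a base component, with a dummy role $r$, the relevant pairs are $(r,x)$ for all ports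 $x$ of $L,\tilde x,\tilde y$, and $$[\![\,[\tilde x\rangle\tilde y]\{L\}\,]\!]=(\nu\tilde z)(x_1\Leftarrow\gamma(r,x_1))\cdots(y_1\Rightarrow\gamma(r,y_1))\cdots\lfloor\gamma(r,L)\rfloor .$$ For a composite with forwarders $w_i\leftarrow x_i$, $y_j\leftarrow z_j$ ($x_i\in\tilde x$, $y_j\in\tilde y$), the relevant pairs are the role-port and role-label pairs of $D$, those $(r,w_i),(r,z_j)$ of $F$, and those of the interfaces of the assigned components, and the encoding is $$(\nu\tilde z)(x_1\Leftarrow\gamma(r,w_1))\cdots(y_1\Rightarrow\gamma(r,z_1))\cdots\Big(\prod_{(s,C_s)\in R}[\![s=C_s]\!]_\gamma\ \Big|\ \prod_{p\in\mathrm{roles}(G)}[\![G]\!]_p\ \Big|\ \lfloor B\rfloor\Big).$$ Here $[\![s=C_s]\!]_\gamma=(\nu\tilde u,\tilde t)(\gamma(s,u_1)\Leftarrow u_1)\cdots(\gamma(s,t_1)\Rightarrow t_1)\cdots[\![C_s]\!]$ for $C_s$ with interface $\tilde u,\tilde t$. $B$ has the queue $\gamma(q,\ell)\langle\cdot\rangle\mathrm{id}(\gamma(p,\ell))$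 for each $\ell:q.w\leftarrow p.z$ in $D$, to which the values in transit in $G$ are appended, outermost first, for each role still to receive them: only the selected branch of a choice in transit is considered, and both branches of a choice not yet made must give the same result. The monitor $[\![G]\!]_p$ is, for the sender of a communication labelled $\ell$ with port $z$ in $D$, $\gamma(p,z)?(a).\gamma(p,\ell)!a.[\![G']\!]_p$ with continuation $G'$; for a receiver, pending or not, with port $w$ in $D$, $\gamma(p,\ell)?(a).\gamma(p,w)!a.[\![G']\!]_p$; and for any other role $[\![G']\!]_p$. For choices the monitors are the same with the input replaced by branching: $z'\&(u!\mathtt{inl}.[\![G_1]\!]_p,\ u!\mathtt{inr}.[\![G_2]\!]_p)$ with $z'=\gamma(p,z)$, $u=\gamma(p,\ell)$ for the sender and $z'=\gamma(p,\ell)$, $u=\gamma(p,w)$ for a receiver. For an uninvolved role of a choice not yet made, $[\![G_1]\!]_p$ and $[\![G_2]\!]_p$ must coincide and give the monitor; for a role not waiting in a choice in transit the monitor is that of the selected branch. Finally $[\![\mu X.G]\!]_p$ is $\mu X.[\![G]\!]_p$ if $p\in\mathrm{roles}(G)$ and $\mathbf 0$ otherwise, $[\![X]\!]_p=X$, and $[\![\mathbf{end}]\!]_p=\mathbf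 0$. **Proposition (Encoding Soundness).** Let $C$ be reachable, by any transitions, from a well-formed program, and suppose that $[\![C]\!]$ is defined. If $C\xrightarrow{\tau}C'$ then $[\![C']\!]$ is defined and there are processes $P_1,P_2$ with $$[\![C]\!]\xrightarrow{\tau}P_1\xrightarrow{\tau}P_2\equiv[\![C']\!].$$ Precisely: for every encoding of $C$ (every choice of names) there are such $P_1$, $P_2$ and an encoding of $C'$ with $P_2\equiv$ that encoding. -/

import Mathlib

namespace GC

universe u

/-! ### Names and values -/

/-- Ports (a countably infinite set of names). -/
abbrev Port := ℕ
/-- Roles of protocols. -/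
abbrev Role := ℕ
/-- Communication labels of protocols. -/
abbrev Label := ℕ
/-- Recursion variables, of protocols and of processes. -/
abbrev RecVar := ℕ
/-- Value variables, of processes. -/
abbrev Var := ℕ

/-- Values: the two selection constants and arbitrary further data. -/
inductive Val (V : Type u) : Type u
  | inl : Val V
  | inr : Val V
  | data : V → Val V

/-- Observable actions: the output `y!v` and the input `x?v`. -/
inductive Act (V : Type u) : Type u
  | out : Port → Val V → Act V
  | inp : Port → Val V → Act V

namespace Act
variable {V : Type u}

/-- The subject of an action. -/
def subj : Act V → Port
  | out y _ => y
  | inp x _ => x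

/-- The complementary action: outputs and inputs on the same port are exchanged. -/
def dual : Act V → Act V
  | out y v => inp y v
  | inp x v => out x v

end Act

/-! ### Local binders and their semantics -/

/-- A store: a finite partial map from ports to values, as an association list. -/
abbrev Store (V : Type u) := List (Port × Val V)

/-- The domain of a store. -/
def Store.dom {V : Type u} (σ : Store V) : List Port := σ.map Prod.fst

/-- A local binder: output port `out`, queue of stores `stores` (first store first), function
`fn` and its list of parameters `args`. -/
structure LBinder (V : Type u) : Type u where
  out : Port
  stores : List (Store V)
  fn : List (Val V) →. Val V
  args : List Port

namespace LBinder
variable {V : Type u}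

/-- Renaming of all ports of a local binder. -/
def rename (f : Port → Port) (b : LBinder V) : LBinder V where
  out := f b.out
  stores := b.stores.map fun σ => σ.map fun e => (f e.1, e.2)
  fn := b.fn
  args := b.args.map f

/-- The ports of a local binder. -/
def ports (b : LBinder V) : List Port :=
  b.out :: (b.args ++ b.stores.flatMap fun σ => Store.dom σ)

/-- Transitions of a single local binder. -/
inductive Step : LBinder V → Act V → LBinder V → Prop
  | const {y : Port} {f : List (Val V) →. Val V} {v : Val V} :
      v ∈ f [] → Step ⟨y, [], f, []⟩ (.out y v) ⟨y, [], f, []⟩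
  | out {y : Port} {σ : Store V} {σs : List (Store V)} {f : List (Val V) →. Val V}
      {xs : List Port} {vs : List (Val V)} {v : Val V} :
      xs ≠ [] → (∀ x, x ∈ xs ↔ x ∈ Store.dom σ) →
      List.Forall₂ (fun x w => List.lookup x σ = some w) xs vs → v ∈ f vs →
      Step ⟨y, σ :: σs, f, xs⟩ (.out y v) ⟨y, σs, f, xs⟩
  | inpNew {y : Port} {σs : List (Store V)} {f : List (Val V) →. Val V} {xs : List Port}
      {x : Port} {v : Val V} :
      (∀ σ ∈ σs, x ∈ Store.dom σ) → x ∈ xs →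
      Step ⟨y, σs, f, xs⟩ (.inp x v) ⟨y, σs ++ [[(x, v)]], f, xs⟩
  | inpUpd {y : Port} {σs₁ σs₂ : List (Store V)} {σ : Store V} {f : List (Val V) →. Val V}
      {xs : List Port} {x : Port} {v : Val V} :
      (∀ τ ∈ σs₁, x ∈ Store.dom τ) → x ∉ Store.dom σ → x ∈ xs →
      Step ⟨y, σs₁ ++ σ :: σs₂, f, xs⟩ (.inp x v) ⟨y, σs₁ ++ ((x, v) :: σ) :: σs₂, f, xs⟩
  | inpDisc {b : LBinder V} {x : Port} {v : Val V} :
      x ∉ b.args → Step b (.inp x v) b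

end LBinder

/-- Transitions of a collection of local binders: one binder outputs, all binders input. -/
inductive LStep {V : Type u} : List (LBinder V) → Act V → List (LBinder V) → Prop
  | out {L₁ L₂ : List (LBinder V)} {b b' : LBinder V} {y : Port} {v : Val V} :
      LBinder.Step b (.out y v) b' → LStep (L₁ ++ b :: L₂) (.out y v) (L₁ ++ b' :: L₂)
  | inp {L L' : List (LBinder V)} {x : Port} {v : Val V} :
      List.Forall₂ (fun b b' => LBinder.Step b (.inp x v) b') L L' → LStep L (.inp x v) L'

/-! ### Protocols and their semantics -/

/-- Protocols, including the runtime terms `comT` and `choiceT`, in which the value has been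
sent and is still to be received by the listed roles. -/
inductive Proto (V : Type u) : Type u
  | com : Role → Label → Finset Role → Proto V → Proto V
  | choice : Role → Label → Finset Role → Proto V → Proto V → Proto V
  | mu : RecVar → Proto V → Proto V
  | var : RecVar → Proto V
  | done : Proto V
  | comT : Label → Val V → Finset Role → Proto V → Proto V
  | choiceT : Label → Val V → Finset Role → Proto V → Proto V → Proto V

namespace Proto
variable {V : Type u}

/-- The roles that occur in a protocol. -/
def roles : Proto V → Finset Role
  | com p _ Q G => insert p (Q ∪ G.roles)
  | choice p _ Q G₁ G₂ => insert p (Q ∪ (G₁.roles ∪ G₂.roles))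
  | mu _ G => G.roles
  | var _ => ∅
  | done => ∅
  | comT _ _ Q G => Q ∪ G.roles
  | choiceT _ _ Q G₁ G₂ => Q ∪ (G₁.roles ∪ G₂.roles)

/-- The free recursion variables of a protocol. -/
def freeVars : Proto V → Finset RecVar
  | com _ _ _ G => G.freeVars
  | choice _ _ _ G₁ G₂ => G₁.freeVars ∪ G₂.freeVars
  | mu X G => G.freeVars.erase X
  | var X => {X}
  | done => ∅
  | comT _ _ _ G => G.freeVars
  | choiceT _ _ _ G₁ G₂ => G₁.freeVars ∪ G₂.freeVars

/-- `subst X H G` is `G` with `H` for the free occurrences of `X`; `H` is meant to be closed. -/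
def subst (X : RecVar) (H : Proto V) : Proto V → Proto V
  | com p l Q G => com p l Q (subst X H G)
  | choice p l Q G₁ G₂ => choice p l Q (subst X H G₁) (subst X H G₂)
  | mu Y G => if Y = X then mu Y G else mu Y (subst X H G)
  | var Y => if Y = X then H else var Y
  | done => done
  | comT l v Q G => comT l v Q (subst X H G)
  | choiceT l v Q G₁ G₂ => choiceT l v Q (subst X H G₁) (subst X H G₂)

/-- No runtime term occurs. -/
def Static : Proto V → Prop
  | com _ _ _ G => G.Static
  | choice _ _ _ G₁ G₂ => G₁.Static ∧ G₂.Static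
  | mu _ G => G.Static
  | var _ => True
  | done => True
  | comT _ _ _ _ => False
  | choiceT _ _ _ _ _ => False

/-- `S p l Q` holds for each communication and choice from `p` to `Q` labelled `l` in the
protocol. -/
def ForallCom (S : Role → Label → Finset Role → Prop) : Proto V → Prop
  | com p l Q G => S p l Q ∧ G.ForallCom S
  | choice p l Q G₁ G₂ => S p l Q ∧ G₁.ForallCom S ∧ G₂.ForallCom S
  | mu _ G => G.ForallCom S
  | var _ => True
  | done => True
  | comT _ _ _ G => G.ForallCom S
  | choiceT _ _ _ G₁ G₂ => G₁.ForallCom S ∧ G₂.ForallCom S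

/-- Each recursion `mu Y H` within the given term that can jump back to `X` (free in it)
involves all the roles in `S`. -/
def JumpsInvolve (X : RecVar) (S : Finset Role) : Proto V → Prop
  | com _ _ _ G => G.JumpsInvolve X S
  | choice _ _ _ G₁ G₂ => G₁.JumpsInvolve X S ∧ G₂.JumpsInvolve X S
  | mu Y H => Y = X ∨ ((X ∈ H.freeVars → S ⊆ H.roles) ∧ H.JumpsInvolve X S)
  | var _ => True
  | done => True
  | comT _ _ _ G => G.JumpsInvolve X S
  | choiceT _ _ _ G₁ G₂ => G₁.JumpsInvolve X S ∧ G₂.JumpsInvolve X S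

/-- Whenever a recursion `mu Y H` inside the body `G` of a recursion `mu X G` has `X` free, all
the roles of `G` occur in `H`. -/
def RecOK : Proto V → Prop
  | com _ _ _ G => G.RecOK
  | choice _ _ _ G₁ G₂ => G₁.RecOK ∧ G₂.RecOK
  | mu X G => G.JumpsInvolve X G.roles ∧ G.RecOK
  | var _ => True
  | done => True
  | comT _ _ _ G => G.RecOK
  | choiceT _ _ _ G₁ G₂ => G₁.RecOK ∧ G₂.RecOK

end Proto

/-- Protocol labels: role `p` sends, or receives, `v` on the interaction labelled `l`. -/
inductive PAct (V : Type u) : Type u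
  | send : Role → Label → Val V → PAct V
  | recv : Role → Label → Val V → PAct V

/-- The role of a protocol label. -/
def PAct.role {V : Type u} : PAct V → Role
  | send p _ _ => p
  | recv q _ _ => q

/-- Transitions of protocols. -/
inductive Proto.Step {V : Type u} : Proto V → PAct V → Proto V → Prop
  | sVal {p : Role} {l : Label} {Q : Finset Role} {G : Proto V} {v : Val V} :
      Step (.com p l Q G) (.send p l v) (.comT l v Q G)
  | sChoice {p : Role} {l : Label} {Q : Finset Role} {G₁ G₂ : Proto V} {v : Val V} :
      v = .inl ∨ v = .inr →
      Step (.choice p l Q G₁ G₂) (.send p l v) (.choiceT l v Q G₁ G₂)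
  | rVal {q : Role} {l : Label} {Q : Finset Role} {G : Proto V} {v : Val V} :
      q ∈ Q → (Q.erase q).Nonempty →
      Step (.comT l v Q G) (.recv q l v) (.comT l v (Q.erase q) G)
  | rVal2 {q : Role} {l : Label} {G : Proto V} {v : Val V} :
      Step (.comT l v {q} G) (.recv q l v) G
  | rChoice {q : Role} {l : Label} {Q : Finset Role} {G₁ G₂ : Proto V} {v : Val V} :
      q ∈ Q → (Q.erase q).Nonempty →
      Step (.choiceT l v Q G₁ G₂) (.recv q l v) (.choiceT l v (Q.erase q) G₁ G₂)
  | rChoiceL {q : Role} {l : Label} {G₁ G₂ : Proto V} :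
      Step (.choiceT l .inl {q} G₁ G₂) (.recv q l .inl) G₁
  | rChoiceR {q : Role} {l : Label} {G₁ G₂ : Proto V} :
      Step (.choiceT l .inr {q} G₁ G₂) (.recv q l .inr) G₂
  | unfold {X : RecVar} {G G' : Proto V} {α : PAct V} :
      Step (Proto.subst X (.mu X G) G) α G' → Step (.mu X G) α G'
  | conc1 {p : Role} {l : Label} {Q : Finset Role} {G G' : Proto V} {α : PAct V} :
      Step G α G' → α.role ≠ p → α.role ∉ Q → Step (.com p l Q G) α (.com p l Q G')
  | conc2 {p : Role} {l : Label} {Q : Finset Role} {G₁ G₂ G₁' G₂' : Proto V} {α : PAct V} :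
      Step G₁ α G₁' → Step G₂ α G₂' → α.role ≠ p → α.role ∉ Q →
      Step (.choice p l Q G₁ G₂) α (.choice p l Q G₁' G₂')
  | conc3 {l : Label} {v : Val V} {Q : Finset Role} {G G' : Proto V} {α : PAct V} :
      Step G α G' → α.role ∉ Q → Step (.comT l v Q G) α (.comT l v Q G')
  | conc4 {l : Label} {Q : Finset Role} {G₁ G₂ G₁' : Proto V} {α : PAct V} :
      Step G₁ α G₁' → α.role ∉ Q →
      Step (.choiceT l .inl Q G₁ G₂) α (.choiceT l .inl Q G₁' G₂)
  | conc5 {l : Label} {Q : Finset Role} {G₁ G₂ G₂' : Proto V} {α : PAct V} :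
      Step G₂ α G₂' → α.role ∉ Q →
      Step (.choiceT l .inr Q G₁ G₂) α (.choiceT l .inr Q G₁ G₂')

/-! ### Components and their semantics -/

/-- The connection binder that realises the interaction `label` by connecting the output port
`sendPort` of role `send` with the input port `recvPort` of role `recv`. -/
structure CBinder where
  label : Label
  recv : Role
  recvPort : Port
  send : Role
  sendPort : Port

/-- A forwarder, with flow from `src` to `dst`. For input forwarders `src` is an input port of
the composite and `dst` an input port of the subcomponent; for output forwarders `src` is an
output port of the subcomponent and `dst` an output port of the composite. -/
structure Fwd where
  dst : Port
  src : Port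

/-- Components. `base xs ys L` has input ports `xs`, output ports `ys` and local binders `L`.
`comp xs ys D r Fi Fo R G` is the composite with connection binders `D`, forwarders of role `r`
(input forwarders `Fi`, output forwarders `Fo`), role assignments `R` and protocol `G`. -/
inductive Comp (V : Type u) : Type u
  | base (xs ys : List Port) (L : List (LBinder V)) : Comp V
  | comp (xs ys : List Port) (D : List CBinder) (r : Role) (Fi Fo : List Fwd)
      (R : List (Role × Comp V)) (G : Proto V) : Comp V

namespace Comp
variable {V : Type u}

/-- The input ports of a component. -/
def inputs : Comp V → List Port
  | base xs _ _ => xs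
  | comp xs _ _ _ _ _ _ _ => xs

/-- The output ports of a component. -/
def outputs : Comp V → List Port
  | base _ ys _ => ys
  | comp _ ys _ _ _ _ _ _ => ys

end Comp

/-- Labels of component transitions. -/
inductive CLabel (V : Type u) : Type u
  | act : Act V → CLabel V
  | tau : CLabel V

/-- Transitions of components. -/
inductive Comp.Step {V : Type u} : Comp V → CLabel V → Comp V → Prop
  | outBase {xs ys : List Port} {L L' : List (LBinder V)} {y : Port} {v : Val V} :
      LStep L (.out y v) L' → y ∈ ys →
      Step (.base xs ys L) (.act (.out y v)) (.base xs ys L')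
  | inpBase {xs ys : List Port} {L L' : List (LBinder V)} {x : Port} {v : Val V} :
      LStep L (.inp x v) L' → x ∈ xs →
      Step (.base xs ys L) (.act (.inp x v)) (.base xs ys L')
  | outChor {xs ys : List Port} {D : List CBinder} {r : Role} {Fi Fo : List Fwd}
      {R₁ R₂ : List (Role × Comp V)} {G G' : Proto V} {b : CBinder} {C C' : Comp V}
      {v : Val V} :
      Step C (.act (.out b.sendPort v)) C' → b ∈ D →
      Proto.Step G (.send b.send b.label v) G' →
      Step (.comp xs ys D r Fi Fo (R₁ ++ (b.send, C) :: R₂) G) .tau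
        (.comp xs ys D r Fi Fo (R₁ ++ (b.send, C') :: R₂) G')
  | inpChor {xs ys : List Port} {D : List CBinder} {r : Role} {Fi Fo : List Fwd}
      {R₁ R₂ : List (Role × Comp V)} {G G' : Proto V} {b : CBinder} {C C' : Comp V}
      {v : Val V} :
      Step C (.act (.inp b.recvPort v)) C' → b ∈ D →
      Proto.Step G (.recv b.recv b.label v) G' →
      Step (.comp xs ys D r Fi Fo (R₁ ++ (b.recv, C) :: R₂) G) .tau
        (.comp xs ys D r Fi Fo (R₁ ++ (b.recv, C') :: R₂) G')
  | internal {xs ys : List Port} {D : List CBinder} {r s : Role} {Fi Fo : List Fwd}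
      {R₁ R₂ : List (Role × Comp V)} {G : Proto V} {C C' : Comp V} :
      Step C .tau C' →
      Step (.comp xs ys D r Fi Fo (R₁ ++ (s, C) :: R₂) G) .tau
        (.comp xs ys D r Fi Fo (R₁ ++ (s, C') :: R₂) G)
  | outComp {xs ys : List Port} {D : List CBinder} {r : Role} {Fi Fo : List Fwd}
      {R₁ R₂ : List (Role × Comp V)} {G : Proto V} {f : Fwd} {C C' : Comp V} {v : Val V} :
      Step C (.act (.out f.src v)) C' → f ∈ Fo → f.dst ∈ ys →
      Step (.comp xs ys D r Fi Fo (R₁ ++ (r, C) :: R₂) G) (.act (.out f.dst v))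
        (.comp xs ys D r Fi Fo (R₁ ++ (r, C') :: R₂) G)
  | inpComp {xs ys : List Port} {D : List CBinder} {r : Role} {Fi Fo : List Fwd}
      {R₁ R₂ : List (Role × Comp V)} {G : Proto V} {f : Fwd} {C C' : Comp V} {v : Val V} :
      Step C (.act (.inp f.dst v)) C' → f ∈ Fi → f.src ∈ xs →
      Step (.comp xs ys D r Fi Fo (R₁ ++ (r, C) :: R₂) G) (.act (.inp f.src v))
        (.comp xs ys D r Fi Fo (R₁ ++ (r, C') :: R₂) G)

/-! ### Well-formed programs -/

/-- Connection binders use each receiver port at most once, have at most one binder per label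
and receiving role, and pair labels and sender ports one to one. -/
structure BindersOK (D : List CBinder) : Prop where
  recvPort_once : (D.map fun b => (b.recv, b.recvPort)).Nodup
  recv_once : (D.map fun b => (b.label, b.recv)).Nodup
  send_iff : ∀ b ∈ D, ∀ b' ∈ D,
    (b.send = b'.send ∧ b.sendPort = b'.sendPort) ↔ b.label = b'.label

/-- Well-formedness of a source protocol relative to the connection binders. -/
structure ProtoOK {V : Type u} (D : List CBinder) (G : Proto V) : Prop where
  static : G.Static
  closed : G.freeVars = ∅
  recOK : G.RecOK
  coms : G.ForallCom fun p l Q =>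
    Q.Nonempty ∧ p ∉ Q ∧ ∀ b ∈ D, b.label = l → b.send = p ∧ b.recv ∈ Q

/-- Well-formed source programs: components without runtime terms (no values are queued in local
binders or in transit in protocols) that satisfy the structural constraints at every level. -/
inductive Program {V : Type u} : Comp V → Prop
  | base {xs ys : List Port} {L : List (LBinder V)} :
      (xs ++ ys).Nodup → (L.map LBinder.out).Nodup → (∀ b ∈ L, b.stores = []) →
      Program (.base xs ys L)
  | comp {xs ys : List Port} {D : List CBinder} {r : Role} {Fi Fo : List Fwd}
      {R : List (Role × Comp V)} {G : Proto V} :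
      (xs ++ ys).Nodup →
      (Fi.map Fwd.src ++ Fo.map Fwd.dst).Nodup → (Fi.map Fwd.dst ++ Fo.map Fwd.src).Nodup →
      BindersOK D → ProtoOK D G → (∀ a ∈ R, Program a.2) →
      Program (.comp xs ys D r Fi Fo R G)

/-- `C` is reachable from `C₀` by any transitions. -/
def Reaches {V : Type u} (C₀ C : Comp V) : Prop :=
  Relation.ReflTransGen (fun A B => ∃ l, Comp.Step A l B) C₀ C

/-! ### Target processes -/

/-- Objects of output prefixes: variables and values. -/
inductive Obj (V : Type u) : Type u
  | var : Var → Obj V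
  | val : Val V → Obj V

/-- Processes. `fwdOut z w P` forwards the outputs of `P` on `w` as outputs on `z`, and
`fwdIn z w P` forwards the inputs of `P` on `w` as inputs on `z`; neither binds a name. -/
inductive Proc (V : Type u) : Type u
  | nil : Proc V
  | par : Proc V → Proc V → Proc V
  | nu : Port → Proc V → Proc V
  | mu : RecVar → Proc V → Proc V
  | var : RecVar → Proc V
  | out : Port → Obj V → Proc V → Proc V
  | inp : Port → Var → Proc V → Proc V
  | branch : Port → Proc V → Proc V → Proc V
  | box : List (LBinder V) → Proc V
  | fwdOut : Port → Port → Proc V → Proc V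
  | fwdIn : Port → Port → Proc V → Proc V

namespace Obj
variable {V : Type u}

/-- Renaming of variables in an object. -/
def rename (g : Var → Var) : Obj V → Obj V
  | var a => var (g a)
  | val v => val v

/-- Substitution of a value for a variable in an object. -/
def subst (a : Var) (v : Val V) : Obj V → Obj V
  | var b => if b = a then val v else var b
  | val w => val w

/-- The variables of an object. -/
def vars : Obj V → Set Var
  | var a => {a}
  | val _ => ∅

end Obj

namespace Proc
variable {V : Type u}

/-- Free ports. -/
def freePorts : Proc V → Set Port
  | nil => ∅
  | par P Q => P.freePorts ∪ Q.freePorts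
  | nu z P => P.freePorts \ {z}
  | mu _ P => P.freePorts
  | var _ => ∅
  | out z _ P => insert z P.freePorts
  | inp z _ P => insert z P.freePorts
  | branch z P Q => insert z (P.freePorts ∪ Q.freePorts)
  | box L => {x | ∃ b ∈ L, x ∈ b.ports}
  | fwdOut z w P => insert z (insert w P.freePorts)
  | fwdIn z w P => insert z (insert w P.freePorts)

/-- Free value variables. -/
def freeVars : Proc V → Set Var
  | nil => ∅
  | par P Q => P.freeVars ∪ Q.freeVars
  | nu _ P => P.freeVars
  | mu _ P => P.freeVars
  | var _ => ∅
  | out _ o P => o.vars ∪ P.freeVars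
  | inp _ a P => P.freeVars \ {a}
  | branch _ P Q => P.freeVars ∪ Q.freeVars
  | box _ => ∅
  | fwdOut _ _ P => P.freeVars
  | fwdIn _ _ P => P.freeVars

/-- Free recursion variables. -/
def freeRecVars : Proc V → Set RecVar
  | nil => ∅
  | par P Q => P.freeRecVars ∪ Q.freeRecVars
  | nu _ P => P.freeRecVars
  | mu X P => P.freeRecVars \ {X}
  | var X => {X}
  | out _ _ P => P.freeRecVars
  | inp _ _ P => P.freeRecVars
  | branch _ P Q => P.freeRecVars ∪ Q.freeRecVars
  | box _ => ∅
  | fwdOut _ _ P => P.freeRecVars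
  | fwdIn _ _ P => P.freeRecVars

/-- Renaming of all names, free and bound: ports by `f`, variables by `g`, recursion variables
by `h`. It is used for transpositions, for which it respects binding. -/
def rename (f : Port → Port) (g : Var → Var) (h : RecVar → RecVar) : Proc V → Proc V
  | nil => nil
  | par P Q => par (rename f g h P) (rename f g h Q)
  | nu z P => nu (f z) (rename f g h P)
  | mu X P => mu (h X) (rename f g h P)
  | var X => var (h X)
  | out z o P => out (f z) (o.rename g) (rename f g h P)
  | inp z a P => inp (f z) (g a) (rename f g h P)
  | branch z P Q => branch (f z) (rename f g h P) (rename f g h Q)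
  | box L => box (L.map (LBinder.rename f))
  | fwdOut z w P => fwdOut (f z) (f w) (rename f g h P)
  | fwdIn z w P => fwdIn (f z) (f w) (rename f g h P)

/-- Substitution of a value for the free occurrences of a variable. -/
def substVal (a : Var) (v : Val V) : Proc V → Proc V
  | nil => nil
  | par P Q => par (substVal a v P) (substVal a v Q)
  | nu z P => nu z (substVal a v P)
  | mu X P => mu X (substVal a v P)
  | var X => var X
  | out z o P => out z (o.subst a v) (substVal a v P)
  | inp z b P => if b = a then inp z b P else inp z b (substVal a v P)
  | branch z P Q => branch z (substVal a v P) (substVal a v Q)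
  | box L => box L
  | fwdOut z w P => fwdOut z w (substVal a v P)
  | fwdIn z w P => fwdIn z w (substVal a v P)

end Proc

/-- `SubstRec X Q P P'`: replacing the free occurrences of `X` in `P` by `Q` captures no free
name of `Q` and yields `P'`. When a name would be captured, `P` has to be alpha-converted
first. -/
inductive SubstRec {V : Type u} (X : RecVar) (Q : Proc V) : Proc V → Proc V → Prop
  | nil : SubstRec X Q .nil .nil
  | par {P₁ P₂ P₁' P₂' : Proc V} :
      SubstRec X Q P₁ P₁' → SubstRec X Q P₂ P₂' → SubstRec X Q (.par P₁ P₂) (.par P₁' P₂')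
  | nu {z : Port} {P P' : Proc V} :
      z ∉ Q.freePorts → SubstRec X Q P P' → SubstRec X Q (.nu z P) (.nu z P')
  | muSame {P : Proc V} : SubstRec X Q (.mu X P) (.mu X P)
  | mu {Y : RecVar} {P P' : Proc V} :
      Y ≠ X → Y ∉ Q.freeRecVars → SubstRec X Q P P' → SubstRec X Q (.mu Y P) (.mu Y P')
  | varSame : SubstRec X Q (.var X) Q
  | var {Y : RecVar} : Y ≠ X → SubstRec X Q (.var Y) (.var Y)
  | out {z : Port} {o : Obj V} {P P' : Proc V} :
      SubstRec X Q P P' → SubstRec X Q (.out z o P) (.out z o P')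
  | inp {z : Port} {a : Var} {P P' : Proc V} :
      a ∉ Q.freeVars → SubstRec X Q P P' → SubstRec X Q (.inp z a P) (.inp z a P')
  | branch {z : Port} {P₁ P₂ P₁' P₂' : Proc V} :
      SubstRec X Q P₁ P₁' → SubstRec X Q P₂ P₂' →
      SubstRec X Q (.branch z P₁ P₂) (.branch z P₁' P₂')
  | box {L : List (LBinder V)} : SubstRec X Q (.box L) (.box L)
  | fwdOut {z w : Port} {P P' : Proc V} :
      SubstRec X Q P P' → SubstRec X Q (.fwdOut z w P) (.fwdOut z w P')
  | fwdIn {z w : Port} {P P' : Proc V} :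
      SubstRec X Q P P' → SubstRec X Q (.fwdIn z w P) (.fwdIn z w P')

/-- The least congruence that contains `A`. -/
inductive Cong {V : Type u} (A : Proc V → Proc V → Prop) : Proc V → Proc V → Prop
  | ax {P Q : Proc V} : A P Q → Cong A P Q
  | refl (P : Proc V) : Cong A P P
  | symm {P Q : Proc V} : Cong A P Q → Cong A Q P
  | trans {P Q R : Proc V} : Cong A P Q → Cong A Q R → Cong A P R
  | par {P P' Q Q' : Proc V} : Cong A P P' → Cong A Q Q' → Cong A (.par P Q) (.par P' Q')
  | nu {z : Port} {P P' : Proc V} : Cong A P P' → Cong A (.nu z P) (.nu z P')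
  | mu {X : RecVar} {P P' : Proc V} : Cong A P P' → Cong A (.mu X P) (.mu X P')
  | out {z : Port} {o : Obj V} {P P' : Proc V} :
      Cong A P P' → Cong A (.out z o P) (.out z o P')
  | inp {z : Port} {a : Var} {P P' : Proc V} :
      Cong A P P' → Cong A (.inp z a P) (.inp z a P')
  | branch {z : Port} {P P' Q Q' : Proc V} :
      Cong A P P' → Cong A Q Q' → Cong A (.branch z P Q) (.branch z P' Q')
  | fwdOut {z w : Port} {P P' : Proc V} :
      Cong A P P' → Cong A (.fwdOut z w P) (.fwdOut z w P')
  | fwdIn {z w : Port} {P P' : Proc V} :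
      Cong A P P' → Cong A (.fwdIn z w P) (.fwdIn z w P')

/-- Renaming of a bound name to a fresh one. -/
inductive AlphaAx {V : Type u} : Proc V → Proc V → Prop
  | nu {z z' : Port} {P : Proc V} : z' ∉ P.freePorts →
      AlphaAx (.nu z P) (.nu z' (P.rename (Equiv.swap z z') id id))
  | inp {z : Port} {a b : Var} {P : Proc V} : b ∉ P.freeVars →
      AlphaAx (.inp z a P) (.inp z b (P.rename id (Equiv.swap a b) id))
  | mu {X Y : RecVar} {P : Proc V} : Y ∉ P.freeRecVars →
      AlphaAx (.mu X P) (.mu Y (P.rename id id (Equiv.swap X Y)))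

/-- Alpha-equivalence. -/
def AlphaEq {V : Type u} : Proc V → Proc V → Prop := Cong AlphaAx

/-- The axioms of structural congruence. -/
inductive StructAx {V : Type u} : Proc V → Proc V → Prop
  | alpha {P Q : Proc V} : AlphaAx P Q → StructAx P Q
  | parComm {P Q : Proc V} : StructAx (.par P Q) (.par Q P)
  | parAssoc {P Q R : Proc V} : StructAx (.par (.par P Q) R) (.par P (.par Q R))
  | parNil {P : Proc V} : StructAx (.par P .nil) P
  | nuNil {z : Port} : StructAx (.nu z .nil) .nil
  | nuComm {z w : Port} {P : Proc V} : StructAx (.nu z (.nu w P)) (.nu w (.nu z P))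
  | nuPar {z : Port} {P Q : Proc V} : z ∉ Q.freePorts →
      StructAx (.par (.nu z P) Q) (.nu z (.par P Q))
  | unfold {X : RecVar} {P P' : Proc V} : SubstRec X (.mu X P) P P' →
      StructAx (.mu X P) P'
  | boxPerm {L L' : List (LBinder V)} : L.Perm L' → StructAx (.box L) (.box L')
  | fwdInIn {z w z' w' : Port} {P : Proc V} : z ≠ z' → z ≠ w' → w ≠ z' → w ≠ w' →
      StructAx (.fwdIn z w (.fwdIn z' w' P)) (.fwdIn z' w' (.fwdIn z w P))
  | fwdOutOut {z w z' w' : Port} {P : Proc V} : z ≠ z' → z ≠ w' → w ≠ z' → w ≠ w' →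
      StructAx (.fwdOut z w (.fwdOut z' w' P)) (.fwdOut z' w' (.fwdOut z w P))
  | fwdInOut {z w z' w' : Port} {P : Proc V} : z ≠ z' → z ≠ w' → w ≠ z' → w ≠ w' →
      StructAx (.fwdIn z w (.fwdOut z' w' P)) (.fwdOut z' w' (.fwdIn z w P))

/-- Structural congruence. -/
def StructCong {V : Type u} : Proc V → Proc V → Prop := Cong StructAx

/-- Labels of process transitions: actions of queues, (overlined) actions of communication
primitives, and internal moves. -/
inductive PLabel (V : Type u) : Type u
  | queue : Act V → PLabel V
  | prim : Act V → PLabel V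
  | tau : PLabel V

/-- The port `z` is not the subject of the label; internal moves have no subject. -/
def PLabel.Avoids {V : Type u} (z : Port) : PLabel V → Prop
  | queue a => a.subj ≠ z
  | prim a => a.subj ≠ z
  | tau => True

/-- Transitions of processes. A communication primitive synchronises with the complementary
action of a queue. -/
inductive Proc.Step {V : Type u} : Proc V → PLabel V → Proc V → Prop
  | alpha {P P' Q : Proc V} {l : PLabel V} : AlphaEq P P' → Step P' l Q → Step P l Q
  | act {L L' : List (LBinder V)} {a : Act V} :
      LStep L a L' → Step (.box L) (.queue a) (.box L')
  | res {z : Port} {P Q : Proc V} {l : PLabel V} :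
      Step P l Q → l.Avoids z → Step (.nu z P) l (.nu z Q)
  | parL {P Q R : Proc V} {l : PLabel V} : Step P l Q → Step (.par P R) l (.par Q R)
  | parR {P Q R : Proc V} {l : PLabel V} : Step P l Q → Step (.par R P) l (.par R Q)
  | comL {P P' Q Q' : Proc V} {a : Act V} :
      Step P (.queue a) P' → Step Q (.prim a.dual) Q' →
      Step (.par P Q) .tau (.par P' Q')
  | comR {P P' Q Q' : Proc V} {a : Act V} :
      Step P (.prim a.dual) P' → Step Q (.queue a) Q' →
      Step (.par P Q) .tau (.par P' Q')
  | unfold {X : RecVar} {P P' Q : Proc V} {l : PLabel V} :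
      SubstRec X (.mu X P) P P' → Step P' l Q → Step (.mu X P) l Q
  | fwd1 {z w : Port} {P Q : Proc V} {l : PLabel V} :
      Step P l Q → l.Avoids z → l.Avoids w → Step (.fwdIn z w P) l (.fwdIn z w Q)
  | fwd2 {z w : Port} {P Q : Proc V} {l : PLabel V} :
      Step P l Q → l.Avoids z → l.Avoids w → Step (.fwdOut z w P) l (.fwdOut z w Q)
  | fwdInp {z w : Port} {P Q : Proc V} {v : Val V} :
      Step P (.queue (.inp w v)) Q → Step (.fwdIn z w P) (.queue (.inp z v)) (.fwdIn z w Q)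
  | fwdOut {z w : Port} {P Q : Proc V} {v : Val V} :
      Step P (.queue (.out w v)) Q → Step (.fwdOut z w P) (.queue (.out z v)) (.fwdOut z w Q)
  | fwdInp2 {z w : Port} {P Q : Proc V} {v : Val V} :
      Step P (.prim (.inp w v)) Q → Step (.fwdIn z w P) (.prim (.inp z v)) (.fwdIn z w Q)
  | fwdOut2 {z w : Port} {P Q : Proc V} {v : Val V} :
      Step P (.prim (.out w v)) Q → Step (.fwdOut z w P) (.prim (.out z v)) (.fwdOut z w Q)
  | out {z : Port} {v : Val V} {P : Proc V} :
      Step (.out z (.val v) P) (.prim (.out z v)) P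
  | inp {z : Port} {a : Var} {P : Proc V} {v : Val V} :
      Step (.inp z a P) (.prim (.inp z v)) (P.substVal a v)
  | choL {z : Port} {P Q : Proc V} : Step (.branch z P Q) (.prim (.inp z .inl)) P
  | choR {z : Port} {P Q : Proc V} : Step (.branch z P Q) (.prim (.inp z .inr)) Q

/-! ### The encoding -/

/-- A mapping of role-port pairs and role-label pairs to ports; only its values on the relevant
finite set of pairs matter. -/
abbrev Naming := Role → Port ⊕ Label → Port

/-- The image of the role-port pair `(p, z)`. -/
abbrev Naming.port (γ : Naming) (p : Role) (z : Port) : Port := γ p (.inl z)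

/-- The image of the role-label pair `(p, l)`. -/
abbrev Naming.lab (γ : Naming) (p : Role) (l : Label) : Port := γ p (.inr l)

/-- `EncProto D γ r G P`: the encoding of the protocol `G` for role `r`, with connection binders
`D` and mapping `γ`, is defined and equal to `P`. -/
inductive EncProto {V : Type u} (D : List CBinder) (γ : Naming) (r : Role) :
    Proto V → Proc V → Prop
  | comSend {l : Label} {Q : Finset Role} {G : Proto V} {P : Proc V} {b : CBinder} :
      b ∈ D → b.label = l → b.send = r → EncProto D γ r G P →
      EncProto D γ r (.com r l Q G)
        (.inp (γ.port r b.sendPort) 0 (.out (γ.lab r l) (.var 0) P))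
  | comRecv {p : Role} {l : Label} {Q : Finset Role} {G : Proto V} {P : Proc V}
      {b : CBinder} :
      r ∈ Q → b ∈ D → b.label = l → b.recv = r → b.send = p → EncProto D γ r G P →
      EncProto D γ r (.com p l Q G)
        (.inp (γ.lab r l) 0 (.out (γ.port r b.recvPort) (.var 0) P))
  | comOther {p : Role} {l : Label} {Q : Finset Role} {G : Proto V} {P : Proc V} :
      r ≠ p → r ∉ Q → EncProto D γ r G P → EncProto D γ r (.com p l Q G) P
  | comTRecv {l : Label} {v : Val V} {Q : Finset Role} {G : Proto V} {P : Proc V}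
      {b : CBinder} :
      r ∈ Q → b ∈ D → b.label = l → b.recv = r → EncProto D γ r G P →
      EncProto D γ r (.comT l v Q G)
        (.inp (γ.lab r l) 0 (.out (γ.port r b.recvPort) (.var 0) P))
  | comTOther {l : Label} {v : Val V} {Q : Finset Role} {G : Proto V} {P : Proc V} :
      r ∉ Q → EncProto D γ r G P → EncProto D γ r (.comT l v Q G) P
  | choiceSend {l : Label} {Q : Finset Role} {G₁ G₂ : Proto V} {P₁ P₂ : Proc V}
      {b : CBinder} :
      b ∈ D → b.label = l → b.send = r → EncProto D γ r G₁ P₁ → EncProto D γ r G₂ P₂ →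
      EncProto D γ r (.choice r l Q G₁ G₂)
        (.branch (γ.port r b.sendPort) (.out (γ.lab r l) (.val .inl) P₁)
          (.out (γ.lab r l) (.val .inr) P₂))
  | choiceRecv {p : Role} {l : Label} {Q : Finset Role} {G₁ G₂ : Proto V} {P₁ P₂ : Proc V}
      {b : CBinder} :
      r ∈ Q → b ∈ D → b.label = l → b.recv = r → b.send = p →
      EncProto D γ r G₁ P₁ → EncProto D γ r G₂ P₂ →
      EncProto D γ r (.choice p l Q G₁ G₂)
        (.branch (γ.lab r l) (.out (γ.port r b.recvPort) (.val .inl) P₁)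
          (.out (γ.port r b.recvPort) (.val .inr) P₂))
  | choiceOther {p : Role} {l : Label} {Q : Finset Role} {G₁ G₂ : Proto V} {P : Proc V} :
      r ≠ p → r ∉ Q → EncProto D γ r G₁ P → EncProto D γ r G₂ P →
      EncProto D γ r (.choice p l Q G₁ G₂) P
  | choiceTRecv {l : Label} {v : Val V} {Q : Finset Role} {G₁ G₂ : Proto V}
      {P₁ P₂ : Proc V} {b : CBinder} :
      r ∈ Q → b ∈ D → b.label = l → b.recv = r →
      EncProto D γ r G₁ P₁ → EncProto D γ r G₂ P₂ →
      EncProto D γ r (.choiceT l v Q G₁ G₂)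
        (.branch (γ.lab r l) (.out (γ.port r b.recvPort) (.val .inl) P₁)
          (.out (γ.port r b.recvPort) (.val .inr) P₂))
  | choiceTL {l : Label} {Q : Finset Role} {G₁ G₂ : Proto V} {P : Proc V} :
      r ∉ Q → EncProto D γ r G₁ P → EncProto D γ r (.choiceT l .inl Q G₁ G₂) P
  | choiceTR {l : Label} {Q : Finset Role} {G₁ G₂ : Proto V} {P : Proc V} :
      r ∉ Q → EncProto D γ r G₂ P → EncProto D γ r (.choiceT l .inr Q G₁ G₂) P
  | muIn {X : RecVar} {G : Proto V} {P : Proc V} :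
      r ∈ G.roles → EncProto D γ r G P → EncProto D γ r (.mu X G) (.mu X P)
  | muOut {X : RecVar} {G : Proto V} : r ∉ G.roles → EncProto D γ r (.mu X G) .nil
  | var {X : RecVar} : EncProto D γ r (.var X) (.var X)
  | done : EncProto D γ r .done .nil

/-- The identity function of one parameter. -/
def idFn {V : Type u} : List (Val V) →. Val V
  | [v] => Part.some v
  | _ => Part.none

/-- The empty monitor queues: one for each connection binder. -/
def buildQueues {V : Type u} (D : List CBinder) (γ : Naming) : List (LBinder V) :=
  D.map fun b => ⟨γ.lab b.recv b.label, [], idFn, [γ.lab b.send b.label]⟩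

/-- Append the store `{u ↦ v}` to the queue if its output port is in `us`. -/
def enqueue {V : Type u} (us : Finset Port) (u : Port) (v : Val V) (b : LBinder V) :
    LBinder V :=
  if b.out ∈ us then { b with stores := b.stores ++ [[(u, v)]] } else b

/-- The output ports of the monitor queues of the roles `Q` for the label `l`. -/
def queuePorts (γ : Naming) (l : Label) (Q : Finset Role) : Finset Port :=
  Q.image fun q => γ.lab q l

/-- Each of the roles `Q` has a queue for `l` in `L`, with the common input port `u`. -/
def HasQueues {V : Type u} (γ : Naming) (l : Label) (Q : Finset Role) (u : Port)
    (L : List (LBinder V)) : Prop :=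
  ∀ q ∈ Q, ∃ b ∈ L, b.out = γ.lab q l ∧ b.args = [u] ∧ b.fn = idFn

/-- `Fill γ G L L'`: placing the values in transit in `G` into the queues `L` is defined and
yields `L'`. -/
inductive Fill {V : Type u} (γ : Naming) :
    Proto V → List (LBinder V) → List (LBinder V) → Prop
  | com {p : Role} {l : Label} {Q : Finset Role} {G : Proto V} {L L' : List (LBinder V)} :
      Fill γ G L L' → Fill γ (.com p l Q G) L L'
  | comT {l : Label} {v : Val V} {Q : Finset Role} {G : Proto V} {u : Port}
      {L L' : List (LBinder V)} :
      HasQueues γ l Q u L → Fill γ G (L.map (enqueue (queuePorts γ l Q) u v)) L' →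
      Fill γ (.comT l v Q G) L L'
  | choice {p : Role} {l : Label} {Q : Finset Role} {G₁ G₂ : Proto V}
      {L L' : List (LBinder V)} :
      Fill γ G₁ L L' → Fill γ G₂ L L' → Fill γ (.choice p l Q G₁ G₂) L L'
  | choiceTL {l : Label} {Q : Finset Role} {G₁ G₂ : Proto V} {u : Port}
      {L L' : List (LBinder V)} :
      HasQueues γ l Q u L → Fill γ G₁ (L.map (enqueue (queuePorts γ l Q) u .inl)) L' →
      Fill γ (.choiceT l .inl Q G₁ G₂) L L'
  | choiceTR {l : Label} {Q : Finset Role} {G₁ G₂ : Proto V} {u : Port}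
      {L L' : List (LBinder V)} :
      HasQueues γ l Q u L → Fill γ G₂ (L.map (enqueue (queuePorts γ l Q) u .inr)) L' →
      Fill γ (.choiceT l .inr Q G₁ G₂) L L'
  | mu {X : RecVar} {G : Proto V} {L L' : List (LBinder V)} :
      Fill γ G L L' → Fill γ (.mu X G) L L'
  | var {X : RecVar} {L : List (LBinder V)} : Fill γ (.var X) L L
  | done {L : List (LBinder V)} : Fill γ .done L L

/-- Restriction of a list of ports. -/
def nuList {V : Type u} (zs : List Port) (P : Proc V) : Proc V := zs.foldr .nu P

/-- A list of input forwarders `(z, w)`, the first one outermost. -/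
def fwdIns {V : Type u} (F : List (Port × Port)) (P : Proc V) : Proc V :=
  F.foldr (fun f Q => .fwdIn f.1 f.2 Q) P

/-- A list of output forwarders `(z, w)`, the first one outermost. -/
def fwdOuts {V : Type u} (F : List (Port × Port)) (P : Proc V) : Proc V :=
  F.foldr (fun f Q => .fwdOut f.1 f.2 Q) P

/-- `γ` is injective on `N`, the list `zs` enumerates the image of `N` under `γ`, and this image
avoids the ports `ps`. -/
structure FreshNaming (γ : Naming) (N : List (Role × (Port ⊕ Label))) (zs ps : List Port) :
    Prop where
  inj : Set.InjOn (fun n : Role × (Port ⊕ Label) => γ n.1 n.2) {n | n ∈ N}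
  nodup : zs.Nodup
  image : ∀ z, z ∈ zs ↔ ∃ n ∈ N, γ n.1 n.2 = z
  fresh : ∀ z ∈ zs, z ∉ ps

/-- The role ports used by a base component, for the dummy role `r`. -/
def baseNames {V : Type u} (r : Role) (xs ys : List Port) (L : List (LBinder V)) :
    List (Role × (Port ⊕ Label)) :=
  (L.flatMap LBinder.ports ++ xs ++ ys).map fun x => (r, .inl x)

/-- The ports in the interfaces of the assigned components. -/
def interfacePorts {V : Type u} (R : List (Role × Comp V)) : List Port :=
  R.flatMap fun a => a.2.inputs ++ a.2.outputs

/-- The role ports and role labels used by a composite component: those of the connection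
binders, of the forwarders and of the interfaces of the assigned components. -/
def compNames {V : Type u} (D : List CBinder) (r : Role) (Fi Fo : List Fwd)
    (R : List (Role × Comp V)) : List (Role × (Port ⊕ Label)) :=
  (D.flatMap fun b => [(b.recv, .inl b.recvPort), (b.send, .inl b.sendPort),
      (b.recv, .inr b.label), (b.send, .inr b.label)]) ++
    Fi.map (fun f => (r, .inl f.dst)) ++ Fo.map (fun f => (r, .inl f.src)) ++
    R.flatMap fun a => (a.2.inputs ++ a.2.outputs).map fun x => (a.1, .inl x)

mutual

/-- `Enc C P`: `P` is an encoding of the component `C`. Encodings of the same component differ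
only in the choice of fresh names and in the order of restrictions and monitors. The bound names
are chosen apart from the free ones, so that no port is captured. -/
inductive Enc {V : Type u} : Comp V → Proc V → Prop
  | base {xs ys : List Port} {L : List (LBinder V)} {γ : Naming} {r : Role}
      {zs : List Port} :
      FreshNaming γ (baseNames r xs ys L) zs (xs ++ ys) →
      Enc (.base xs ys L)
        (nuList zs (fwdIns (xs.map fun x => (x, γ.port r x))
          (fwdOuts (ys.map fun y => (y, γ.port r y))
            (.box (L.map (LBinder.rename (γ.port r)))))))
  | comp {xs ys : List Port} {D : List CBinder} {r : Role} {Fi Fo : List Fwd}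
      {R : List (Role × Comp V)} {G : Proto V} {γ : Naming} {zs : List Port}
      {ps : List Role} {Rs Ms : List (Proc V)} {L : List (LBinder V)} :
      (∀ f ∈ Fi, f.src ∈ xs) → (∀ f ∈ Fo, f.dst ∈ ys) →
      FreshNaming γ (compNames D r Fi Fo R) zs (xs ++ ys ++ interfacePorts R) →
      EncRoles γ R Rs →
      ps.Nodup → (∀ p, p ∈ ps ↔ p ∈ G.roles) →
      List.Forall₂ (fun p M => EncProto D γ p G M) ps Ms →
      Fill γ G (buildQueues D γ) L →
      Enc (.comp xs ys D r Fi Fo R G)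
        (nuList zs (fwdIns (Fi.map fun f => (f.src, γ.port r f.dst))
          (fwdOuts (Fo.map fun f => (f.dst, γ.port r f.src))
            ((Rs ++ Ms).foldr .par (.box L)))))

/-- The encodings of the role assignments, one process for each. -/
inductive EncRoles {V : Type u} : Naming → List (Role × Comp V) → List (Proc V) → Prop
  | nil {γ : Naming} : EncRoles γ [] []
  | cons {γ : Naming} {p : Role} {C : Comp V} {R : List (Role × Comp V)} {P : Proc V}
      {Ps : List (Proc V)} :
      Enc C P → EncRoles γ R Ps →
      EncRoles γ ((p, C) :: R)
        (nuList (C.inputs ++ C.outputs) (fwdIns (C.inputs.map fun x => (γ.port p x, x))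
          (fwdOuts (C.outputs.map fun y => (γ.port p y, y)) P)) :: Ps)

end

end GC

namespace GC

universe u
variable {V : Type u}

-- Substitution, roles and recursion in protocols.

namespace Proto

-- Every communication of a composite passes through the monitor of the acting role, and this
-- accounts for the two internal steps. When `p` sends, its component hands the value to the monitor
-- of `p`, which then broadcasts it into the queues of all receivers of that label. When `q`
-- receives, its queue hands the value to the monitor of `q`, which passes it on to the component. A
-- move inside an assigned component is handled by induction, because restrictions, forwarders and
-- parallel composition let internal steps pass. Visible actions of components are matched exactly
-- by single queue actions (`Enc.act_step`), so the weight of the proof lies on the protocol.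
--
-- The difficulty is that a protocol may act below prefixes and through unfolded recursions. The
-- acting monitor unfolds its own recursions on the way to its prefix (`Fires`), but the new
-- protocol contains the unfolded body for every role, so the other monitors must be unfolded as
-- well, up to congruence. Moreover the new encoding must be defined: at a pending choice the
-- monitors of an uninvolved role in the two branches have to coincide syntactically. The unfolding
-- is therefore a function `unfoldMus` of the monitor, of a count `k`, and of the values queued for
-- the role, so that equal monitors stay equal. The count is the same in both branches because the
-- acting role has one monitor for both and this monitor determines `k` (`Fires.unique`). The queued
-- values are needed because a branching monitor looks the same for a pending choice, where both
-- branches move, and for a choice in transit, where only the selected one does; a nonempty queue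
-- tells the two apart. This works because nothing is in transit on label `l` below a pending
-- interaction labelled `l` (`TransitOK`), an invariant that holds since the binders fix the sender
-- of each label. `EncProto.step` carries this induction; `RecOK` enters through `EncProto.subst`,
-- which says that taking monitors commutes with unfolding.
--
-- For the queues, the relation `Fill` is replaced by explicit contents `Proto.transit`. Definedness
-- of the encoding yields the predicate `Live` (`Fill.live`); `Proto.Live.step` preserves it and
-- computes the effect of an action, a push at the back for a send and a pop at the front for a
-- receive; `Proto.Live.fill` turns it back into definedness.

theorem subst_eq_self {X : RecVar} {H G : Proto V} (h : X ∉ G.freeVars) :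
    subst X H G = G := by
  induction G with
  | mu Y G ih =>
    by_cases e : Y = X
    · simp [subst, e]
    · simp only [freeVars, Finset.mem_erase, not_and] at h
      simp [subst, e, ih (h (Ne.symm e))]
  | var Y => simp_all [subst, freeVars, eq_comm]
  | _ => simp_all [subst, freeVars]

theorem freeVars_subst {X : RecVar} {H : Proto V} (hH : H.freeVars = ∅) (G : Proto V) :
    (subst X H G).freeVars ⊆ G.freeVars.erase X := by
  induction G with
  | mu Y G ih =>
    by_cases e : Y = X
    · subst e; simp [subst, freeVars]
    · intro Z hZ
      simp only [subst, e, if_false, freeVars, Finset.mem_erase] at hZ ⊢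
      have := ih hZ.2
      simp only [Finset.mem_erase] at this
      tauto
  | var Y => by_cases e : Y = X <;> simp [subst, e, freeVars, hH]
  | com p l Q G ih => exact ih
  | comT l v Q G ih => exact ih
  | done => simp [subst, freeVars]
  | choice p l Q G₁ G₂ ih₁ ih₂ =>
    simp only [subst, freeVars, Finset.erase_union_distrib]; exact Finset.union_subset_union ih₁ ih₂
  | choiceT l v Q G₁ G₂ ih₁ ih₂ =>
    simp only [subst, freeVars, Finset.erase_union_distrib]; exact Finset.union_subset_union ih₁ ih₂

theorem roles_subset_subst (X : RecVar) (H G : Proto V) : G.roles ⊆ (subst X H G).roles := by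
  induction G with
  | mu Y G ih => by_cases e : Y = X <;> simp [subst, e, roles, ih]
  | var Y => simp [roles]
  | done => simp [roles]
  | com p l Q G ih => simp only [subst, roles]; gcongr
  | comT l v Q G ih => simp only [subst, roles]; gcongr
  | choice p l Q G₁ G₂ ih₁ ih₂ => simp only [subst, roles]; gcongr
  | choiceT l v Q G₁ G₂ ih₁ ih₂ => simp only [subst, roles]; gcongr

theorem roles_subst_subset (X : RecVar) (H G : Proto V) :
    (subst X H G).roles ⊆ G.roles ∪ H.roles := by
  induction G with
  | mu Y G ih => by_cases e : Y = X <;> simp [subst, e, roles, ih]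
  | var Y => by_cases e : Y = X <;> simp [subst, e, roles]
  | done => simp [subst, roles]
  | com p l Q G ih => intro r hr; have := @ih r; simp_all [subst, roles]; tauto
  | comT l v Q G ih => intro r hr; have := @ih r; simp_all [subst, roles]; tauto
  | choice p l Q G₁ G₂ ih₁ ih₂ =>
    intro r hr; have := @ih₁ r; have := @ih₂ r; simp_all [subst, roles]; tauto
  | choiceT l v Q G₁ G₂ ih₁ ih₂ =>
    intro r hr; have := @ih₁ r; have := @ih₂ r; simp_all [subst, roles]; tauto

/-- If `X` is free, substitution adds only roles of `H`, which are already in `G`; otherwise it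
changes nothing. The hypothesis is what `JumpsInvolve` provides at an inner recursion. -/
theorem roles_subst_eq {X : RecVar} {H G : Proto V} (h : X ∈ G.freeVars → H.roles ⊆ G.roles) :
    (subst X H G).roles = G.roles := by
  by_cases hX : X ∈ G.freeVars
  · refine Finset.Subset.antisymm ((roles_subst_subset X H G).trans ?_) (roles_subset_subst X H G)
    exact Finset.union_subset (Finset.Subset.refl _) (h hX)
  · rw [subst_eq_self hX]

theorem roles_unfold (X : RecVar) (G : Proto V) : (subst X (mu X G) G).roles = G.roles :=
  roles_subst_eq fun _ => Finset.Subset.refl _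

theorem Step.role_mem {G G' : Proto V} {α : PAct V} (h : Step G α G') : α.role ∈ G.roles := by
  induction h with
  | unfold _ ih => rw [roles_unfold] at ih; exact ih
  | _ => simp_all [roles, PAct.role]

/-- Roles may vanish but never appear, so the old monitors suffice for the new protocol. -/
theorem Step.roles_subset {G G' : Proto V} {α : PAct V} (h : Step G α G') :
    G'.roles ⊆ G.roles := by
  induction h with
  | unfold _ ih => rw [roles_unfold] at ih; exact ih
  | sVal => intro r hr; simp_all [roles]
  | sChoice => intro r hr; simp_all [roles]
  | conc2 _ _ _ _ ih₁ ih₂ =>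
    intro r hr; have := @ih₁ r; have := @ih₂ r; simp only [roles, Finset.mem_insert,
      Finset.mem_union] at *; tauto
  | rVal => intro r hr; simp only [roles, Finset.mem_union, Finset.mem_erase] at *; tauto
  | rChoice => intro r hr; simp only [roles, Finset.mem_union, Finset.mem_erase] at *; tauto
  | rVal2 => intro r hr; simp [roles, hr]
  | rChoiceL => intro r hr; simp [roles, hr]
  | rChoiceR => intro r hr; simp [roles, hr]
  | conc1 _ _ _ ih => intro r hr; have := @ih r; simp only [roles, Finset.mem_insert,
      Finset.mem_union] at *; tauto
  | conc3 _ _ ih => intro r hr; have := @ih r; simp only [roles, Finset.mem_union] at *; tauto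
  | conc4 _ _ ih => intro r hr; have := @ih r; simp only [roles, Finset.mem_union] at *; tauto
  | conc5 _ _ ih => intro r hr; have := @ih r; simp only [roles, Finset.mem_union] at *; tauto

theorem jumpsInvolve_of_notMem {Y : RecVar} (S : Finset Role) {G : Proto V}
    (h : Y ∉ G.freeVars) : G.JumpsInvolve Y S := by
  induction G with
  | mu Z G ih =>
    by_cases e : Z = Y
    · exact Or.inl e
    · simp only [freeVars, Finset.mem_erase, not_and] at h
      have h := h (Ne.symm e)
      exact Or.inr ⟨fun h' => absurd h' h, ih h⟩
  | _ => simp_all [JumpsInvolve, freeVars]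

/-- A closed `H` brings in no free variable and so no new jump, while substitution can only enlarge
the role set of a recursion body. -/
theorem JumpsInvolve.subst {X Y : RecVar} {S : Finset Role} {H G : Proto V}
    (hH : H.freeVars = ∅) (h : G.JumpsInvolve Y S) :
    (Proto.subst X H G).JumpsInvolve Y S := by
  induction G with
  | mu Z G ih =>
    by_cases e : Z = X
    · simpa [Proto.subst, e] using h
    · simp only [Proto.subst, e, if_false]
      rcases h with h | ⟨h₁, h₂⟩
      · exact Or.inl h
      · refine Or.inr ⟨fun hY => ?_, ih h₂⟩
        exact (h₁ (Finset.mem_of_mem_erase (freeVars_subst hH G hY))).trans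
          (roles_subset_subst X H G)
  | var Z =>
    by_cases e : Z = X
    · simpa [Proto.subst, e] using jumpsInvolve_of_notMem S (by simp [hH])
    · simp [Proto.subst, e, JumpsInvolve]
  | _ => simp_all [JumpsInvolve, Proto.subst]

/-- Inner recursions that can jump to `X` already involve all roles of `H`, so no recursion body
gains a role and the requirement on its own variable stays the same. -/
theorem RecOK.subst {X : RecVar} {H G : Proto V} (hH : H.freeVars = ∅) (hr : H.RecOK)
    (h : G.RecOK) (hj : G.JumpsInvolve X H.roles) : (Proto.subst X H G).RecOK := by
  induction G with
  | mu Y G ih =>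
    by_cases e : Y = X
    · simpa [Proto.subst, e] using h
    · rcases hj with hj | ⟨hj₁, hj₂⟩
      · exact absurd hj e
      · simp only [Proto.subst, e, if_false, RecOK]
        rw [roles_subst_eq hj₁]
        exact ⟨h.1.subst hH, ih h.2 hj₂⟩
  | var Z =>
    by_cases e : Z = X
    · simpa [Proto.subst, e] using hr
    · simp [Proto.subst, e, RecOK]
  | _ => simp_all [RecOK, JumpsInvolve, Proto.subst]

theorem Static.subst {X : RecVar} {H G : Proto V} (hH : H.Static) (h : G.Static) :
    (Proto.subst X H G).Static := by
  induction G with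
  | mu Y G ih => by_cases e : Y = X <;> simp_all [Proto.subst, Static]
  | var Y => by_cases e : Y = X <;> simp_all [Proto.subst, Static]
  | _ => simp_all [Proto.subst, Static]

theorem ForallCom.subst {S : Role → Label → Finset Role → Prop} {X : RecVar} {H G : Proto V}
    (hH : H.ForallCom S) (h : G.ForallCom S) : (Proto.subst X H G).ForallCom S := by
  induction G with
  | mu Y G ih => by_cases e : Y = X <;> simp_all [Proto.subst, ForallCom]
  | var Y => by_cases e : Y = X <;> simp_all [Proto.subst, ForallCom]
  | _ => simp_all [Proto.subst, ForallCom]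

-- Invariants of reachable protocols: where values in transit may occur.

/-- A runtime term labelled `l` occurs. -/
def HasTransit (l : Label) : Proto V → Prop
  | com _ _ _ G => G.HasTransit l
  | choice _ _ _ G₁ G₂ => G₁.HasTransit l ∨ G₂.HasTransit l
  | mu _ G => G.HasTransit l
  | var _ => False
  | done => False
  | comT l' _ _ G => l' = l ∨ G.HasTransit l
  | choiceT l' _ _ G₁ G₂ => l' = l ∨ G₁.HasTransit l ∨ G₂.HasTransit l

/-- No runtime term labelled `l` occurs below a communication or choice labelled `l`, and none
at all below a recursion. -/
def TransitOK : Proto V → Prop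
  | com _ l _ G => ¬ G.HasTransit l ∧ G.TransitOK
  | choice _ l _ G₁ G₂ => (¬ G₁.HasTransit l ∧ ¬ G₂.HasTransit l) ∧ G₁.TransitOK ∧ G₂.TransitOK
  | mu _ G => G.Static
  | var _ => True
  | done => True
  | comT _ _ _ G => G.TransitOK
  | choiceT _ _ _ G₁ G₂ => G₁.TransitOK ∧ G₂.TransitOK

theorem Static.not_hasTransit {G : Proto V} (h : G.Static) (l : Label) : ¬ G.HasTransit l := by
  induction G <;> simp_all [Static, HasTransit]

theorem Static.transitOK {G : Proto V} (h : G.Static) : G.TransitOK := by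
  induction G <;> simp_all [Static, TransitOK, Static.not_hasTransit]

end Proto

/-- The binders labelled `l` connect `p` with roles in `Q`, where `Q` is nonempty without `p`. -/
def ComConnected (D : List CBinder) (p : Role) (l : Label) (Q : Finset Role) : Prop :=
  Q.Nonempty ∧ p ∉ Q ∧ ∀ b ∈ D, b.label = l → b.send = p ∧ b.recv ∈ Q

/-- The structural constraints on the protocols that are reachable from source protocols. -/
structure Proto.Run (D : List CBinder) (G : Proto V) : Prop where
  closed : G.freeVars = ∅
  recOK : G.RecOK
  coms : G.ForallCom (ComConnected D)
  transit : G.TransitOK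

/-- Sending is done by senders of connection binders. -/
def PAct.Allowed (D : List CBinder) : PAct V → Prop
  | send p l _ => ∃ b ∈ D, b.label = l ∧ b.send = p
  | recv _ _ _ => True

namespace Proto

variable {D : List CBinder}

theorem run_com {p : Role} {l : Label} {Q : Finset Role} {G : Proto V} :
    Run D (com p l Q G) ↔ ComConnected D p l Q ∧ ¬ G.HasTransit l ∧ Run D G := by
  constructor
  · rintro ⟨h₁, h₂, h₃, h₄⟩
    exact ⟨h₃.1, h₄.1, h₁, h₂, h₃.2, h₄.2⟩
  · rintro ⟨h, h', h₁, h₂, h₃, h₄⟩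
    exact ⟨h₁, h₂, ⟨h, h₃⟩, h', h₄⟩

theorem run_comT {l : Label} {v : Val V} {Q : Finset Role} {G : Proto V} :
    Run D (comT l v Q G) ↔ Run D G := by
  constructor <;> rintro ⟨h₁, h₂, h₃, h₄⟩ <;> exact ⟨h₁, h₂, h₃, h₄⟩

theorem run_choice {p : Role} {l : Label} {Q : Finset Role} {G₁ G₂ : Proto V} :
    Run D (choice p l Q G₁ G₂) ↔ ComConnected D p l Q ∧ ¬ G₁.HasTransit l ∧
      ¬ G₂.HasTransit l ∧ Run D G₁ ∧ Run D G₂ := by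
  constructor
  · rintro ⟨h₁, h₂, h₃, h₄⟩
    simp only [freeVars, Finset.union_eq_empty] at h₁
    exact ⟨h₃.1, h₄.1.1, h₄.1.2, ⟨h₁.1, h₂.1, h₃.2.1, h₄.2.1⟩, ⟨h₁.2, h₂.2, h₃.2.2, h₄.2.2⟩⟩
  · rintro ⟨h, h₁, h₂, ⟨a₁, a₂, a₃, a₄⟩, ⟨b₁, b₂, b₃, b₄⟩⟩
    exact ⟨by simp [freeVars, a₁, b₁], ⟨a₂, b₂⟩, ⟨h, a₃, b₃⟩, ⟨h₁, h₂⟩, a₄, b₄⟩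

theorem run_choiceT {l : Label} {v : Val V} {Q : Finset Role} {G₁ G₂ : Proto V} :
    Run D (choiceT l v Q G₁ G₂) ↔ Run D G₁ ∧ Run D G₂ := by
  constructor
  · rintro ⟨h₁, h₂, h₃, h₄⟩
    simp only [freeVars, Finset.union_eq_empty] at h₁
    exact ⟨⟨h₁.1, h₂.1, h₃.1, h₄.1⟩, ⟨h₁.2, h₂.2, h₃.2, h₄.2⟩⟩
  · rintro ⟨⟨a₁, a₂, a₃, a₄⟩, ⟨b₁, b₂, b₃, b₄⟩⟩
    exact ⟨by simp [freeVars, a₁, b₁], ⟨a₂, b₂⟩, ⟨a₃, b₃⟩, a₄, b₄⟩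

theorem closed_unfold {X : RecVar} {G : Proto V} (h : (mu X G).freeVars = ∅) :
    (subst X (mu X G) G).freeVars = ∅ :=
  Finset.subset_empty.1 ((freeVars_subst h G).trans h.le)

theorem RecOK.unfold {X : RecVar} {G : Proto V} (hc : (mu X G).freeVars = ∅)
    (h : (mu X G).RecOK) : (Proto.subst X (mu X G) G).RecOK :=
  RecOK.subst hc h h.2 h.1

theorem Static.unfold {X : RecVar} {G : Proto V} (h : G.Static) :
    (Proto.subst X (mu X G) G).Static :=
  Static.subst (H := mu X G) h h

theorem Run.unfold {X : RecVar} {G : Proto V} (h : Run D (mu X G)) :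
    Run D (Proto.subst X (mu X G) G) where
  closed := closed_unfold h.closed
  recOK := h.recOK.unfold h.closed
  coms := ForallCom.subst (H := mu X G) h.coms h.coms
  transit := (Static.unfold h.transit).transitOK

/-- Only a send creates a runtime term, and with its own label. Unfolding creates none because
recursion bodies are static. -/
theorem Step.hasTransit {G G' : Proto V} {α : PAct V} {l : Label} (h : Step G α G')
    (hr : Run D G) (ht : G'.HasTransit l) :
    G.HasTransit l ∨ ∃ p v, α = .send p l v := by
  induction h with
  | unfold _ ih =>
    rcases ih hr.unfold ht with h | h
    · exact absurd h ((Static.unfold hr.transit).not_hasTransit l)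
    · exact Or.inr h
  | sVal =>
    rcases ht with rfl | ht
    · exact Or.inr ⟨_, _, rfl⟩
    · exact Or.inl ht
  | sChoice =>
    rcases ht with rfl | ht
    · exact Or.inr ⟨_, _, rfl⟩
    · exact Or.inl ht
  | conc1 _ _ _ ih => exact ih (run_com.1 hr).2.2 ht
  | conc2 _ _ _ _ ih₁ ih₂ =>
    have hr := (run_choice.1 hr).2.2.2
    rcases ht with ht | ht
    · exact (ih₁ hr.1 ht).imp_left Or.inl
    · exact (ih₂ hr.2 ht).imp_left Or.inr
  | conc3 _ _ ih =>
    rcases ht with ht | ht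
    · exact Or.inl (Or.inl ht)
    · exact (ih (run_comT.1 hr) ht).imp_left Or.inr
  | conc4 _ _ ih =>
    rcases ht with ht | ht | ht
    · exact Or.inl (Or.inl ht)
    · exact (ih (run_choiceT.1 hr).1 ht).imp_left fun h => Or.inr (Or.inl h)
    · exact Or.inl (Or.inr (Or.inr ht))
  | conc5 _ _ ih =>
    rcases ht with ht | ht | ht
    · exact Or.inl (Or.inl ht)
    · exact Or.inl (Or.inr (Or.inl ht))
    · exact (ih (run_choiceT.1 hr).2 ht).imp_left fun h => Or.inr (Or.inr h)
  | rVal => exact Or.inl ht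
  | rVal2 => exact Or.inl (Or.inr ht)
  | rChoice => exact Or.inl ht
  | rChoiceL => exact Or.inl (Or.inr (Or.inl ht))
  | rChoiceR => exact Or.inl (Or.inr (Or.inr ht))

/-- This is what keeps `TransitOK` invariant below a prefix: an action that overtakes an interaction
labelled `l` cannot send on `l`, as every binder labelled `l` has its sender at `p`. -/
theorem Step.not_hasTransit {G G' : Proto V} {α : PAct V} {p : Role} {l : Label}
    {Q : Finset Role} (h : Step G α G') (hr : Run D G) (ha : α.Allowed D) (hp : α.role ≠ p)
    (hc : ComConnected D p l Q) (ht : ¬ G.HasTransit l) : ¬ G'.HasTransit l := by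
  intro ht'
  rcases h.hasTransit hr ht' with h' | ⟨q, v, rfl⟩
  · exact ht h'
  · obtain ⟨b, hb, hl, hs⟩ := ha
    exact hp (hs.symm.trans (hc.2.2 b hb hl).1)

theorem Run.step {G G' : Proto V} {α : PAct V} (hr : Run D G) (h : Step G α G')
    (ha : α.Allowed D) : Run D G' := by
  induction h with
  | unfold _ ih => exact ih hr.unfold ha
  | sVal => exact run_comT.2 (run_com.1 hr).2.2
  | sChoice => exact run_choiceT.2 (run_choice.1 hr).2.2.2
  | rVal => exact run_comT.2 (run_comT.1 hr)
  | rVal2 => exact run_comT.1 hr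
  | rChoice => exact run_choiceT.2 (run_choiceT.1 hr)
  | rChoiceL => exact (run_choiceT.1 hr).1
  | rChoiceR => exact (run_choiceT.1 hr).2
  | conc1 h hp _ ih =>
    obtain ⟨hc, ht, hr⟩ := run_com.1 hr
    exact run_com.2 ⟨hc, h.not_hasTransit hr ha hp hc ht, ih hr ha⟩
  | conc2 h₁ h₂ hp _ ih₁ ih₂ =>
    obtain ⟨hc, ht₁, ht₂, hr₁, hr₂⟩ := run_choice.1 hr
    exact run_choice.2 ⟨hc, h₁.not_hasTransit hr₁ ha hp hc ht₁,
      h₂.not_hasTransit hr₂ ha hp hc ht₂, ih₁ hr₁ ha, ih₂ hr₂ ha⟩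
  | conc3 _ _ ih => exact run_comT.2 (ih (run_comT.1 hr) ha)
  | conc4 _ _ ih => exact run_choiceT.2 ⟨ih (run_choiceT.1 hr).1 ha, (run_choiceT.1 hr).2⟩
  | conc5 _ _ ih => exact run_choiceT.2 ⟨(run_choiceT.1 hr).1, ih (run_choiceT.1 hr).2 ha⟩

theorem ProtoOK.run {G : Proto V} (h : ProtoOK D G) : Run D G :=
  ⟨h.closed, h.recOK, h.coms, h.static.transitOK⟩

end Proto

-- Values in transit and live protocols.

/-- The values in transit for each role and label, first value first. For a choice not yet made
those of the first branch are taken. -/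
def Proto.transit : Proto V → Role → Label → List (Val V)
  | com _ _ _ G => G.transit
  | choice _ _ _ G₁ _ => G₁.transit
  | mu _ G => G.transit
  | var _ => fun _ _ => []
  | done => fun _ _ => []
  | comT l v Q G => fun q l' => if q ∈ Q ∧ l' = l then v :: G.transit q l' else G.transit q l'
  | choiceT l v Q G₁ G₂ => fun q l' =>
      let t := match v with
        | .inr => G₂.transit
        | _ => G₁.transit
      if q ∈ Q ∧ l' = l then v :: t q l' else t q l'

/-- Communication labelled `l` from `p` to `Q` is realised by connection binders. -/
def ComRealised (D : List CBinder) (p : Role) (l : Label) (Q : Finset Role) : Prop :=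
  p ∉ Q ∧ (∀ b ∈ D, b.label = l → b.send = p ∧ b.recv ∈ Q) ∧
    ∀ q ∈ Q, ∃ b ∈ D, b.label = l ∧ b.recv = q

/-- Conditions on the selected branches of a protocol: interactions are realised by binders, no
values are in transit below a pending communication with the same label, and pending branches
agree on the values in transit. -/
def Proto.Live (D : List CBinder) : Proto V → Prop
  | com p l Q G => ComRealised D p l Q ∧ (∀ q, G.transit q l = []) ∧ G.Live D
  | choice p l Q G₁ G₂ => ComRealised D p l Q ∧ (∀ q, G₁.transit q l = []) ∧
      G₁.transit = G₂.transit ∧ G₁.Live D ∧ G₂.Live D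
  | mu _ G => G.Static ∧ G.Live D
  | var _ => True
  | done => True
  | comT l _ Q G => (∀ q ∈ Q, ∃ b ∈ D, b.label = l ∧ b.recv = q) ∧ G.Live D
  | choiceT l v Q G₁ G₂ => (∀ q ∈ Q, ∃ b ∈ D, b.label = l ∧ b.recv = q) ∧
      match v with
      | .inl => G₁.Live D
      | .inr => G₂.Live D
      | .data _ => False

namespace Proto
variable {D : List CBinder}

theorem Static.transit_eq {G : Proto V} (h : G.Static) : G.transit = fun _ _ => [] := by
  induction G <;> simp_all [Static, transit]

theorem Live.subst {X : RecVar} {H G : Proto V} (hs : H.Static) (hH : H.Live D)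
    (h : G.Live D) (hG : G.Static) : (Proto.subst X H G).Live D := by
  induction G with
  | mu Y G ih =>
    by_cases e : Y = X
    · simpa [Proto.subst, e] using h
    · simp only [Proto.subst, e, if_false]
      exact ⟨hs.subst hG, ih h.2 hG⟩
  | var Y => by_cases e : Y = X <;> simp_all [Proto.subst, Live]
  | com p l Q G ih => exact ⟨h.1, by simp [(hs.subst (G := G) hG).transit_eq], ih h.2.2 hG⟩
  | choice p l Q G₁ G₂ ih₁ ih₂ =>
    exact ⟨h.1, by simp [(hs.subst hG.1).transit_eq], by
      rw [(hs.subst hG.1).transit_eq, (hs.subst hG.2).transit_eq], ih₁ h.2.2.2.1 hG.1,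
      ih₂ h.2.2.2.2 hG.2⟩
  | done => exact h
  | comT => exact hG.elim
  | choiceT => exact hG.elim

theorem Live.unfold {X : RecVar} {G : Proto V} (h : (mu X G).Live D) :
    (Proto.subst X (mu X G) G).Live D :=
  Live.subst (H := mu X G) h.1 h h.2 h.1

theorem transit_unfold {X : RecVar} {G : Proto V} (h : G.Static) :
    (Proto.subst X (mu X G) G).transit = (mu X G).transit := by
  rw [(Static.unfold h).transit_eq, transit, h.transit_eq]

end Proto

/-! ### Monitors -/

namespace Proc

/-- Naive substitution of a process for a recursion variable. -/
def substRec (X : RecVar) (Q : Proc V) : Proc V → Proc V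
  | nil => nil
  | par P P' => par (substRec X Q P) (substRec X Q P')
  | nu z P => nu z (substRec X Q P)
  | mu Y P => if Y = X then mu Y P else mu Y (substRec X Q P)
  | var Y => if Y = X then Q else var Y
  | out z o P => out z o (substRec X Q P)
  | inp z a P => inp z a (substRec X Q P)
  | branch z P P' => branch z (substRec X Q P) (substRec X Q P')
  | box L => box L
  | fwdOut z w P => fwdOut z w (substRec X Q P)
  | fwdIn z w P => fwdIn z w (substRec X Q P)

/-- Apply `f` to the topmost recursions below the prefixes of a monitor, given the values `w`
queued at each port: when a value is queued for a branching, only the selected branch counts. -/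
def mapMus (f : RecVar → Proc V → Proc V) : (Port → List (Val V)) → Proc V → Proc V
  | w, inp z a P => inp z a (mapMus f (Function.update w z (w z).tail) P)
  | w, out z o P => out z o (mapMus f w P)
  | w, branch z P Q =>
    match w z with
    | [] => branch z (mapMus f w P) (mapMus f w Q)
    | .inl :: t => branch z (mapMus f (Function.update w z t) P) Q
    | .inr :: t => branch z P (mapMus f (Function.update w z t) Q)
    | .data _ :: _ => branch z P Q
  | _, mu X P => f X P
  | _, P => P

/-- Unfold the first `k` recursions of a monitor along each path. -/
def unfoldMus : ℕ → (Port → List (Val V)) → Proc V → Proc V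
  | 0, _, P => P
  | k + 1, w, P =>
    mapMus (fun X Q => unfoldMus k (fun _ => []) (substRec X (mu X Q) Q)) w P

section unfoldMus
variable (k : ℕ) (w : Port → List (Val V))

theorem unfoldMus_inp (z : Port) (a : Var) (P : Proc V) :
    unfoldMus k w (inp z a P) =
      inp z a (unfoldMus k (Function.update w z (w z).tail) P) := by
  cases k <;> simp [unfoldMus, mapMus]

theorem unfoldMus_out (z : Port) (o : Obj V) (P : Proc V) :
    unfoldMus k w (out z o P) = out z o (unfoldMus k w P) := by
  cases k <;> simp [unfoldMus, mapMus]

theorem unfoldMus_nil : unfoldMus k w (nil : Proc V) = nil := by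
  cases k <;> simp [unfoldMus, mapMus]

variable {w}

theorem unfoldMus_branch {z : Port} (h : w z = []) (P Q : Proc V) :
    unfoldMus k w (branch z P Q) = branch z (unfoldMus k w P) (unfoldMus k w Q) := by
  cases k <;> simp [unfoldMus, mapMus, h]

theorem unfoldMus_branch_inl {z : Port} {t : List (Val V)} (h : w z = .inl :: t)
    (P Q : Proc V) :
    unfoldMus k w (branch z P Q) = branch z (unfoldMus k (Function.update w z t) P) Q := by
  cases k <;> simp [unfoldMus, mapMus, h]

theorem unfoldMus_branch_inr {z : Port} {t : List (Val V)} (h : w z = .inr :: t)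
    (P Q : Proc V) :
    unfoldMus k w (branch z P Q) = branch z P (unfoldMus k (Function.update w z t) Q) := by
  cases k <;> simp [unfoldMus, mapMus, h]

end unfoldMus

/-- After `k` unfoldings `M` receives `v` on `x` and becomes `u!v.P`. -/
inductive Fires (v : Val V) : Proc V → ℕ → Port → Port → Proc V → Prop
  | inp {x u : Port} {P : Proc V} :
      P.substVal 0 v = P → Fires v (.inp x 0 (.out u (.var 0) P)) 0 x u P
  | inl {x u : Port} {P Q : Proc V} :
      v = .inl → Fires v (.branch x (.out u (.val .inl) P) Q) 0 x u P
  | inr {x u : Port} {P Q : Proc V} :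
      v = .inr → Fires v (.branch x Q (.out u (.val .inr) P)) 0 x u P
  | mu {X : RecVar} {M P : Proc V} {k : ℕ} {x u : Port} :
      SubstRec X (.mu X M) M (Proc.substRec X (.mu X M) M) →
      Fires v (Proc.substRec X (.mu X M) M) k x u P → Fires v (.mu X M) (k + 1) x u P

/-- The shape of the monitor together with the value dictates the path to the firing prefix. At a
pending choice the acting role has one monitor for both branches, so both inductive results agree on
the count and on the continuation. -/
theorem Fires.unique {v : Val V} {M P P' : Proc V} {k k' : ℕ} {x x' u u' : Port}
    (h : Fires v M k x u P) (h' : Fires v M k' x' u' P') : k = k' ∧ P = P' := by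
  induction h generalizing k' with
  | inp => cases h'; exact ⟨rfl, rfl⟩
  | inl hv => cases h' with
    | inl => exact ⟨rfl, rfl⟩
    | inr hv' => exact absurd (hv.symm.trans hv') (by simp)
  | inr hv => cases h' with
    | inl hv' => exact absurd (hv.symm.trans hv') (by simp)
    | inr => exact ⟨rfl, rfl⟩
  | mu _ _ ih => cases h' with
    | mu _ h' => obtain ⟨rfl, rfl⟩ := ih h'; exact ⟨rfl, rfl⟩

theorem Fires.step {v : Val V} {M P : Proc V} {k : ℕ} {x u : Port} (h : Fires v M k x u P) :
    Step M (.prim (.inp x v)) (.out u (.val v) P) := by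
  induction h with
  | @inp x u P h =>
    have : (Proc.out u (.var 0) P).substVal 0 v = .out u (.val v) P := by
      simp [substVal, Obj.subst, h]
    exact this ▸ Step.inp
  | inl hv => subst hv; exact .choL
  | inr hv => subst hv; exact .choR
  | mu hs _ ih => exact .unfold hs ih

end Proc

/-- The names of the connection binders. -/
def binderNames (D : List CBinder) : List (Role × (Port ⊕ Label)) :=
  D.flatMap fun b => [(b.recv, .inl b.recvPort), (b.send, .inl b.sendPort),
      (b.recv, .inr b.label), (b.send, .inr b.label)]

section binderNames
variable {D : List CBinder} {b : CBinder}

theorem sendPort_mem_binderNames (hb : b ∈ D) : (b.send, .inl b.sendPort) ∈ binderNames D :=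
  List.mem_flatMap.2 ⟨b, hb, by simp⟩

theorem recvLabel_mem_binderNames (hb : b ∈ D) : (b.recv, .inr b.label) ∈ binderNames D :=
  List.mem_flatMap.2 ⟨b, hb, by simp⟩

theorem sendLabel_mem_binderNames (hb : b ∈ D) : (b.send, .inr b.label) ∈ binderNames D :=
  List.mem_flatMap.2 ⟨b, hb, by simp⟩

end binderNames

/-- `γ` is injective on the names of the connection binders. -/
def Naming.InjBinders (γ : Naming) (D : List CBinder) : Prop :=
  Set.InjOn (fun n : Role × (Port ⊕ Label) => γ n.1 n.2) {n | n ∈ binderNames D}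

-- Monitors under substitution and unfolding.

section EncProto
variable {D : List CBinder} {γ : Naming} {r : Role} {G : Proto V} {M : Proc V}

theorem EncProto.freeVars (h : EncProto D γ r G M) : M.freeVars = ∅ := by
  induction h <;> simp_all [Proc.freeVars, Obj.vars]

/-- Monitors have no free value variables, so receiving a value changes only the output directly
after the input. All inputs can thus bind the same variable 0. -/
theorem EncProto.substVal (h : EncProto D γ r G M) (a : Var) (v : Val V) :
    M.substVal a v = M := by
  induction h <;> simp_all [Proc.substVal, Obj.subst]

theorem EncProto.freeRecVars (h : EncProto D γ r G M) : M.freeRecVars ⊆ ↑G.freeVars := by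
  induction h with
  | muIn _ _ ih =>
    simp only [Proc.freeRecVars, Proto.freeVars, Finset.coe_erase]
    exact Set.sdiff_subset_sdiff_left ih
  | comSend _ _ _ _ ih => exact ih
  | comRecv _ _ _ _ _ _ ih => exact ih
  | comOther _ _ _ ih => exact ih
  | comTRecv _ _ _ _ _ ih => exact ih
  | comTOther _ _ ih => exact ih
  | choiceSend _ _ _ _ _ ih₁ ih₂ =>
    simp only [Proc.freeRecVars, Proto.freeVars, Finset.coe_union]
    exact Set.union_subset_union ih₁ ih₂
  | choiceRecv _ _ _ _ _ _ _ ih₁ ih₂ =>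
    simp only [Proc.freeRecVars, Proto.freeVars, Finset.coe_union]
    exact Set.union_subset_union ih₁ ih₂
  | choiceTRecv _ _ _ _ _ _ ih₁ ih₂ =>
    simp only [Proc.freeRecVars, Proto.freeVars, Finset.coe_union]
    exact Set.union_subset_union ih₁ ih₂
  | choiceOther _ _ _ _ ih₁ ih₂ =>
    simp only [Proto.freeVars, Finset.coe_union]
    exact ih₁.trans Set.subset_union_left
  | choiceTL _ _ ih =>
    simp only [Proto.freeVars, Finset.coe_union]
    exact ih.trans Set.subset_union_left
  | choiceTR _ _ ih =>
    simp only [Proto.freeVars, Finset.coe_union]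
    exact ih.trans Set.subset_union_right
  | muOut => simp [Proc.freeRecVars]
  | var => simp [Proc.freeRecVars, Proto.freeVars]
  | done => simp [Proc.freeRecVars]

/-- Monitors bind no ports, and `Q` has no free variables that a binder could capture; naive
substitution is therefore the capture-avoiding one. -/
theorem EncProto.substRec {X : RecVar} {Q : Proc V} (hr : Q.freeRecVars = ∅)
    (hv : Q.freeVars = ∅) (h : EncProto D γ r G M) : SubstRec X Q M (Proc.substRec X Q M) := by
  induction h with
  | @muIn Y G P _ _ ih =>
    by_cases e : Y = X
    · subst e; simpa [Proc.substRec] using SubstRec.muSame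
    · simpa [Proc.substRec, e] using SubstRec.mu e (by simp [hr]) ih
  | @var Y =>
    by_cases e : Y = X
    · subst e; simpa [Proc.substRec] using SubstRec.varSame
    · simpa [Proc.substRec, e] using SubstRec.var e
  | comSend _ _ _ _ ih => exact .inp (by simp [hv]) (.out ih)
  | comRecv _ _ _ _ _ _ ih => exact .inp (by simp [hv]) (.out ih)
  | comOther _ _ _ ih => exact ih
  | comTRecv _ _ _ _ _ ih => exact .inp (by simp [hv]) (.out ih)
  | comTOther _ _ ih => exact ih
  | choiceSend _ _ _ _ _ ih₁ ih₂ => exact .branch (.out ih₁) (.out ih₂)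
  | choiceRecv _ _ _ _ _ _ _ ih₁ ih₂ => exact .branch (.out ih₁) (.out ih₂)
  | choiceTRecv _ _ _ _ _ _ ih₁ ih₂ => exact .branch (.out ih₁) (.out ih₂)
  | choiceOther _ _ _ _ ih₁ ih₂ => exact ih₁
  | choiceTL _ _ ih => exact ih
  | choiceTR _ _ ih => exact ih
  | muOut => exact .nil
  | done => exact .nil

/-- The critical case is an inner recursion that does not involve `r`, whose monitor is `nil`. Since
`r` is a role of `H`, `JumpsInvolve` forbids `X` to be free there, so the substitution leaves both
the protocol and `nil` unchanged. -/
theorem EncProto.subst {X : RecVar} {H : Proto V} {Q : Proc V} (hQ : EncProto D γ r H Q)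
    (hH : r ∈ H.roles) (h : EncProto D γ r G M) (hj : G.JumpsInvolve X H.roles) :
    EncProto D γ r (Proto.subst X H G) (Proc.substRec X Q M) := by
  induction h with
  | @muIn Y G P hr hG ih =>
    by_cases e : Y = X
    · simpa [Proc.substRec, Proto.subst, e] using EncProto.muIn hr hG
    · rcases hj with hj | hj
      · exact absurd hj e
      · simpa [Proc.substRec, Proto.subst, e] using
          EncProto.muIn (Proto.roles_subset_subst X H G hr) (ih hj.2)
  | @muOut Y G hr =>
    by_cases e : Y = X
    · simpa [Proc.substRec, Proto.subst, e] using EncProto.muOut hr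
    · rcases hj with hj | hj
      · exact absurd hj e
      · have : X ∉ G.freeVars := fun hX => hr (hj.1 hX hH)
        simpa [Proc.substRec, Proto.subst, e, Proto.subst_eq_self this] using
          EncProto.muOut hr
  | @var Y =>
    by_cases e : Y = X
    · simpa [Proc.substRec, Proto.subst, e] using hQ
    · simpa [Proc.substRec, Proto.subst, e] using EncProto.var
  | comSend h₁ h₂ h₃ _ ih => exact .comSend h₁ h₂ h₃ (ih hj)
  | comRecv h₁ h₂ h₃ h₄ h₅ _ ih => exact .comRecv h₁ h₂ h₃ h₄ h₅ (ih hj)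
  | comOther h₁ h₂ _ ih => exact .comOther h₁ h₂ (ih hj)
  | comTRecv h₁ h₂ h₃ h₄ _ ih => exact .comTRecv h₁ h₂ h₃ h₄ (ih hj)
  | comTOther h₁ _ ih => exact .comTOther h₁ (ih hj)
  | choiceSend h₁ h₂ h₃ _ _ ih₁ ih₂ => exact .choiceSend h₁ h₂ h₃ (ih₁ hj.1) (ih₂ hj.2)
  | choiceRecv h₁ h₂ h₃ h₄ h₅ _ _ ih₁ ih₂ =>
    exact .choiceRecv h₁ h₂ h₃ h₄ h₅ (ih₁ hj.1) (ih₂ hj.2)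
  | choiceTRecv h₁ h₂ h₃ h₄ _ _ ih₁ ih₂ =>
    exact .choiceTRecv h₁ h₂ h₃ h₄ (ih₁ hj.1) (ih₂ hj.2)
  | choiceOther h₁ h₂ _ _ ih₁ ih₂ => exact .choiceOther h₁ h₂ (ih₁ hj.1) (ih₂ hj.2)
  | choiceTL h₁ _ ih => exact .choiceTL h₁ (ih hj.1)
  | choiceTR h₁ _ ih => exact .choiceTR h₁ (ih hj.2)
  | done => exact .done

/-- An uninvolved role skips every prefix, and closedness excludes ending at a variable outside a
recursion; what remains is `done` or a recursion without `r`. -/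
theorem EncProto.eq_nil (h : EncProto D γ r G M) (hc : G.freeVars = ∅) (hr : r ∉ G.roles) :
    M = .nil := by
  induction h <;> simp_all [Proto.freeVars, Proto.roles]

theorem EncProto.nil_of_static (hs : G.Static) (hc : G.freeVars = ∅) (hr : r ∉ G.roles) :
    EncProto D γ r G (.nil : Proc V) := by
  induction G with
  | com p l Q G ih =>
    simp only [Proto.roles, Finset.mem_insert, Finset.mem_union, not_or] at hr
    exact .comOther hr.1 hr.2.1 (ih hs hc hr.2.2)
  | choice p l Q G₁ G₂ ih₁ ih₂ =>
    simp only [Proto.roles, Finset.mem_insert, Finset.mem_union, not_or] at hr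
    simp only [Proto.freeVars, Finset.union_eq_empty] at hc
    exact .choiceOther hr.1 hr.2.1 (ih₁ hs.1 hc.1 hr.2.2.1) (ih₂ hs.2 hc.2 hr.2.2.2)
  | mu X G => exact .muOut hr
  | var X => simp [Proto.freeVars] at hc
  | done => exact .done
  | comT => exact hs.elim
  | choiceT => exact hs.elim

theorem EncProto.unfold {X : RecVar} (hc : (Proto.mu X G).freeVars = ∅)
    (hk : (Proto.mu X G).RecOK) (hr : r ∈ G.roles) (h : EncProto D γ r G M) :
    SubstRec X (.mu X M) M (Proc.substRec X (.mu X M) M) ∧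
      EncProto D γ r (Proto.subst X (.mu X G) G) (Proc.substRec X (.mu X M) M) := by
  have hm : EncProto D γ r (.mu X G) (.mu X M) := .muIn hr h
  refine ⟨h.substRec ?_ hm.freeVars, EncProto.subst hm hr h hk.1⟩
  have := hm.freeRecVars
  rw [hc, Finset.coe_empty] at this
  exact Set.subset_empty_iff.1 this

end EncProto

-- Unfolding the monitors of the roles that do not act.

/-- `w` gives the values in transit for `r` at its input ports. -/
structure Agrees (D : List CBinder) (γ : Naming) (w : Port → List (Val V)) (r : Role)
    (t : Role → Label → List (Val V)) : Prop where
  lab : ∀ b ∈ D, b.recv = r → w (γ.lab r b.label) = t r b.label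
  port : ∀ b ∈ D, b.send = r → w (γ.port r b.sendPort) = []

/-- Injectivity of `γ` keeps the changed port apart from the other receiver ports and from the
sender ports, so consuming values of one label leaves all other entries correct. -/
theorem Agrees.update {D : List CBinder} {γ : Naming} (hγ : γ.InjBinders D)
    {w : Port → List (Val V)} {r : Role} {t t' : Role → Label → List (Val V)}
    (h : Agrees D γ w r t) {b : CBinder} (hb : b ∈ D) (hr : b.recv = r)
    (ht : ∀ l ≠ b.label, t' r l = t r l) :
    Agrees D γ (Function.update w (γ.lab r b.label) (t' r b.label)) r t' where
  lab b' hb' hr' := by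
    by_cases e : b'.label = b.label
    · simp [e]
    · rw [Function.update_of_ne, h.lab b' hb' hr', ht _ e]
      intro hγ'
      subst hr
      have := hγ (hr' ▸ recvLabel_mem_binderNames hb') (recvLabel_mem_binderNames hb) hγ'
      simp_all
  port b' hb' hr' := by
    rw [Function.update_of_ne, h.port b' hb' hr']
    intro hγ'
    subst hr
    have := hγ (hr' ▸ sendPort_mem_binderNames hb') (recvLabel_mem_binderNames hb) hγ'
    simp at this

/-- The value of a protocol label. -/
def PAct.val : PAct V → Val V
  | send _ _ v => v
  | recv _ _ v => v

/-- The ports `x` and `u` on which the monitor of the acting role receives and sends. -/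
def PAct.Ports (D : List CBinder) (γ : Naming) : PAct V → Port → Port → Prop
  | send p l _, x, u => ∃ b ∈ D, b.label = l ∧ b.send = p ∧
      x = γ.port p b.sendPort ∧ u = γ.lab p l
  | recv q l _, x, u => ∃ b ∈ D, b.label = l ∧ b.recv = q ∧
      x = γ.lab q l ∧ u = γ.port q b.recvPort

/-- Unfolding `k` recursions turns each monitor of a role other than `s` for `G` into a
congruent one for `G'`. -/
def Follows (D : List CBinder) (γ : Naming) (s : Role) (k : ℕ) (G G' : Proto V) : Prop :=
  ∀ r, r ≠ s → ∀ w N, Agrees D γ w r G.transit → EncProto D γ r G N →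
    EncProto D γ r G' (N.unfoldMus k w) ∧ StructCong N (N.unfoldMus k w)

/-- Unfolding zero recursions is the identity. This covers the actions of a topmost interaction. -/
theorem Follows.of_imp {D : List CBinder} {γ : Naming} {s : Role} {G G' : Proto V}
    (h : ∀ r, r ≠ s → ∀ N, EncProto D γ r G N → EncProto D γ r G' N) :
    Follows D γ s 0 G G' :=
  fun r hr _ N _ hN => ⟨h r hr N hN, .refl N⟩

section follows
variable {D : List CBinder} {γ : Naming} {s : Role} {k : ℕ}

theorem update_tail_eq {w : Port → List (Val V)} {z : Port} (h : w z = []) :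
    Function.update w z (w z).tail = w := by
  simp [h]

/-- No value is in transit on `l`, so the port of the input prefix has an empty queue and passing
the prefix leaves `w` as it is. -/
theorem Follows.com {p : Role} {l : Label} {Q : Finset Role} {G G' : Proto V}
    (ht : ∀ q, G.transit q l = []) (h : Follows D γ s k G G') :
    Follows D γ s k (.com p l Q G) (.com p l Q G') := by
  intro r hr w N hw hN
  have hw : Agrees D γ w r G.transit := hw
  cases hN with
  | comSend hb hl hs hN =>
    obtain ⟨h₁, h₂⟩ := h _ hr w _ hw hN
    rw [Proc.unfoldMus_inp, Proc.unfoldMus_out, update_tail_eq (hs ▸ hw.port _ hb hs)]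
    exact ⟨.comSend hb hl hs h₁, .inp (.out h₂)⟩
  | comRecv hQ hb hl hs hp hN =>
    obtain ⟨h₁, h₂⟩ := h _ hr w _ hw hN
    have e : w (γ.lab r l) = [] := by
      have := hw.lab _ hb hs
      rwa [hl, ht] at this
    rw [Proc.unfoldMus_inp, Proc.unfoldMus_out, update_tail_eq e]
    exact ⟨.comRecv hQ hb hl hs hp h₁, .inp (.out h₂)⟩
  | comOther hp hQ hN =>
    obtain ⟨h₁, h₂⟩ := h _ hr w _ hw hN
    exact ⟨.comOther hp hQ h₁, h₂⟩

/-- Equal values in transit allow the same `w` for both branches. Hence a monitor shared by the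
branches has a single unfolding, which encodes both of the new branches; the empty queue makes
`unfoldMus` enter both arms of an involved role's branching. -/
theorem Follows.choice {p : Role} {l : Label} {Q : Finset Role} {G₁ G₂ G₁' G₂' : Proto V}
    (ht : ∀ q, G₁.transit q l = []) (he : G₁.transit = G₂.transit)
    (h : Follows D γ s k G₁ G₁') (h' : Follows D γ s k G₂ G₂') :
    Follows D γ s k (.choice p l Q G₁ G₂) (.choice p l Q G₁' G₂') := by
  intro r hr w N hw hN
  have hw : Agrees D γ w r G₁.transit := hw
  have hw' : Agrees D γ w r G₂.transit := he ▸ hw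
  cases hN with
  | choiceSend hb hl hs hN hN' =>
    obtain ⟨h₁, h₂⟩ := h _ hr w _ hw hN
    obtain ⟨h₁', h₂'⟩ := h' _ hr w _ hw' hN'
    rw [Proc.unfoldMus_branch k (hw.port _ hb hs), Proc.unfoldMus_out, Proc.unfoldMus_out]
    exact ⟨.choiceSend hb hl hs h₁ h₁', .branch (.out h₂) (.out h₂')⟩
  | choiceRecv hQ hb hl hs hp hN hN' =>
    obtain ⟨h₁, h₂⟩ := h _ hr w _ hw hN
    obtain ⟨h₁', h₂'⟩ := h' _ hr w _ hw' hN'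
    have e : w (γ.lab r l) = [] := by
      have := hw.lab _ hb hs
      rwa [hl, ht] at this
    rw [Proc.unfoldMus_branch k e, Proc.unfoldMus_out, Proc.unfoldMus_out]
    exact ⟨.choiceRecv hQ hb hl hs hp h₁ h₁', .branch (.out h₂) (.out h₂')⟩
  | choiceOther hp hQ hN hN' =>
    obtain ⟨h₁, h₂⟩ := h _ hr w _ hw hN
    obtain ⟨h₁', -⟩ := h' _ hr w _ hw' hN'
    exact ⟨.choiceOther hp hQ h₁ h₁', h₂⟩

/-- A role still waiting has `v` at the head of its queue; passing its input consumes this value,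
and the tail agrees with what is in transit below. -/
theorem Follows.comT (hγ : γ.InjBinders D) {l : Label} {v : Val V} {Q : Finset Role}
    {G G' : Proto V} (h : Follows D γ s k G G') :
    Follows D γ s k (.comT l v Q G) (.comT l v Q G') := by
  intro r hr w N hw hN
  cases hN with
  | @comTRecv _ _ _ _ P b hQ hb hl hs hN =>
    subst hl
    have e : w (γ.lab r b.label) = v :: G.transit r b.label := by
      rw [hw.lab b hb hs]; simp [Proto.transit, hQ]
    obtain ⟨h₁, h₂⟩ := h _ hr _ _
      (hw.update hγ hb hs fun l hl => by simp [Proto.transit, hl]) hN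
    rw [Proc.unfoldMus_inp, Proc.unfoldMus_out, e]
    exact ⟨.comTRecv hQ hb rfl hs h₁, .inp (.out h₂)⟩
  | comTOther hQ hN =>
    obtain ⟨h₁, h₂⟩ := h _ hr w _ ⟨fun b hb hs => by
      rw [hw.lab b hb hs]; simp [Proto.transit, hQ], hw.port⟩ hN
    exact ⟨.comTOther hQ h₁, h₂⟩

/-- The head of the queue of a waiting role is `inl`, so only the first arm is unfolded. The other
arm must stay as it is, since the discarded branch of the protocol does not move. -/
theorem Follows.choiceTL (hγ : γ.InjBinders D) {l : Label} {Q : Finset Role}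
    {G₁ G₂ G₁' : Proto V} (h : Follows D γ s k G₁ G₁') :
    Follows D γ s k (.choiceT l .inl Q G₁ G₂) (.choiceT l .inl Q G₁' G₂) := by
  intro r hr w N hw hN
  cases hN with
  | @choiceTRecv _ _ _ _ _ P P' b hQ hb hl hs hN hN' =>
    subst hl
    have e : w (γ.lab r b.label) = .inl :: G₁.transit r b.label := by
      rw [hw.lab b hb hs]; simp [Proto.transit, hQ]
    obtain ⟨h₁, h₂⟩ := h _ hr _ _
      (hw.update hγ hb hs fun l hl => by simp [Proto.transit, hl]) hN
    rw [Proc.unfoldMus_branch_inl k e, Proc.unfoldMus_out]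
    exact ⟨.choiceTRecv hQ hb rfl hs h₁ hN', .branch (.out h₂) (.refl _)⟩
  | choiceTL hQ hN =>
    obtain ⟨h₁, h₂⟩ := h _ hr w _ ⟨fun b hb hs => by
      rw [hw.lab b hb hs]; simp [Proto.transit, hQ], hw.port⟩ hN
    exact ⟨.choiceTL hQ h₁, h₂⟩

theorem Follows.choiceTR (hγ : γ.InjBinders D) {l : Label} {Q : Finset Role}
    {G₁ G₂ G₂' : Proto V} (h : Follows D γ s k G₂ G₂') :
    Follows D γ s k (.choiceT l .inr Q G₁ G₂) (.choiceT l .inr Q G₁ G₂') := by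
  intro r hr w N hw hN
  cases hN with
  | @choiceTRecv _ _ _ _ _ P P' b hQ hb hl hs hN hN' =>
    subst hl
    have e : w (γ.lab r b.label) = .inr :: G₂.transit r b.label := by
      rw [hw.lab b hb hs]; simp [Proto.transit, hQ]
    obtain ⟨h₁, h₂⟩ := h _ hr _ _
      (hw.update hγ hb hs fun l hl => by simp [Proto.transit, hl]) hN'
    rw [Proc.unfoldMus_branch_inr k e, Proc.unfoldMus_out]
    exact ⟨.choiceTRecv hQ hb rfl hs hN h₁, .branch (.refl _) (.out h₂)⟩
  | choiceTR hQ hN =>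
    obtain ⟨h₁, h₂⟩ := h _ hr w _ ⟨fun b hb hs => by
      rw [hw.lab b hb hs]; simp [Proto.transit, hQ], hw.port⟩ hN
    exact ⟨.choiceTR hQ h₁, h₂⟩

/-- Both sides unfold once: for an involved role by the congruence axiom, while an uninvolved role
has `nil` before and after. -/
theorem Follows.unfold {X : RecVar} {G G' : Proto V} (hc : (Proto.mu X G).freeVars = ∅)
    (hk : (Proto.mu X G).RecOK) (hl : (Proto.mu X G).Live D)
    (h : Follows D γ s k (Proto.subst X (.mu X G) G) G') :
    Follows D γ s (k + 1) (.mu X G) G' := by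
  have ht : (Proto.subst X (.mu X G) G).transit = fun _ _ => [] :=
    (Proto.Static.unfold hl.1).transit_eq
  intro r hr w N hw hN
  cases hN with
  | muIn hG hN =>
    obtain ⟨hs, hN⟩ := EncProto.unfold hc hk hG hN
    -- Recursion bodies are static, so empty queues agree with the unfolded body; this matches the
    -- reset of `w` in `unfoldMus` when it enters a recursion.
    obtain ⟨h₁, h₂⟩ := h r hr (fun _ => []) _ ⟨by simp [ht], by simp⟩ hN
    exact ⟨h₁, .trans (.ax (.unfold hs)) h₂⟩
  | muOut hG =>
    have hN : EncProto D γ r (Proto.subst X (.mu X G) G) (.nil : Proc V) :=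
      .nil_of_static (Proto.Static.unfold hl.1) (Proto.closed_unfold hc)
        (by rwa [Proto.roles_unfold])
    obtain ⟨h₁, -⟩ := h r hr (fun _ => []) _ ⟨by simp [ht], by simp⟩ hN
    rw [Proc.unfoldMus_nil] at h₁ ⊢
    exact ⟨h₁, .refl _⟩

end follows

-- A protocol step seen by the monitors.

/-- When the protocol moves, the monitor of the acting role fires and the others follow. -/
theorem EncProto.step {D : List CBinder} {γ : Naming} (hγ : γ.InjBinders D)
    {G G' : Proto V} {α : PAct V} (h : Proto.Step G α G') (hc : G.freeVars = ∅)
    (hk : G.RecOK) (hl : G.Live D) {M : Proc V} (hM : EncProto D γ α.role G M) :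
    ∃ k x u P, M.Fires α.val k x u P ∧ α.Ports D γ x u ∧ EncProto D γ α.role G' P ∧
      Follows D γ α.role k G G' := by
  induction h generalizing M with
  | @sVal p l Q G v =>
    simp only [PAct.role, PAct.val] at *
    cases hM with
    | comSend hb hl' hs hP =>
      refine ⟨0, _, _, _, .inp (hP.substVal _ _), ⟨_, hb, hl', hs, rfl, rfl⟩,
        .comTOther hl.1.1 hP, .of_imp fun r hr N hN => ?_⟩
      cases hN with
      | comSend => exact absurd rfl hr
      | comRecv hQ hb hl hs _ hN => exact .comTRecv hQ hb hl hs hN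
      | comOther _ hQ hN => exact .comTOther hQ hN
    | comRecv hQ => exact absurd hQ hl.1.1
    | comOther hp => exact absurd rfl hp
  | @sChoice p l Q G₁ G₂ v hv =>
    simp only [PAct.role, PAct.val] at *
    cases hM with
    | choiceSend hb hl' hs hP₁ hP₂ =>
      rcases hv with rfl | rfl
      · refine ⟨0, _, _, _, .inl rfl, ⟨_, hb, hl', hs, rfl, rfl⟩,
          .choiceTL hl.1.1 hP₁, .of_imp fun r hr N hN => ?_⟩
        cases hN with
        | choiceSend => exact absurd rfl hr
        | choiceRecv hQ hb hl hs _ hN hN' => exact .choiceTRecv hQ hb hl hs hN hN'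
        | choiceOther _ hQ hN hN' => exact .choiceTL hQ hN
      · refine ⟨0, _, _, _, .inr rfl, ⟨_, hb, hl', hs, rfl, rfl⟩,
          .choiceTR hl.1.1 hP₂, .of_imp fun r hr N hN => ?_⟩
        cases hN with
        | choiceSend => exact absurd rfl hr
        | choiceRecv hQ hb hl hs _ hN hN' => exact .choiceTRecv hQ hb hl hs hN hN'
        | choiceOther _ hQ hN hN' => exact .choiceTR hQ hN'
    | choiceRecv hQ => exact absurd hQ hl.1.1
    | choiceOther hp => exact absurd rfl hp
  | @rVal q l Q G v hq _ =>
    simp only [PAct.role, PAct.val] at *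
    cases hM with
    | comTRecv hQ hb hl' hs hP =>
      refine ⟨0, _, _, _, .inp (hP.substVal _ _), ⟨_, hb, hl', hs, rfl, rfl⟩,
        .comTOther (by simp) hP, .of_imp fun r hr N hN => ?_⟩
      cases hN with
      | comTRecv hQ hb hl hs hN => exact .comTRecv (by simp [hQ, hr]) hb hl hs hN
      | comTOther hQ hN => exact .comTOther (by simp [hQ]) hN
    | comTOther hQ => exact absurd hq hQ
  | @rVal2 q l G v =>
    simp only [PAct.role, PAct.val] at *
    cases hM with
    | comTRecv hQ hb hl' hs hP =>
      refine ⟨0, _, _, _, .inp (hP.substVal _ _), ⟨_, hb, hl', hs, rfl, rfl⟩, hP,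
        .of_imp fun r hr N hN => ?_⟩
      cases hN with
      | comTRecv hQ => exact absurd (Finset.mem_singleton.1 hQ) hr
      | comTOther hQ hN => exact hN
    | comTOther hQ => exact absurd (Finset.mem_singleton_self q) hQ
  | @rChoice q l Q G₁ G₂ v hq _ =>
    simp only [PAct.role, PAct.val] at *
    have hfol : Follows D γ q 0 (.choiceT l v Q G₁ G₂) (.choiceT l v (Q.erase q) G₁ G₂) := by
      refine .of_imp fun r hr N hN => ?_
      cases hN with
      | choiceTRecv hQ hb hl hs hN hN' => exact .choiceTRecv (by simp [hQ, hr]) hb hl hs hN hN'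
      | choiceTL hQ hN => exact .choiceTL (by simp [hQ]) hN
      | choiceTR hQ hN => exact .choiceTR (by simp [hQ]) hN
    cases hM with
    | choiceTRecv hQ hb hl' hs hP₁ hP₂ =>
      -- `Live` leaves only the two selection constants as values of a choice in transit.
      match v, hl.2 with
      | .inl, _ =>
        exact ⟨0, _, _, _, .inl rfl, ⟨_, hb, hl', hs, rfl, rfl⟩,
          .choiceTL (by simp) hP₁, hfol⟩
      | .inr, _ =>
        exact ⟨0, _, _, _, .inr rfl, ⟨_, hb, hl', hs, rfl, rfl⟩,
          .choiceTR (by simp) hP₂, hfol⟩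
    | choiceTL hQ => exact absurd hq hQ
    | choiceTR hQ => exact absurd hq hQ
  | @rChoiceL q l G₁ G₂ =>
    simp only [PAct.role, PAct.val] at *
    cases hM with
    | choiceTRecv hQ hb hl' hs hP₁ hP₂ =>
      refine ⟨0, _, _, _, .inl rfl, ⟨_, hb, hl', hs, rfl, rfl⟩, hP₁,
        .of_imp fun r hr N hN => ?_⟩
      cases hN with
      | choiceTRecv hQ => exact absurd (Finset.mem_singleton.1 hQ) hr
      | choiceTL hQ hN => exact hN
    | choiceTL hQ => exact absurd (Finset.mem_singleton_self q) hQ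
  | @rChoiceR q l G₁ G₂ =>
    simp only [PAct.role, PAct.val] at *
    cases hM with
    | choiceTRecv hQ hb hl' hs hP₁ hP₂ =>
      refine ⟨0, _, _, _, .inr rfl, ⟨_, hb, hl', hs, rfl, rfl⟩, hP₂,
        .of_imp fun r hr N hN => ?_⟩
      cases hN with
      | choiceTRecv hQ => exact absurd (Finset.mem_singleton.1 hQ) hr
      | choiceTR hQ hN => exact hN
    | choiceTR hQ => exact absurd (Finset.mem_singleton_self q) hQ
  | @unfold X G G' α hstep ih =>
    have hr : α.role ∈ G.roles := by
      have := hstep.role_mem; rwa [Proto.roles_unfold] at this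
    cases hM with
    | muIn _ hM =>
      obtain ⟨hs, hM⟩ := EncProto.unfold hc hk hr hM
      obtain ⟨k, x, u, P, hf, hp, hP, hfol⟩ :=
        ih (Proto.closed_unfold hc) (hk.unfold hc) hl.unfold hM
      exact ⟨k + 1, x, u, P, .mu hs hf, hp, hP, hfol.unfold hc hk hl⟩
    | muOut hr' => exact absurd hr hr'
  | conc1 hstep hp hQ ih =>
    cases hM with
    | comSend => exact absurd rfl hp
    | comRecv hQ' => exact absurd hQ' hQ
    | comOther _ _ hM =>
      obtain ⟨k, x, u, P, hf, hx, hP, hfol⟩ := ih hc hk hl.2.2 hM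
      exact ⟨k, x, u, P, hf, hx, .comOther hp hQ hP, hfol.com hl.2.1⟩
  | conc2 _ _ hp hQ ih₁ ih₂ =>
    simp only [Proto.freeVars, Finset.union_eq_empty] at hc
    cases hM with
    | choiceSend => exact absurd rfl hp
    | choiceRecv hQ' => exact absurd hQ' hQ
    | choiceOther _ _ hM hM' =>
      obtain ⟨k, x, u, P, hf, hx, hP, hfol⟩ := ih₁ hc.1 hk.1 hl.2.2.2.1 hM
      obtain ⟨k', x', u', P', hf', hx', hP', hfol'⟩ := ih₂ hc.2 hk.2 hl.2.2.2.2 hM'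
      -- Both branches fire from the same monitor `M`, so one count and one continuation serve for
      -- both.
      obtain ⟨rfl, rfl⟩ := hf.unique hf'
      exact ⟨k, x, u, P, hf, hx, .choiceOther hp hQ hP hP',
        hfol.choice hl.2.1 hl.2.2.1 hfol'⟩
  | conc3 _ hQ ih =>
    cases hM with
    | comTRecv hQ' => exact absurd hQ' hQ
    | comTOther _ hM =>
      obtain ⟨k, x, u, P, hf, hx, hP, hfol⟩ := ih hc hk hl.2 hM
      exact ⟨k, x, u, P, hf, hx, .comTOther hQ hP, hfol.comT hγ⟩
  | conc4 _ hQ ih =>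
    simp only [Proto.freeVars, Finset.union_eq_empty] at hc
    cases hM with
    | choiceTRecv hQ' => exact absurd hQ' hQ
    | choiceTL _ hM =>
      obtain ⟨k, x, u, P, hf, hx, hP, hfol⟩ := ih hc.1 hk.1 hl.2 hM
      exact ⟨k, x, u, P, hf, hx, .choiceTL hQ hP, hfol.choiceTL hγ⟩
  | conc5 _ hQ ih =>
    simp only [Proto.freeVars, Finset.union_eq_empty] at hc
    cases hM with
    | choiceTRecv hQ' => exact absurd hQ' hQ
    | choiceTR _ hM =>
      obtain ⟨k, x, u, P, hf, hx, hP, hfol⟩ := ih hc.2 hk.2 hl.2 hM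
      exact ⟨k, x, u, P, hf, hx, .choiceTR hQ hP, hfol.choiceTR hγ⟩

/-! ### Monitor queues -/

/-- Contents of the queues of each role for each label. -/
abbrev Contents (V : Type u) := Role → Label → List (Val V)

namespace Contents

/-- Append `v` to the queues of the roles `Q` for `l`. -/
def push (l : Label) (Q : Finset Role) (v : Val V) (t : Contents V) : Contents V :=
  fun q l' => if q ∈ Q ∧ l' = l then t q l' ++ [v] else t q l'

/-- Put `v` in front of the queues of the roles `Q` for `l`. -/
def cons (l : Label) (Q : Finset Role) (v : Val V) (t : Contents V) : Contents V :=
  fun q l' => if q ∈ Q ∧ l' = l then v :: t q l' else t q l'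

/-- Append the queues in `s` to those in `t`. -/
def append (t s : Contents V) : Contents V := fun q l => t q l ++ s q l

theorem append_nil (t : Contents V) : t.append (fun _ _ => []) = t := by
  funext q l; simp [append]

theorem push_append (l : Label) (Q : Finset Role) (v : Val V) (t s : Contents V) :
    (t.push l Q v).append s = t.append (s.cons l Q v) := by
  funext q l'
  simp only [push, cons, append]
  split_ifs <;> simp

end Contents

/-- The monitor queues with given contents. -/
def queuesOf (D : List CBinder) (γ : Naming) (t : Contents V) : List (LBinder V) :=
  D.map fun b => ⟨γ.lab b.recv b.label,
    (t b.recv b.label).map fun v => [(γ.lab b.send b.label, v)], idFn,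
    [γ.lab b.send b.label]⟩

/-- The receivers of the interactions labelled `l`. -/
def receivers (D : List CBinder) (l : Label) : Finset Role :=
  ((D.filter fun b => b.label = l).map CBinder.recv).toFinset

theorem mem_receivers {D : List CBinder} {l : Label} {q : Role} :
    q ∈ receivers D l ↔ ∃ b ∈ D, b.label = l ∧ b.recv = q := by
  simp [receivers, and_assoc]

section queues
variable {D : List CBinder} {γ : Naming}

/-- Contents can be read off the queues, but only at pairs that have a binder; elsewhere
`Proto.Live.transit_support` makes them empty. -/
theorem queuesOf_inj {t s : Contents V} (h : queuesOf D γ t = queuesOf D γ s) {b : CBinder}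
    (hb : b ∈ D) : t b.recv b.label = s b.recv b.label := by
  have := List.map_inj_left.1 h b hb
  simp only [LBinder.mk.injEq, true_and, and_true] at this
  exact List.map_injective_iff.2 (fun v w hvw => by simpa using hvw) this

theorem recvLabel_inj (hγ : γ.InjBinders D) {b b' : CBinder} (hb : b ∈ D) (hb' : b' ∈ D)
    (h : γ.lab b.recv b.label = γ.lab b'.recv b'.label) :
    b.recv = b'.recv ∧ b.label = b'.label := by
  have := hγ (recvLabel_mem_binderNames hb) (recvLabel_mem_binderNames hb') h
  simpa using this

theorem sendLabel_inj (hγ : γ.InjBinders D) {b b' : CBinder} (hb : b ∈ D) (hb' : b' ∈ D)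
    (h : γ.lab b.send b.label = γ.lab b'.send b'.label) :
    b.send = b'.send ∧ b.label = b'.label := by
  have := hγ (sendLabel_mem_binderNames hb) (sendLabel_mem_binderNames hb') h
  simpa using this

/-- `enqueue` selects queues by their output ports. As `γ` is injective on binder names, these are
exactly the queues of the roles `Q` for `l`, so the operation on ports is a push on contents. -/
theorem map_enqueue_queuesOf (hγ : γ.InjBinders D) {l : Label} {Q : Finset Role} {u : Port}
    (hQ : ∀ q ∈ Q, ∃ b ∈ D, b.label = l ∧ b.recv = q)
    (hu : ∀ b ∈ D, b.label = l → b.recv ∈ Q → u = γ.lab b.send l) (v : Val V)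
    (t : Contents V) :
    (queuesOf D γ t).map (enqueue (queuePorts γ l Q) u v) = queuesOf D γ (t.push l Q v) := by
  simp only [queuesOf, List.map_map]
  refine List.map_congr_left fun b hb => ?_
  have hiff : γ.lab b.recv b.label ∈ queuePorts γ l Q ↔ b.recv ∈ Q ∧ b.label = l := by
    simp only [queuePorts, Finset.mem_image]
    constructor
    · rintro ⟨q, hq, e⟩
      obtain ⟨b', hb', rfl, rfl⟩ := hQ q hq
      obtain ⟨e₁, e₂⟩ := recvLabel_inj hγ hb' hb e
      exact ⟨e₁ ▸ hq, e₂.symm⟩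
    · rintro ⟨hq, rfl⟩
      exact ⟨_, hq, rfl⟩
  by_cases h : b.recv ∈ Q ∧ b.label = l
  · obtain rfl := h.2
    simp [enqueue, if_pos (hiff.2 h), Contents.push, h.1, hu b hb rfl h.1]
  · simp [enqueue, hiff, Contents.push, h]

-- Definedness of the encoding and liveness.

theorem Proto.Live.transit_support {G : Proto V} (h : G.Live D) {q : Role} {l : Label}
    (hq : q ∉ receivers D l) : G.transit q l = [] := by
  induction G with
  | com p l Q G ih => exact ih h.2.2
  | choice p l Q G₁ G₂ ih₁ ih₂ => exact ih₁ h.2.2.2.1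
  | mu X G ih => exact ih h.2
  | var => rfl
  | done => rfl
  | comT l' v Q G ih =>
    have : ¬ (q ∈ Q ∧ l = l') := by
      rintro ⟨h', rfl⟩; exact hq (mem_receivers.2 (h.1 q h'))
    simp only [transit, if_neg this]
    exact ih h.2
  | choiceT l' v Q G₁ G₂ ih₁ ih₂ =>
    have : ¬ (q ∈ Q ∧ l = l') := by
      rintro ⟨h', rfl⟩; exact hq (mem_receivers.2 (h.1 q h'))
    simp only [transit, if_neg this]
    match v, h.2 with
    | .inl, h => exact ih₁ h
    | .inr, h => exact ih₂ h

theorem Proto.transit_of_not_hasTransit {G : Proto V} {l : Label} (h : ¬ G.HasTransit l)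
    (q : Role) : G.transit q l = [] := by
  induction G with
  | com p l Q G ih => exact ih h
  | choice p l Q G₁ G₂ ih₁ ih₂ => exact ih₁ fun h' => h (Or.inl h')
  | mu X G ih => exact ih h
  | var => rfl
  | done => rfl
  | comT l' v Q G ih =>
    simp only [HasTransit, not_or] at h
    simp [transit, Ne.symm h.1, ih h.2]
  | choiceT l' v Q G₁ G₂ ih₁ ih₂ =>
    simp only [HasTransit, not_or] at h
    cases v <;> simp [transit, Ne.symm h.1, ih₁ h.2.1, ih₂ h.2.2]

theorem ComConnected.realised {p : Role} {l : Label} {Q : Finset Role}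
    (h : ComConnected D p l Q) (hQ : ∀ q ∈ Q, ∃ b ∈ D, b.label = l ∧ b.recv = q) :
    ComRealised D p l Q :=
  ⟨h.2.1, h.2.2, hQ⟩

/-- A receiver without a binder would have no monitor, so the existence of all monitors forces each
interaction to be realised. The role set `S` lets roles of the whole protocol be used inside its
parts. -/
theorem Proto.Static.live {G : Proto V} (hs : G.Static)
    (hc : G.ForallCom (ComConnected D)) {S : Finset Role} (hS : G.roles ⊆ S)
    (hd : ∀ r ∈ S, ∃ M, EncProto D γ r G M) : G.Live D := by
  induction G generalizing S with
  | com p l Q G ih =>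
    simp only [roles, Finset.insert_subset_iff, Finset.union_subset_iff] at hS
    refine ⟨hc.1.realised fun q hq => ?_, ?_, ih hs hc.2 hS.2.2 fun r hr => ?_⟩
    · obtain ⟨M, hM⟩ := hd q (hS.2.1 hq)
      cases hM with
      | comSend => exact absurd hq hc.1.2.1
      | comRecv _ hb hl hr => exact ⟨_, hb, hl, hr⟩
      | comOther _ hq' => exact absurd hq hq'
    · simp [Static.transit_eq (G := G) hs]
    · obtain ⟨M, hM⟩ := hd r hr
      cases hM with
      | comSend _ _ _ h => exact ⟨_, h⟩
      | comRecv _ _ _ _ _ h => exact ⟨_, h⟩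
      | comOther _ _ h => exact ⟨_, h⟩
  | choice p l Q G₁ G₂ ih₁ ih₂ =>
    simp only [roles, Finset.insert_subset_iff, Finset.union_subset_iff] at hS
    have hd' : ∀ r ∈ S, (∃ M, EncProto D γ r G₁ M) ∧ ∃ M, EncProto D γ r G₂ M := by
      intro r hr
      obtain ⟨M, hM⟩ := hd r hr
      cases hM with
      | choiceSend _ _ _ h h' => exact ⟨⟨_, h⟩, _, h'⟩
      | choiceRecv _ _ _ _ _ h h' => exact ⟨⟨_, h⟩, _, h'⟩
      | choiceOther _ _ h h' => exact ⟨⟨_, h⟩, _, h'⟩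
    refine ⟨hc.1.realised fun q hq => ?_, by simp [hs.1.transit_eq],
      by rw [hs.1.transit_eq, hs.2.transit_eq],
      ih₁ hs.1 hc.2.1 hS.2.2.1 fun r hr => (hd' r hr).1,
      ih₂ hs.2 hc.2.2 hS.2.2.2 fun r hr => (hd' r hr).2⟩
    obtain ⟨M, hM⟩ := hd q (hS.2.1 hq)
    cases hM with
    | choiceSend => exact absurd hq hc.1.2.1
    | choiceRecv _ hb hl hr => exact ⟨_, hb, hl, hr⟩
    | choiceOther _ hq' => exact absurd hq hq'
  | mu X G ih =>
    -- The set of roles shrinks to those of the body: for other roles the monitor is `nil` and tells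
    -- nothing about the body.
    refine ⟨hs, ih hs hc (Finset.Subset.refl _) fun r hr => ?_⟩
    obtain ⟨M, hM⟩ := hd r (hS hr)
    cases hM with
    | muIn _ h => exact ⟨_, h⟩
    | muOut hr' => exact absurd hr hr'
  | var => trivial
  | done => trivial
  | comT => exact hs.elim
  | choiceT => exact hs.elim

theorem Fill.eq_of_static {G : Proto V} {L L' : List (LBinder V)} (h : Fill γ G L L')
    (hs : G.Static) : L' = L := by
  induction h <;> simp_all [Proto.Static]

/-- The queue found for a receiver is, by injectivity, that of a binder with the same label, and a
label determines its sender. Hence the store port recorded by `Fill` is forced. -/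
theorem HasQueues.port_eq (hγ : γ.InjBinders D) (hB : BindersOK D) {l : Label}
    {Q : Finset Role} {u : Port} {t : Contents V} (h : HasQueues γ l Q u (queuesOf D γ t)) :
    ∀ b ∈ D, b.label = l → b.recv ∈ Q → u = γ.lab b.send l := by
  rintro b hb rfl hQ
  obtain ⟨b', hb', h₁, h₂, -⟩ := h _ hQ
  obtain ⟨b'', hb'', rfl⟩ := List.mem_map.1 hb'
  simp only [List.cons.injEq, and_true] at h₁ h₂
  obtain ⟨-, e⟩ := recvLabel_inj hγ hb'' hb h₁
  rw [← h₂, e, ((hB.send_iff _ hb'' _ hb).2 e).1]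

/-- The monitors supply the binders, `Run` supplies the absence of transit below a pending label,
and the two fillings of a pending choice with one common result supply the agreement of its
branches. The accumulator `t` holds the values of the outer runtime terms. -/
theorem Fill.live (hγ : γ.InjBinders D) (hB : BindersOK D) {G : Proto V} {t : Contents V}
    {L : List (LBinder V)} (h : Fill γ G (queuesOf D γ t) L) (hr : G.Run D)
    {S : Finset Role} (hS : G.roles ⊆ S) (hd : ∀ r ∈ S, ∃ M, EncProto D γ r G M) :
    G.Live D ∧ L = queuesOf D γ (t.append G.transit) := by
  induction G generalizing t L with
  | com p l Q G ih =>
    cases h with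
    | com h =>
      obtain ⟨hc, ht, hr⟩ := Proto.run_com.1 hr
      simp only [Proto.roles, Finset.insert_subset_iff, Finset.union_subset_iff] at hS
      have := ih h hr hS.2.2 fun r hr => by
        obtain ⟨M, hM⟩ := hd r hr
        cases hM with
        | comSend _ _ _ h => exact ⟨_, h⟩
        | comRecv _ _ _ _ _ h => exact ⟨_, h⟩
        | comOther _ _ h => exact ⟨_, h⟩
      refine ⟨⟨hc.realised fun q hq => ?_, Proto.transit_of_not_hasTransit ht, this.1⟩, this.2⟩
      obtain ⟨M, hM⟩ := hd q (hS.2.1 hq)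
      cases hM with
      | comSend => exact absurd hq hc.2.1
      | comRecv _ hb hl hr => exact ⟨_, hb, hl, hr⟩
      | comOther _ hq' => exact absurd hq hq'
  | choice p l Q G₁ G₂ ih₁ ih₂ =>
    cases h with
    | choice h₁ h₂ =>
      obtain ⟨hc, ht, -, hr₁, hr₂⟩ := Proto.run_choice.1 hr
      simp only [Proto.roles, Finset.insert_subset_iff, Finset.union_subset_iff] at hS
      have hd' : ∀ r ∈ S, (∃ M, EncProto D γ r G₁ M) ∧ ∃ M, EncProto D γ r G₂ M := by
        intro r hr
        obtain ⟨M, hM⟩ := hd r hr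
        cases hM with
        | choiceSend _ _ _ h h' => exact ⟨⟨_, h⟩, _, h'⟩
        | choiceRecv _ _ _ _ _ h h' => exact ⟨⟨_, h⟩, _, h'⟩
        | choiceOther _ _ h h' => exact ⟨⟨_, h⟩, _, h'⟩
      obtain ⟨hl₁, e₁⟩ := ih₁ h₁ hr₁ hS.2.2.1 fun r hr => (hd' r hr).1
      obtain ⟨hl₂, e₂⟩ := ih₂ h₂ hr₂ hS.2.2.2 fun r hr => (hd' r hr).2
      refine ⟨⟨hc.realised fun q hq => ?_, Proto.transit_of_not_hasTransit ht, ?_, hl₁, hl₂⟩,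
        e₁⟩
      · obtain ⟨M, hM⟩ := hd q (hS.2.1 hq)
        cases hM with
        | choiceSend => exact absurd hq hc.2.1
        | choiceRecv _ hb hl hr => exact ⟨_, hb, hl, hr⟩
        | choiceOther _ hq' => exact absurd hq hq'
      -- Where a binder exists the common result of both fillings decides after cancelling `t`; at
      -- all other pairs both sides are empty.
      · funext q l
        by_cases hq : q ∈ receivers D l
        · obtain ⟨b, hb, rfl, rfl⟩ := mem_receivers.1 hq
          exact List.append_cancel_left (queuesOf_inj (e₁.symm.trans e₂) hb)
        · rw [hl₁.transit_support hq, hl₂.transit_support hq]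
  | mu X G ih =>
    have hs : G.Static := hr.transit
    refine ⟨Proto.Static.live (G := .mu X G) hs hr.coms hS hd, ?_⟩
    rw [h.eq_of_static hs, Proto.Static.transit_eq (G := .mu X G) hs, Contents.append_nil]
  | var => cases h; exact ⟨trivial, by rw [Proto.transit, Contents.append_nil]⟩
  | done => cases h; exact ⟨trivial, by rw [Proto.transit, Contents.append_nil]⟩
  | comT l v Q G ih =>
    simp only [Proto.roles, Finset.union_subset_iff] at hS
    have hQ : ∀ q ∈ Q, ∃ b ∈ D, b.label = l ∧ b.recv = q := by
      intro q hq
      obtain ⟨M, hM⟩ := hd q (hS.1 hq)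
      cases hM with
      | comTRecv _ hb hl hr => exact ⟨_, hb, hl, hr⟩
      | comTOther hq' => exact absurd hq hq'
    cases h with
    | comT hq h =>
      rw [map_enqueue_queuesOf hγ hQ (hq.port_eq hγ hB)] at h
      obtain ⟨hl, e⟩ := ih h (Proto.run_comT.1 hr) hS.2 fun r hr => by
        obtain ⟨M, hM⟩ := hd r hr
        cases hM with
        | comTRecv _ _ _ _ h => exact ⟨_, h⟩
        | comTOther _ h => exact ⟨_, h⟩
      exact ⟨⟨hQ, hl⟩, by rw [e, Contents.push_append]; rfl⟩
  | choiceT l v Q G₁ G₂ ih₁ ih₂ =>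
    simp only [Proto.roles, Finset.union_subset_iff] at hS
    obtain ⟨hr₁, hr₂⟩ := Proto.run_choiceT.1 hr
    have hQ : ∀ q ∈ Q, ∃ b ∈ D, b.label = l ∧ b.recv = q := by
      intro q hq
      obtain ⟨M, hM⟩ := hd q (hS.1 hq)
      cases hM with
      | choiceTRecv _ hb hl hr => exact ⟨_, hb, hl, hr⟩
      | choiceTL hq' => exact absurd hq hq'
      | choiceTR hq' => exact absurd hq hq'
    cases h with
    | choiceTL hq h =>
      rw [map_enqueue_queuesOf hγ hQ (hq.port_eq hγ hB)] at h
      obtain ⟨hl, e⟩ := ih₁ h hr₁ hS.2.1 fun r hr => by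
        obtain ⟨M, hM⟩ := hd r hr
        cases hM with
        | choiceTRecv _ _ _ _ h _ => exact ⟨_, h⟩
        | choiceTL _ h => exact ⟨_, h⟩
      exact ⟨⟨hQ, hl⟩, by rw [e, Contents.push_append]; rfl⟩
    | choiceTR hq h =>
      rw [map_enqueue_queuesOf hγ hQ (hq.port_eq hγ hB)] at h
      obtain ⟨hl, e⟩ := ih₂ h hr₂ hS.2.2 fun r hr => by
        obtain ⟨M, hM⟩ := hd r hr
        cases hM with
        | choiceTRecv _ _ _ _ _ h => exact ⟨_, h⟩
        | choiceTR _ h => exact ⟨_, h⟩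
      exact ⟨⟨hQ, hl⟩, by rw [e, Contents.push_append]; rfl⟩

/-- All binders with one label share their sender, so their queues share the input port. For empty
`Q` any port will do. -/
theorem exists_hasQueues (hB : BindersOK D) {l : Label} {Q : Finset Role}
    (hQ : ∀ q ∈ Q, ∃ b ∈ D, b.label = l ∧ b.recv = q) (t : Contents V) :
    ∃ u, HasQueues γ l Q u (queuesOf D γ t) := by
  rcases Q.eq_empty_or_nonempty with rfl | ⟨q, hq⟩
  · exact ⟨0, by simp [HasQueues]⟩
  · obtain ⟨b, hb, rfl, -⟩ := hQ q hq
    refine ⟨γ.lab b.send b.label, fun q' hq' => ?_⟩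
    obtain ⟨b', hb', hl, rfl⟩ := hQ q' hq'
    refine ⟨_, List.mem_map.2 ⟨b', hb', rfl⟩, by simp [hl], ?_, rfl⟩
    rw [hl, ((hB.send_iff _ hb' _ hb).2 hl).1]

theorem Proto.Live.fill (hγ : γ.InjBinders D) (hB : BindersOK D) {G : Proto V}
    (h : G.Live D) (t : Contents V) :
    Fill γ G (queuesOf D γ t) (queuesOf D γ (t.append G.transit)) := by
  induction G generalizing t with
  | com p l Q G ih => exact .com (ih h.2.2 t)
  | choice p l Q G₁ G₂ ih₁ ih₂ =>
    refine .choice (ih₁ h.2.2.2.1 t) ?_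
    have := ih₂ h.2.2.2.2 t
    rwa [← h.2.2.1] at this
  | mu X G ih => exact .mu (ih h.2 t)
  | var => rw [transit, Contents.append_nil]; exact .var
  | done => rw [transit, Contents.append_nil]; exact .done
  | comT l v Q G ih =>
    obtain ⟨u, hu⟩ := exists_hasQueues (γ := γ) hB h.1 t
    refine .comT hu ?_
    rw [map_enqueue_queuesOf hγ h.1 (hu.port_eq hγ hB)]
    exact (Contents.push_append l Q v t G.transit) ▸ ih h.2 _
  | choiceT l v Q G₁ G₂ ih₁ ih₂ =>
    obtain ⟨u, hu⟩ := exists_hasQueues (γ := γ) hB h.1 t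
    match v, h.2 with
    | .inl, hl =>
      refine .choiceTL hu ?_
      rw [map_enqueue_queuesOf hγ h.1 (hu.port_eq hγ hB)]
      exact (Contents.push_append l Q .inl t G₁.transit) ▸ ih₁ hl _
    | .inr, hl =>
      refine .choiceTR hu ?_
      rw [map_enqueue_queuesOf hγ h.1 (hu.port_eq hγ hB)]
      exact (Contents.push_append l Q .inr t G₂.transit) ▸ ih₂ hl _

end queues

/-! ### Effect of protocol transitions on the values in transit -/

/-- Sending appends a value for all receivers; receiving removes the first value. -/
def PAct.Effect (D : List CBinder) : PAct V → Contents V → Contents V → Prop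
  | send _ l v, t, t' => t' = t.push l (receivers D l) v
  | recv q l v, t, t' => t = t'.cons l {q} v

namespace PAct.Effect
variable {D : List CBinder} {α : PAct V} {t t' s : Contents V}

/-- A receive is stated backwards, as consing onto the new contents, and consing is injective. At a
pending choice this keeps the branches in agreement after they move simultaneously. -/
theorem unique (h : α.Effect D t t') (h' : α.Effect D t s) : t' = s := by
  cases α with
  | send => exact h.trans h'.symm
  | recv q l v =>
    have e := h.symm.trans h'
    funext q' l'
    have := congrFun (congrFun e q') l'
    simp only [Contents.cons] at this
    split_ifs at this
    · exact List.cons_injective this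
    · exact this

/-- A receive only removes values, and a send on label `l` would have to come from `p`. -/
theorem eq_nil (h : α.Effect D t t') {p : Role} {l : Label} {Q : Finset Role}
    (hc : ComRealised D p l Q) (ha : α.Allowed D) (hp : α.role ≠ p)
    (ht : ∀ q, t q l = []) (q : Role) : t' q l = [] := by
  cases α with
  | send p' l' v =>
    obtain ⟨b, hb, rfl, rfl⟩ := ha
    have : l ≠ b.label := fun e => hp (hc.2.1 b hb e.symm).1
    rw [show t' = _ from h]
    simp [Contents.push, this, ht]
  | recv q' l' v =>
    have := ht q
    rw [show t = _ from h, Contents.cons] at this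
    split_ifs at this
    exact this

/-- A send appends at the back and so commutes with a value in front. A receiver outside `Q` takes
its value from a queue that `cons l Q v` does not touch. -/
theorem cons (h : α.Effect D t t') {l : Label} {Q : Finset Role} {v : Val V}
    (hQ : α.role ∉ Q) : α.Effect D (t.cons l Q v) (t'.cons l Q v) := by
  cases α with
  | send p' l' v =>
    rw [Effect, show t' = _ from h]
    funext q' l''
    simp only [Contents.cons, Contents.push]
    split_ifs <;> simp
  | recv q l' v =>
    rw [Effect, show t = _ from h]
    funext q' l''
    simp only [Contents.cons, PAct.role, Finset.mem_singleton] at hQ ⊢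
    split_ifs with h₁ h₂
    · exact absurd (h₂.1 ▸ h₁.1) hQ
    all_goals rfl

end PAct.Effect

/-- First-in-first-out order comes from nesting: a send below runtime terms is inner and hence
later, and a receive that passes runtime terms is by a role not waiting in them, for which the
received value is the first. -/
theorem Proto.Live.step {D : List CBinder} {G G' : Proto V} {α : PAct V} (h : Step G α G')
    (ha : α.Allowed D) (hl : G.Live D) : G'.Live D ∧ α.Effect D G.transit G'.transit := by
  induction h with
  | @sVal p l Q G v =>
    refine ⟨⟨hl.1.2.2, hl.2.2⟩, ?_⟩
    -- The broadcast goes to all binders labelled `l`; realisation makes their receivers exactly the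
    -- roles named in the protocol.
    have hQ : receivers D l = Q := by
      ext q; rw [mem_receivers]
      exact ⟨fun ⟨b, hb, hl', hq⟩ => hq ▸ (hl.1.2.1 b hb hl').2, hl.1.2.2 q⟩
    funext q l'
    simp only [transit, Contents.push, hQ]
    split_ifs with h
    · rw [h.2, hl.2.1 q]; rfl
    · rfl
  | @sChoice p l Q G₁ G₂ v hv =>
    obtain ⟨hc, ht, he, hl₁, hl₂⟩ := hl
    have hQ : receivers D l = Q := by
      ext q; rw [mem_receivers]
      exact ⟨fun ⟨b, hb, hl', hq⟩ => hq ▸ (hc.2.1 b hb hl').2, hc.2.2 q⟩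
    refine ⟨⟨hc.2.2, by rcases hv with rfl | rfl <;> assumption⟩, ?_⟩
    have : (Proto.choiceT l v Q G₁ G₂).transit = Contents.cons l Q v G₁.transit := by
      rcases hv with rfl | rfl
      · rfl
      -- `transit` reads a pending choice in its first branch, so selecting the second one needs the
      -- agreement of the branches.
      · rw [he]; rfl
    rw [PAct.Effect, this]
    funext q l'
    simp only [transit, Contents.push, Contents.cons, hQ]
    split_ifs with h
    · rw [h.2, ht q]; rfl
    · rfl
  | @rVal q l Q G v hq _ =>
    refine ⟨⟨fun q hq => hl.1 q (Finset.mem_of_mem_erase hq), hl.2⟩, ?_⟩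
    funext q' l'
    simp only [transit, Contents.cons, Finset.mem_erase, Finset.mem_singleton]
    by_cases e : q' = q <;> by_cases e' : l' = l <;> simp [e, e', hq]
  | @rVal2 q l G v =>
    refine ⟨hl.2, ?_⟩
    rfl
  | @rChoice q l Q G₁ G₂ v hq _ =>
    refine ⟨⟨fun q hq => hl.1 q (Finset.mem_of_mem_erase hq), hl.2⟩, ?_⟩
    funext q' l'
    simp only [transit, Contents.cons, Finset.mem_erase, Finset.mem_singleton]
    by_cases e : q' = q <;> by_cases e' : l' = l <;> simp [e, e', hq]
  | rChoiceL => exact ⟨hl.2, rfl⟩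
  | rChoiceR => exact ⟨hl.2, rfl⟩
  | unfold _ ih =>
    have := ih ha hl.unfold
    rwa [transit_unfold hl.1] at this
  | conc1 _ hp _ ih =>
    obtain ⟨hl', he⟩ := ih ha hl.2.2
    exact ⟨⟨hl.1, he.eq_nil hl.1 ha hp hl.2.1, hl'⟩, he⟩
  | conc2 _ _ hp _ ih₁ ih₂ =>
    obtain ⟨hc, ht, he, hl₁, hl₂⟩ := hl
    obtain ⟨hl₁', he₁⟩ := ih₁ ha hl₁
    obtain ⟨hl₂', he₂⟩ := ih₂ ha hl₂
    exact ⟨⟨hc, he₁.eq_nil hc ha hp ht, he₁.unique (he ▸ he₂), hl₁', hl₂'⟩, he₁⟩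
  | conc3 _ hQ ih =>
    obtain ⟨hl', he⟩ := ih ha hl.2
    exact ⟨⟨hl.1, hl'⟩, he.cons hQ⟩
  | conc4 _ hQ ih =>
    obtain ⟨hl', he⟩ := ih ha hl.2
    exact ⟨⟨hl.1, hl'⟩, he.cons hQ⟩
  | conc5 _ hQ ih =>
    obtain ⟨hl', he⟩ := ih ha hl.2
    exact ⟨⟨hl.1, hl'⟩, he.cons hQ⟩

/-! ### Transitions of the monitor queues -/

section boxes
variable {D : List CBinder} {γ : Naming}

/-- One input reaches every queue for the label, as they share the sender and hence the input port;
all other queues discard it. -/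
theorem queuesOf_push_step (hγ : γ.InjBinders D) (hB : BindersOK D) {b : CBinder}
    (hb : b ∈ D) (v : Val V) (t : Contents V) :
    LStep (queuesOf D γ t) (.inp (γ.lab b.send b.label) v)
      (queuesOf D γ (t.push b.label (receivers D b.label) v)) := by
  refine .inp ?_
  rw [queuesOf, queuesOf, List.forall₂_map_left_iff, List.forall₂_map_right_iff,
    List.forall₂_same]
  intro b' hb'
  by_cases e : b'.label = b.label
  · have hs := ((hB.send_iff _ hb' _ hb).2 e).1
    have hm : b'.recv ∈ receivers D b.label := mem_receivers.2 ⟨b', hb', e, rfl⟩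
    simp only [Contents.push, hm, e, hs, and_self, if_true, List.map_append, List.map_cons,
      List.map_nil]
    -- Every queued store is already defined at the single parameter, so the value opens a new last
    -- store.
    exact .inpNew (by simp [Store.dom]) (by simp)
  · simp only [Contents.push, e, and_false, if_false]
    refine .inpDisc ?_
    simp only [List.mem_singleton]
    exact fun h => e (sendLabel_inj hγ hb hb' h).2.symm

/-- Receiver and label identify the binder, so prepending a value for this pair changes one queue
only, and that queue is the one that outputs. -/
theorem queuesOf_pop_step (hB : BindersOK D) {b : CBinder} (hb : b ∈ D) (v : Val V)
    (t : Contents V) :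
    LStep (queuesOf D γ (t.cons b.label {b.recv} v)) (.out (γ.lab b.recv b.label) v)
      (queuesOf D γ t) := by
  obtain ⟨D₁, D₂, rfl⟩ := List.append_of_mem hb
  have hn := hB.recv_once
  simp only [List.map_append, List.map_cons] at hn
  rw [List.nodup_middle, List.nodup_cons, List.mem_append, not_or] at hn
  have hne : ∀ b' : CBinder, (b' ∈ D₁ ∨ b' ∈ D₂) → ¬ (b'.recv = b.recv ∧ b'.label = b.label) := by
    rintro b' hb' ⟨h₁, h₂⟩
    rcases hb' with hb' | hb'
    · exact hn.1.1 (List.mem_map.2 ⟨b', hb', by rw [h₁, h₂]⟩)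
    · exact hn.1.2 (List.mem_map.2 ⟨b', hb', by rw [h₁, h₂]⟩)
  have h₁ : queuesOf D₁ γ (t.cons b.label {b.recv} v) = queuesOf D₁ γ t :=
    List.map_congr_left fun b' hb' => by
      simp [Contents.cons, hne b' (Or.inl hb')]
  have h₂ : queuesOf D₂ γ (t.cons b.label {b.recv} v) = queuesOf D₂ γ t :=
    List.map_congr_left fun b' hb' => by
      simp [Contents.cons, hne b' (Or.inr hb')]
  have hs : ∀ s : Contents V, queuesOf (D₁ ++ b :: D₂) γ s = queuesOf D₁ γ s ++
      ⟨γ.lab b.recv b.label,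
        (s b.recv b.label).map fun v => [(γ.lab b.send b.label, v)], idFn,
        [γ.lab b.send b.label]⟩ :: queuesOf D₂ γ s := by
    intro s; simp [queuesOf]
  rw [hs, hs, h₁, h₂]
  refine .out ?_
  simp only [Contents.cons, Finset.mem_singleton, and_self, if_true, List.map_cons]
  exact .out (vs := [v]) (by simp) (by simp [Store.dom]) (by simp) (Part.mem_some v)

end boxes

/-! ### Local binders under renaming -/

/-- Renaming of the subject of an action. -/
def Act.rename (f : Port → Port) : Act V → Act V
  | out y v => out (f y) v
  | inp x v => inp (f x) v

theorem Store.dom_rename (f : Port → Port) (σ : Store V) :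
    Store.dom (σ.map fun e => (f e.1, e.2)) = (Store.dom σ).map f := by
  simp [Store.dom]

theorem lookup_rename {f : Port → Port} {S : Set Port} (hf : Set.InjOn f S) {σ : Store V}
    {x : Port} (hx : x ∈ S) (hσ : ∀ y ∈ Store.dom σ, y ∈ S) :
    List.lookup (f x) (σ.map fun e => (f e.1, e.2)) = List.lookup x σ := by
  induction σ with
  | nil => rfl
  | cons e σ ih =>
    simp only [Store.dom, List.map_cons, List.mem_cons, forall_eq_or_imp] at hσ
    have ih := ih hσ.2
    by_cases h : x = e.1
    · obtain ⟨e, w⟩ := e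
      obtain rfl := h
      simp
    · have h' : f x ≠ f e.1 := fun e' => h (hf hx hσ.1 e')
      rw [List.map_cons, List.lookup_cons, List.lookup_cons, beq_false_of_ne h,
        beq_false_of_ne h', ih]

theorem mem_map_of_injOn {f : Port → Port} {S : Set Port} (hf : Set.InjOn f S) {l : List Port}
    {x : Port} (hx : x ∈ S) (hl : ∀ y ∈ l, y ∈ S) : f x ∈ l.map f ↔ x ∈ l := by
  rw [List.mem_map]
  exact ⟨fun ⟨y, hy, e⟩ => hf (hl y hy) hx e ▸ hy, fun h => ⟨x, h, rfl⟩⟩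

namespace LBinder

theorem mem_ports_store {b : LBinder V} {σ : Store V} (hσ : σ ∈ b.stores) {x : Port}
    (hx : x ∈ Store.dom σ) : x ∈ b.ports := by
  simp only [ports, List.mem_cons, List.mem_append, List.mem_flatMap]
  exact Or.inr (Or.inr ⟨σ, hσ, hx⟩)

theorem mem_ports_args {b : LBinder V} {x : Port} (hx : x ∈ b.args) : x ∈ b.ports := by
  simp only [ports, List.mem_cons, List.mem_append]
  exact Or.inr (Or.inl hx)

/-- Injectivity on the ports of the binder and the subject is needed for the negative premises, a
port missing from a store or from the parameters, and for lookups. -/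
theorem Step.rename {f : Port → Port} {S : Set Port} (hf : Set.InjOn f S) {b b' : LBinder V}
    {a : Act V} (h : Step b a b') (ha : a.subj ∈ S) (hb : ∀ x ∈ b.ports, x ∈ S) :
    Step (b.rename f) (a.rename f) (b'.rename f) := by
  have hargs : ∀ x ∈ b.args, x ∈ S := fun x hx => hb x (mem_ports_args hx)
  have hst : ∀ σ ∈ b.stores, ∀ x ∈ Store.dom σ, x ∈ S :=
    fun σ hσ x hx => hb x (mem_ports_store hσ hx)
  cases h with
  | const h => exact .const h
  | @out y σ σs g xs vs v hne hdom hl hv =>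
    simp only [LBinder.rename, Act.rename, List.map_cons]
    refine .out (by simpa using hne) ?_ ?_ hv
    · intro x
      rw [Store.dom_rename, List.mem_map, List.mem_map]
      simp only [hdom]
    · rw [List.forall₂_map_left_iff]
      have : ∀ x ∈ xs, List.lookup (f x) (σ.map fun e => (f e.1, e.2)) = List.lookup x σ :=
        fun x hx => lookup_rename hf (hargs x hx) (hst σ (by simp))
      clear hne hdom hv hb hargs hst
      induction hl with
      | nil => exact .nil
      | cons h _ ih =>
        exact .cons ((this _ (by simp)).trans h) (ih fun x hx => this x (by simp [hx]))
  | @inpNew y σs g xs x v h hx =>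
    simp only [LBinder.rename, Act.rename, List.map_append, List.map_cons, List.map_nil]
    refine .inpNew ?_ (List.mem_map.2 ⟨x, hx, rfl⟩)
    intro τ hτ
    obtain ⟨σ, hσ, rfl⟩ := List.mem_map.1 hτ
    rw [Store.dom_rename]
    exact List.mem_map.2 ⟨x, h σ hσ, rfl⟩
  | @inpUpd y σs₁ σs₂ σ g xs x v h hσ hx =>
    simp only [LBinder.rename, Act.rename, List.map_append, List.map_cons]
    refine .inpUpd ?_ ?_ (List.mem_map.2 ⟨x, hx, rfl⟩)
    · intro τ hτ
      obtain ⟨σ, hσ, rfl⟩ := List.mem_map.1 hτ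
      rw [Store.dom_rename]
      exact List.mem_map.2 ⟨x, h σ hσ, rfl⟩
    · rw [Store.dom_rename]
      exact fun h' => hσ ((mem_map_of_injOn hf ha (hst σ (by simp))).1 h')
  | inpDisc h =>
    refine .inpDisc ?_
    exact fun h' => h ((mem_map_of_injOn hf ha hargs).1 h')

/-- An output drops a store whose domain is the parameter list, and an input records only
parameters. The relevant names of a base component are thus invariant, and its old `γ` still serves.
-/
theorem Step.mem_ports {b b' : LBinder V} {a : Act V} (h : Step b a b') (x : Port) :
    x ∈ b'.ports ↔ x ∈ b.ports := by
  cases h with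
  | const => rfl
  | inpDisc => rfl
  | out _ hdom =>
    simp only [ports, List.mem_cons, List.mem_append, List.flatMap_cons, hdom]
    tauto
  | @inpNew _ _ _ _ y _ _ hy =>
    have : x = y → x ∈ _ := fun e => e ▸ hy
    simp only [ports, List.mem_cons, List.mem_append, List.flatMap_append, List.flatMap_cons,
      List.flatMap_nil, Store.dom, List.map_cons, List.map_nil, List.not_mem_nil]
    tauto
  | @inpUpd _ _ _ _ _ _ y _ _ _ hy =>
    have : x = y → x ∈ _ := fun e => e ▸ hy
    simp only [ports, List.mem_cons, List.mem_append, List.flatMap_append, List.flatMap_cons,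
      Store.dom, List.map_cons]
    tauto

end LBinder

theorem LStep.rename {f : Port → Port} {S : Set Port} (hf : Set.InjOn f S)
    {L L' : List (LBinder V)} {a : Act V} (h : LStep L a L') (ha : a.subj ∈ S)
    (hL : ∀ b ∈ L, ∀ x ∈ b.ports, x ∈ S) :
    LStep (L.map (LBinder.rename f)) (a.rename f) (L'.map (LBinder.rename f)) := by
  cases h with
  | @out L₁ L₂ b b' y v h =>
    simp only [List.map_append, List.map_cons]
    exact .out (h.rename hf ha (hL b (by simp)))
  | inp h =>
    refine .inp ?_
    rw [List.forall₂_map_left_iff, List.forall₂_map_right_iff]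
    induction h with
    | nil => exact .nil
    | cons h _ ih =>
      exact .cons (h.rename hf ha (hL _ (by simp))) (ih fun b hb => hL b (by simp [hb]))

theorem LStep.mem_ports {L L' : List (LBinder V)} {a : Act V} (h : LStep L a L') (x : Port) :
    x ∈ L'.flatMap LBinder.ports ↔ x ∈ L.flatMap LBinder.ports := by
  cases h with
  | out h => simp [h.mem_ports x]
  | inp h =>
    induction h with
    | nil => rfl
    | cons h _ ih => simp only [List.flatMap_cons, List.mem_append, ih, h.mem_ports x]

theorem FreshNaming.congr {γ : Naming} {N N' : List (Role × (Port ⊕ Label))}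
    {zs ps : List Port} (h : FreshNaming γ N zs ps) (e : ∀ n, n ∈ N' ↔ n ∈ N) :
    FreshNaming γ N' zs ps where
  inj := by
    have := h.inj
    simpa only [← e] using this
  nodup := h.nodup
  image z := by simp only [e]; exact h.image z
  fresh := h.fresh

/-! ### Transitions below restrictions, forwarders and parallel compositions -/

section contexts

theorem nuList_step {zs : List Port} {P Q : Proc V} {l : PLabel V} (h : Proc.Step P l Q)
    (hz : ∀ z ∈ zs, l.Avoids z) : Proc.Step (nuList zs P) l (nuList zs Q) := by
  induction zs with
  | nil => exact h
  | cons z zs ih =>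
    exact .res (ih fun z' hz' => hz z' (by simp [hz'])) (hz z (by simp))

theorem fwdIns_pass {F : List (Port × Port)} {P Q : Proc V} {l : PLabel V}
    (h : Proc.Step P l Q) (hF : ∀ f ∈ F, l.Avoids f.1 ∧ l.Avoids f.2) :
    Proc.Step (fwdIns F P) l (fwdIns F Q) := by
  induction F with
  | nil => exact h
  | cons f F ih =>
    exact .fwd1 (ih fun g hg => hF g (by simp [hg])) (hF f (by simp)).1 (hF f (by simp)).2

theorem fwdOuts_pass {F : List (Port × Port)} {P Q : Proc V} {l : PLabel V}
    (h : Proc.Step P l Q) (hF : ∀ f ∈ F, l.Avoids f.1 ∧ l.Avoids f.2) :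
    Proc.Step (fwdOuts F P) l (fwdOuts F Q) := by
  induction F with
  | nil => exact h
  | cons f F ih =>
    exact .fwd2 (ih fun g hg => hF g (by simp [hg])) (hF f (by simp)).1 (hF f (by simp)).2

/-- Distinct forwarders have distinct external ports and distinct internal ports, and external
ports are not internal ones. -/
structure FwdsOK (F : List (Port × Port)) : Prop where
  ext : (F.map Prod.fst).Nodup
  int : (F.map Prod.snd).Nodup
  ne : ∀ f ∈ F, ∀ g ∈ F, f.1 ≠ g.2

namespace FwdsOK

theorem left {F F' : List (Port × Port)} (h : FwdsOK (F ++ F')) : FwdsOK F where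
  ext := (List.map_append ▸ h.ext).of_append_left
  int := (List.map_append ▸ h.int).of_append_left
  ne f hf g hg := h.ne f (by simp [hf]) g (by simp [hg])

theorem right {F F' : List (Port × Port)} (h : FwdsOK (F ++ F')) : FwdsOK F' where
  ext := (List.map_append ▸ h.ext).of_append_right
  int := (List.map_append ▸ h.int).of_append_right
  ne f hf g hg := h.ne f (by simp [hf]) g (by simp [hg])

theorem disjoint {F F' : List (Port × Port)} (h : FwdsOK (F ++ F')) {f g : Port × Port}
    (hf : f ∈ F) (hg : g ∈ F') : f.1 ≠ g.1 ∧ f.2 ≠ g.2 := by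
  have h₁ := h.ext
  have h₂ := h.int
  rw [List.map_append] at h₁ h₂
  exact ⟨fun e => (List.disjoint_of_nodup_append h₁) (List.mem_map.2 ⟨f, hf, rfl⟩)
      (List.mem_map.2 ⟨g, hg, e.symm⟩),
    fun e => (List.disjoint_of_nodup_append h₂) (List.mem_map.2 ⟨f, hf, rfl⟩)
      (List.mem_map.2 ⟨g, hg, e.symm⟩)⟩

theorem tail {f : Port × Port} {F : List (Port × Port)} (h : FwdsOK (f :: F)) : FwdsOK F :=
  right (F := [f]) h

theorem head_ne {f g : Port × Port} {F : List (Port × Port)} (h : FwdsOK (f :: F))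
    (hg : g ∈ F) : f.1 ≠ g.1 ∧ f.2 ≠ g.2 :=
  disjoint (F := [f]) h (by simp) hg

end FwdsOK

/-- Inside the matching forwarder the action has its internal port as subject, outside it the
external one; `FwdsOK` makes every other forwarder avoid the subject that it sees. -/
theorem fwdIns_inp {F : List (Port × Port)} (hF : FwdsOK F) {P Q : Proc V} {v : Val V}
    {f : Port × Port} (hf : f ∈ F) (h : Proc.Step P (.queue (.inp f.2 v)) Q) :
    Proc.Step (fwdIns F P) (.queue (.inp f.1 v)) (fwdIns F Q) := by
  induction F with
  | nil => simp at hf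
  | cons g F ih =>
    rcases List.mem_cons.1 hf with rfl | hf'
    · exact .fwdInp (fwdIns_pass h fun g hg =>
        ⟨(hF.ne g (by simp [hg]) f (by simp)).symm, (hF.head_ne hg).2⟩)
    · exact .fwd1 (ih hF.tail hf') (hF.head_ne hf').1.symm (hF.ne f hf g (by simp))

theorem fwdOuts_out {F : List (Port × Port)} (hF : FwdsOK F) {P Q : Proc V} {v : Val V}
    {f : Port × Port} (hf : f ∈ F) (h : Proc.Step P (.queue (.out f.2 v)) Q) :
    Proc.Step (fwdOuts F P) (.queue (.out f.1 v)) (fwdOuts F Q) := by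
  induction F with
  | nil => simp at hf
  | cons g F ih =>
    rcases List.mem_cons.1 hf with rfl | hf'
    · exact .fwdOut (fwdOuts_pass h fun g hg =>
        ⟨(hF.ne g (by simp [hg]) f (by simp)).symm, (hF.head_ne hg).2⟩)
    · exact .fwd2 (ih hF.tail hf') (hF.head_ne hf').1.symm (hF.ne f hf g (by simp))

/-- A process behind restrictions and forwarders. -/
def wrap (zs : List Port) (Fi Fo : List (Port × Port)) (P : Proc V) : Proc V :=
  nuList zs (fwdIns Fi (fwdOuts Fo P))

variable {zs : List Port} {Fi Fo : List (Port × Port)} {P Q : Proc V}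

theorem wrap_inp (hF : FwdsOK (Fi ++ Fo)) {v : Val V} {f : Port × Port} (hf : f ∈ Fi)
    (hz : f.1 ∉ zs) (h : Proc.Step P (.queue (.inp f.2 v)) Q) :
    Proc.Step (wrap zs Fi Fo P) (.queue (.inp f.1 v)) (wrap zs Fi Fo Q) := by
  refine nuList_step (fwdIns_inp hF.left hf (fwdOuts_pass h fun g hg => ?_))
    fun z hz' (e : f.1 = z) => hz (e ▸ hz')
  exact ⟨(hF.ne g (by simp [hg]) f (by simp [hf])).symm, (hF.disjoint hf hg).2⟩

theorem wrap_out (hF : FwdsOK (Fi ++ Fo)) {v : Val V} {f : Port × Port} (hf : f ∈ Fo)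
    (hz : f.1 ∉ zs) (h : Proc.Step P (.queue (.out f.2 v)) Q) :
    Proc.Step (wrap zs Fi Fo P) (.queue (.out f.1 v)) (wrap zs Fi Fo Q) := by
  refine nuList_step (fwdIns_pass (fwdOuts_out hF.right hf h) fun g hg => ?_)
    fun z hz' (e : f.1 = z) => hz (e ▸ hz')
  exact ⟨(hF.disjoint hg hf).1.symm, hF.ne f (by simp [hf]) g (by simp [hg])⟩

theorem wrap_tau (h : Proc.Step P .tau Q) :
    Proc.Step (wrap zs Fi Fo P) .tau (wrap zs Fi Fo Q) :=
  nuList_step (fwdIns_pass (fwdOuts_pass h fun _ _ => ⟨trivial, trivial⟩)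
    fun _ _ => ⟨trivial, trivial⟩) fun _ _ => trivial

theorem wrap_cong (h : StructCong P Q) : StructCong (wrap zs Fi Fo P) (wrap zs Fi Fo Q) := by
  have h₁ : StructCong (fwdOuts Fo P) (fwdOuts Fo Q) := by
    induction Fo with
    | nil => exact h
    | cons f F ih => exact .fwdOut ih
  have h₂ : StructCong (fwdIns Fi (fwdOuts Fo P)) (fwdIns Fi (fwdOuts Fo Q)) := by
    clear h
    induction Fi with
    | nil => exact h₁
    | cons f F ih => exact .fwdIn ih
  clear h h₁
  unfold wrap
  induction zs with
  | nil => exact h₂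
  | cons z zs ih => exact .nu ih

/-- Parallel composition of a list of processes with a last one. -/
def parList (Ps : List (Proc V)) (T : Proc V) : Proc V := Ps.foldr .par T

theorem parList_append (A B : List (Proc V)) (T : Proc V) :
    parList (A ++ B) T = parList A (parList B T) := List.foldr_append

variable {l : PLabel V} {X X' T T' : Proc V}

theorem parList_last (A : List (Proc V)) (h : Proc.Step T l T') :
    Proc.Step (parList A T) l (parList A T') := by
  induction A with
  | nil => exact h
  | cons P A ih => exact .parR ih

theorem parList_elem (A B : List (Proc V)) (T : Proc V) (h : Proc.Step X l X') :
    Proc.Step (parList (A ++ X :: B) T) l (parList (A ++ X' :: B) T) := by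
  rw [parList_append, parList_append]
  exact parList_last A (.parL h)

theorem parList_queue_prim (A B : List (Proc V)) {a : Act V}
    (h : Proc.Step X (.queue a) X') (h' : Proc.Step T (.prim a.dual) T') :
    Proc.Step (parList (A ++ X :: B) T) .tau (parList (A ++ X' :: B) T') := by
  rw [parList_append, parList_append]
  exact parList_last A (.comL h (parList_last B h'))

theorem parList_prim_queue (A B : List (Proc V)) {a : Act V}
    (h : Proc.Step X (.prim a.dual) X') (h' : Proc.Step T (.queue a) T') :
    Proc.Step (parList (A ++ X :: B) T) .tau (parList (A ++ X' :: B) T') := by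
  rw [parList_append, parList_append]
  exact parList_last A (.comR h (parList_last B h'))

theorem parList_cong_last (A : List (Proc V)) (h : StructCong T T') :
    StructCong (parList A T) (parList A T') := by
  induction A with
  | nil => exact h
  | cons P A ih => exact .par (.refl P) ih

theorem parList_cong_elem (A B : List (Proc V)) (T : Proc V) (h : StructCong X X') :
    StructCong (parList (A ++ X :: B) T) (parList (A ++ X' :: B) T) := by
  rw [parList_append, parList_append]
  exact parList_cong_last A (.par h (.refl _))

end contexts

/-! ### Monitors of a protocol in parallel -/

section monitors
variable {D : List CBinder} {γ : Naming}

/-- Injectivity of `γ` makes the label recoverable from the port, so prescribing the contents port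
by port is consistent. -/
theorem exists_agrees (hγ : γ.InjBinders D) (r : Role) (t : Contents V) :
    ∃ w, Agrees D γ w r t := by
  classical
  refine ⟨fun z => if h : ∃ b ∈ D, b.recv = r ∧ γ.lab r b.label = z then
    t r h.choose.label else [], ⟨fun b hb hr => ?_, fun b hb hr => ?_⟩⟩
  · have h : ∃ b' ∈ D, b'.recv = r ∧ γ.lab r b'.label = γ.lab r b.label := ⟨b, hb, hr, rfl⟩
    rw [dif_pos h]
    obtain ⟨h₁, h₂, h₃⟩ := h.choose_spec
    rw [(recvLabel_inj hγ h₁ hb (by rw [h₂, hr]; exact h₃)).2]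
  · rw [dif_neg]
    rintro ⟨b', hb', hr', e⟩
    subst hr
    have := hγ (hr' ▸ recvLabel_mem_binderNames hb') (sendPort_mem_binderNames hb) e
    simp at this

theorem forall₂_append_left {α β : Type*} {p : α → β → Prop} {l₁ l₂ : List α} {m : List β}
    (h : List.Forall₂ p (l₁ ++ l₂) m) :
    ∃ m₁ m₂, List.Forall₂ p l₁ m₁ ∧ List.Forall₂ p l₂ m₂ ∧ m = m₁ ++ m₂ := by
  induction l₁ generalizing m with
  | nil => exact ⟨[], m, .nil, h, rfl⟩
  | cons a l₁ ih =>
    cases h with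
    | cons ha h =>
      obtain ⟨m₁, m₂, h₁, h₂, rfl⟩ := ih h
      exact ⟨_ :: m₁, m₂, .cons ha h₁, h₂, rfl⟩

/-- The encoding has monitors only for the roles of the new protocol. Those of vanished roles have
become `nil` up to congruence and are absorbed. -/
theorem parList_monitors {G : Proto V} (hc : G.freeVars = ∅) {ps : List Role}
    {Ns : List (Proc V)}
    (h : List.Forall₂ (fun p N => ∃ N', EncProto D γ p G N' ∧ StructCong N N') ps Ns) :
    ∃ Ms, List.Forall₂ (fun p M => EncProto D γ p G M) (ps.filter (· ∈ G.roles)) Ms ∧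
      ∀ T, StructCong (parList Ns T) (parList Ms T) := by
  induction h with
  | nil => exact ⟨[], .nil, fun T => .refl T⟩
  | @cons p N ps Ns h _ ih =>
    obtain ⟨N', hN', hc'⟩ := h
    obtain ⟨Ms, hMs, hT⟩ := ih
    by_cases hp : p ∈ G.roles
    · refine ⟨N' :: Ms, ?_, fun T => .par hc' (hT T)⟩
      rw [List.filter_cons_of_pos (by simpa using hp)]
      exact .cons hN' hMs
    · refine ⟨Ms, ?_, fun T => ?_⟩
      · rwa [List.filter_cons_of_neg (by simpa using hp)]
      · obtain rfl := hN'.eq_nil hc hp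
        exact .trans (.par hc' (hT T)) (.trans (.ax .parComm) (.ax .parNil))

/-- Splits the monitors around that of the acting role. The statement stops before its output is
performed, because the partner of that second step is outside the monitors. -/
theorem monitors_step (hγ : γ.InjBinders D) {G G' : Proto V} {α : PAct V}
    (h : Proto.Step G α G') (ha : α.Allowed D) (hr : G.Run D) (hl : G.Live D)
    {ps : List Role} {Ms : List (Proc V)} (hps : ps.Nodup) (hmem : ∀ p, p ∈ ps ↔ p ∈ G.roles)
    (hMs : List.Forall₂ (fun p M => EncProto D γ p G M) ps Ms) :
    ∃ A M B x u P ps' Ms', Ms = A ++ M :: B ∧ α.Ports D γ x u ∧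
      Proc.Step M (.prim (.inp x α.val)) (.out u (.val α.val) P) ∧
      ps'.Nodup ∧ (∀ p, p ∈ ps' ↔ p ∈ G'.roles) ∧
      List.Forall₂ (fun p M => EncProto D γ p G' M) ps' Ms' ∧
      ∀ T, StructCong (parList (A ++ P :: B) T) (parList Ms' T) := by
  obtain ⟨ps₁, ps₂, rfl⟩ := List.append_of_mem ((hmem _).2 h.role_mem)
  obtain ⟨A, Ms₂, hA, h₂, rfl⟩ := forall₂_append_left hMs
  cases h₂ with
  | @cons _ M _ B hM hB =>
  obtain ⟨k, x, u, P, hf, hx, hP, hfol⟩ := EncProto.step hγ h hr.closed hr.recOK hl hM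
  rw [List.nodup_middle, List.nodup_cons, List.mem_append, not_or] at hps
  have hoth : ∀ qs Ns, α.role ∉ qs → List.Forall₂ (fun p M => EncProto D γ p G M) qs Ns →
      List.Forall₂ (fun p N => ∃ N', EncProto D γ p G' N' ∧ StructCong N N') qs Ns := by
    intro qs Ns hq hN
    induction hN with
    | nil => exact .nil
    | @cons q N qs Ns hN _ ih =>
      simp only [List.mem_cons, not_or] at hq
      obtain ⟨w, hw⟩ := exists_agrees hγ q G.transit
      exact .cons ⟨_, hfol q (Ne.symm hq.1) w N hw hN⟩ (ih hq.2)
  obtain ⟨Ms', hMs', hT⟩ := parList_monitors (hr.step h ha).closed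
    (List.rel_append (hoth _ _ hps.1.1 hA)
      (.cons ⟨P, hP, .refl P⟩ (hoth _ _ hps.1.2 hB)))
  refine ⟨A, M, B, x, u, P, _, Ms', rfl, hx, hf.step, ?_, ?_, hMs', hT⟩
  · refine List.Nodup.filter _ ?_
    rw [List.nodup_middle, List.nodup_cons, List.mem_append, not_or]
    exact hps
  · intro p
    simp only [List.mem_filter, decide_eq_true_eq, hmem p, and_iff_right_iff_imp]
    exact fun hp => h.roles_subset hp

end monitors

/-! ### Reachable components -/

/-- The structural constraints on reachable components. -/
inductive Comp.Run : Comp V → Prop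
  | base {xs ys : List Port} {L : List (LBinder V)} : (xs ++ ys).Nodup → Run (.base xs ys L)
  | comp {xs ys : List Port} {D : List CBinder} {r : Role} {Fi Fo : List Fwd}
      {R : List (Role × Comp V)} {G : Proto V} :
      (xs ++ ys).Nodup →
      (Fi.map Fwd.src ++ Fo.map Fwd.dst).Nodup → (Fi.map Fwd.dst ++ Fo.map Fwd.src).Nodup →
      BindersOK D → G.Run D → (∀ a ∈ R, Run a.2) →
      Run (.comp xs ys D r Fi Fo R G)

theorem Program.run {C : Comp V} (h : Program C) : C.Run := by
  induction h with
  | base h _ _ => exact .base h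
  | comp h₁ h₂ h₃ h₄ h₅ _ ih => exact .comp h₁ h₂ h₃ h₄ (Proto.ProtoOK.run h₅) ih

namespace Comp

theorem Run.nodup {C : Comp V} (h : C.Run) : (C.inputs ++ C.outputs).Nodup := by
  cases h <;> assumption

theorem Step.interface {C C' : Comp V} {l : CLabel V} (h : Step C l C') :
    C'.inputs = C.inputs ∧ C'.outputs = C.outputs := by
  cases h <;> exact ⟨rfl, rfl⟩

theorem Step.out_mem {C C' : Comp V} {y : Port} {v : Val V}
    (h : Step C (.act (.out y v)) C') : y ∈ C.outputs := by
  cases h <;> assumption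

theorem Step.inp_mem {C C' : Comp V} {x : Port} {v : Val V}
    (h : Step C (.act (.inp x v)) C') : x ∈ C.inputs := by
  cases h <;> assumption

theorem run_update {R₁ R₂ : List (Role × Comp V)} {s : Role} {C C' : Comp V}
    (h : ∀ a ∈ R₁ ++ (s, C) :: R₂, Run a.2) (hC : C.Run → C'.Run) :
    ∀ a ∈ R₁ ++ (s, C') :: R₂, Run a.2 := by
  simp only [List.mem_append, List.mem_cons] at h ⊢
  rintro a (ha | rfl | ha)
  · exact h a (Or.inl ha)
  · exact hC (h _ (Or.inr (Or.inl rfl)))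
  · exact h a (Or.inr (Or.inr ha))

theorem Run.step {C C' : Comp V} {l : CLabel V} (h : Step C l C') (hC : C.Run) : C'.Run := by
  induction h with
  | outBase => cases hC with | base h => exact .base h
  | inpBase => cases hC with | base h => exact .base h
  | @outChor _ _ _ _ _ _ _ _ _ _ b _ _ v _ hb hG ih =>
    cases hC with
    | comp h₁ h₂ h₃ h₄ h₅ h₆ =>
      exact .comp h₁ h₂ h₃ h₄ (h₅.step hG ⟨b, hb, rfl, rfl⟩) (run_update h₆ ih)
  | inpChor _ hb hG ih =>
    cases hC with
    | comp h₁ h₂ h₃ h₄ h₅ h₆ =>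
      exact .comp h₁ h₂ h₃ h₄ (h₅.step hG trivial) (run_update h₆ ih)
  | internal _ ih =>
    cases hC with
    | comp h₁ h₂ h₃ h₄ h₅ h₆ => exact .comp h₁ h₂ h₃ h₄ h₅ (run_update h₆ ih)
  | outComp _ _ _ ih =>
    cases hC with
    | comp h₁ h₂ h₃ h₄ h₅ h₆ => exact .comp h₁ h₂ h₃ h₄ h₅ (run_update h₆ ih)
  | inpComp _ _ _ ih =>
    cases hC with
    | comp h₁ h₂ h₃ h₄ h₅ h₆ => exact .comp h₁ h₂ h₃ h₄ h₅ (run_update h₆ ih)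

theorem Run.of_reaches {C C' : Comp V} (hC : C.Run) (h : Reaches C C') : C'.Run := by
  induction h with
  | refl => exact hC
  | tail _ h ih => exact Run.step h.choose_spec ih

end Comp

/-! ### Encodings of components -/

namespace FreshNaming
variable {γ : Naming} {N : List (Role × (Port ⊕ Label))} {zs ps : List Port}

theorem mem (h : FreshNaming γ N zs ps) {n : Role × (Port ⊕ Label)} (hn : n ∈ N) :
    γ n.1 n.2 ∈ zs :=
  (h.image _).2 ⟨n, hn, rfl⟩

theorem ne (h : FreshNaming γ N zs ps) {n : Role × (Port ⊕ Label)} (hn : n ∈ N) {x : Port}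
    (hx : x ∈ ps) : x ≠ γ n.1 n.2 :=
  fun e => h.fresh _ (h.mem hn) (e ▸ hx)

theorem port_injOn (h : FreshNaming γ N zs ps) (r : Role) :
    Set.InjOn (γ.port r) {x | (r, .inl x) ∈ N} := by
  intro x hx y hy e
  have := h.inj hx hy e
  simpa using this

end FreshNaming

theorem FwdsOK.of_injOn {f : Port → Port} {ins outs : List Port} (hn : (ins ++ outs).Nodup)
    (hf : Set.InjOn f {x | x ∈ ins ++ outs})
    (hne : ∀ x ∈ ins ++ outs, ∀ y ∈ ins ++ outs, x ≠ f y) :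
    FwdsOK ((ins.map fun x => (x, f x)) ++ outs.map fun x => (x, f x)) := by
  rw [← List.map_append]
  constructor
  · simpa [List.map_map, Function.comp_def] using hn
  · rw [List.map_map]
    exact hn.map_on hf
  · simp only [List.mem_map]
    rintro _ ⟨x, hx, rfl⟩ _ ⟨y, hy, rfl⟩
    exact hne x hx y hy

theorem FwdsOK.of_injOn' {f : Port → Port} {ins outs : List Port} (hn : (ins ++ outs).Nodup)
    (hf : Set.InjOn f {x | x ∈ ins ++ outs})
    (hne : ∀ x ∈ ins ++ outs, ∀ y ∈ ins ++ outs, x ≠ f y) :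
    FwdsOK ((ins.map fun x => (f x, x)) ++ outs.map fun x => (f x, x)) := by
  rw [← List.map_append]
  constructor
  · rw [List.map_map]
    exact hn.map_on hf
  · simpa [List.map_map, Function.comp_def] using hn
  · simp only [List.mem_map]
    rintro _ ⟨x, hx, rfl⟩ _ ⟨y, hy, rfl⟩
    exact (hne y hy x hx).symm

/-- The encoding of an assignment of a component to a role, given that of the component. -/
def roleProc (γ : Naming) (p : Role) (C : Comp V) (P : Proc V) : Proc V :=
  wrap (C.inputs ++ C.outputs) (C.inputs.map fun x => (γ.port p x, x))
    (C.outputs.map fun y => (γ.port p y, y)) P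

section composites
variable {γ : Naming} {D : List CBinder} {r s : Role} {Fi Fo : List Fwd}
  {R R₁ R₂ : List (Role × Comp V)} {C C' : Comp V} {zs xs ys : List Port}

theorem mem_compNames_interface (hC : (s, C) ∈ R) {x : Port}
    (hx : x ∈ C.inputs ++ C.outputs) : (s, .inl x) ∈ compNames D r Fi Fo R := by
  refine List.mem_append_right _ (List.mem_flatMap.2 ⟨_, hC, List.mem_map.2 ⟨x, hx, rfl⟩⟩)

theorem mem_interfacePorts (hC : (s, C) ∈ R) {x : Port} (hx : x ∈ C.inputs ++ C.outputs) :
    x ∈ interfacePorts R :=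
  List.mem_flatMap.2 ⟨_, hC, hx⟩

theorem mem_compNames_fwdIn {f : Fwd} (hf : f ∈ Fi) :
    (r, .inl f.dst) ∈ compNames D r Fi Fo R := by
  simp only [compNames, List.mem_append, List.mem_map]
  exact Or.inl (Or.inl (Or.inr ⟨f, hf, rfl⟩))

theorem mem_compNames_fwdOut {f : Fwd} (hf : f ∈ Fo) :
    (r, .inl f.src) ∈ compNames D r Fi Fo R := by
  simp only [compNames, List.mem_append, List.mem_map]
  exact Or.inl (Or.inr ⟨f, hf, rfl⟩)

theorem compNames_update (h : C'.inputs = C.inputs ∧ C'.outputs = C.outputs) :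
    compNames D r Fi Fo (R₁ ++ (s, C') :: R₂) = compNames D r Fi Fo (R₁ ++ (s, C) :: R₂) := by
  simp [compNames, h.1, h.2]

theorem interfacePorts_update (h : C'.inputs = C.inputs ∧ C'.outputs = C.outputs) :
    interfacePorts (R₁ ++ (s, C') :: R₂) = interfacePorts (R₁ ++ (s, C) :: R₂) := by
  simp [interfacePorts, h.1, h.2]

/-- Transitions preserve interfaces, so the same naming and restricted ports encode the successor.
-/
theorem FreshNaming.update (h : C'.inputs = C.inputs ∧ C'.outputs = C.outputs)
    (hF : FreshNaming γ (compNames D r Fi Fo (R₁ ++ (s, C) :: R₂)) zs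
      (xs ++ ys ++ interfacePorts (R₁ ++ (s, C) :: R₂))) :
    FreshNaming γ (compNames D r Fi Fo (R₁ ++ (s, C') :: R₂)) zs
      (xs ++ ys ++ interfacePorts (R₁ ++ (s, C') :: R₂)) := by
  rwa [compNames_update h, interfacePorts_update h]

theorem FreshNaming.injBinders {ps : List Port}
    (hF : FreshNaming γ (compNames D r Fi Fo R) zs ps) : γ.InjBinders D :=
  hF.inj.mono fun n hn => by
    simp only [compNames, Set.mem_ofPred_eq, List.append_assoc]
    exact List.mem_append_left _ hn

theorem FreshNaming.roleFwds (hF : FreshNaming γ (compNames D r Fi Fo R) zs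
      (xs ++ ys ++ interfacePorts R)) (hC : (s, C) ∈ R)
    (hn : (C.inputs ++ C.outputs).Nodup) :
    FwdsOK ((C.inputs.map fun x => (γ.port s x, x)) ++
      C.outputs.map fun y => (γ.port s y, y)) :=
  .of_injOn' hn ((hF.port_injOn s).mono fun _ hx => mem_compNames_interface hC hx)
    fun _ hx _ hy => hF.ne (mem_compNames_interface hC hy)
      (List.mem_append_right _ (mem_interfacePorts hC hx))

theorem FreshNaming.port_notMem (hF : FreshNaming γ (compNames D r Fi Fo R) zs
      (xs ++ ys ++ interfacePorts R)) (hC : (s, C) ∈ R) {x : Port}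
    (hx : x ∈ C.inputs ++ C.outputs) : γ.port s x ∉ C.inputs ++ C.outputs :=
  fun h => hF.ne (mem_compNames_interface hC hx)
    (List.mem_append_right _ (mem_interfacePorts hC h)) rfl

theorem roleProc_out (hF : FreshNaming γ (compNames D r Fi Fo R) zs
      (xs ++ ys ++ interfacePorts R)) (hC : (s, C) ∈ R)
    (hn : (C.inputs ++ C.outputs).Nodup) {y : Port} (hy : y ∈ C.outputs) {v : Val V}
    {P Q : Proc V} (h : Proc.Step P (.queue (.out y v)) Q) :
    Proc.Step (roleProc γ s C P) (.queue (.out (γ.port s y) v)) (roleProc γ s C Q) :=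
  wrap_out (f := (γ.port s y, y)) (hF.roleFwds hC hn) (List.mem_map.2 ⟨y, hy, rfl⟩)
    (hF.port_notMem hC (List.mem_append_right _ hy)) h

theorem roleProc_inp (hF : FreshNaming γ (compNames D r Fi Fo R) zs
      (xs ++ ys ++ interfacePorts R)) (hC : (s, C) ∈ R)
    (hn : (C.inputs ++ C.outputs).Nodup) {x : Port} (hx : x ∈ C.inputs) {v : Val V}
    {P Q : Proc V} (h : Proc.Step P (.queue (.inp x v)) Q) :
    Proc.Step (roleProc γ s C P) (.queue (.inp (γ.port s x) v)) (roleProc γ s C Q) :=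
  wrap_inp (f := (γ.port s x, x)) (hF.roleFwds hC hn) (List.mem_map.2 ⟨x, hx, rfl⟩)
    (hF.port_notMem hC (List.mem_append_left _ hx)) h

theorem FreshNaming.compFwds (hF : FreshNaming γ (compNames D r Fi Fo R) zs
      (xs ++ ys ++ interfacePorts R))
    (he : (Fi.map Fwd.src ++ Fo.map Fwd.dst).Nodup)
    (hi : (Fi.map Fwd.dst ++ Fo.map Fwd.src).Nodup)
    (hFi : ∀ f ∈ Fi, f.src ∈ xs) (hFo : ∀ f ∈ Fo, f.dst ∈ ys) :
    FwdsOK ((Fi.map fun f => (f.src, γ.port r f.dst)) ++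
      Fo.map fun f => (f.dst, γ.port r f.src)) where
  ext := by simpa [Function.comp_def] using he
  int := by
    have hsub : ∀ x ∈ Fi.map Fwd.dst ++ Fo.map Fwd.src,
        (r, .inl x) ∈ compNames D r Fi Fo R := by
      intro x hx
      simp only [List.mem_append, List.mem_map] at hx
      rcases hx with ⟨f, hf, rfl⟩ | ⟨f, hf, rfl⟩
      · exact mem_compNames_fwdIn hf
      · exact mem_compNames_fwdOut hf
    have := hi.map_on ((hF.port_injOn r).mono hsub)
    simpa [Function.comp_def] using this
  ne := by
    have hx : ∀ f ∈ (Fi.map fun f => (f.src, γ.port r f.dst)) ++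
        Fo.map fun f => (f.dst, γ.port r f.src), f.1 ∈ xs ++ ys ∧ f.2 ∈ zs := by
      intro f hf
      simp only [List.mem_append, List.mem_map] at hf ⊢
      rcases hf with ⟨f, hf, rfl⟩ | ⟨f, hf, rfl⟩
      · exact ⟨Or.inl (hFi f hf), hF.mem (mem_compNames_fwdIn hf)⟩
      · exact ⟨Or.inr (hFo f hf), hF.mem (mem_compNames_fwdOut hf)⟩
    intro f hf g hg e
    exact hF.fresh _ (hx g hg).2 (e ▸ List.mem_append_left _ (hx f hf).1)

/-- Isolates the process of one assignment and allows it to be replaced by an encoding of any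
component with the same interface. -/
theorem EncRoles.split {Rs : List (Proc V)} (h : EncRoles γ (R₁ ++ (s, C) :: R₂) Rs) :
    ∃ A P B, Rs = A ++ roleProc γ s C P :: B ∧ Enc C P ∧
      ∀ (C' : Comp V) P', C'.inputs = C.inputs ∧ C'.outputs = C.outputs → Enc C' P' →
        EncRoles γ (R₁ ++ (s, C') :: R₂) (A ++ roleProc γ s C P' :: B) := by
  induction R₁ generalizing Rs with
  | nil =>
    cases h with
    | @cons _ _ _ _ P Ps hP hR =>
      refine ⟨[], P, Ps, rfl, hP, fun C' P' he hP' => ?_⟩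
      have := EncRoles.cons (p := s) hP' hR
      rwa [he.1, he.2] at this
  | cons a R₁ ih =>
    cases h with
    | cons hP hR =>
      obtain ⟨A, P, B, rfl, hP', hup⟩ := ih hR
      exact ⟨_ :: A, P, B, rfl, hP', fun C' P' he hP'' => .cons hP (hup C' P' he hP'')⟩

end composites

-- Encodings of base components.

theorem FreshNaming.base_step {xs ys : List Port} {L L' : List (LBinder V)} {γ : Naming} {r : Role}
    {zs : List Port} (hF : FreshNaming γ (baseNames r xs ys L) zs (xs ++ ys)) {a : Act V}
    (h : LStep L a L') : FreshNaming γ (baseNames r xs ys L') zs (xs ++ ys) :=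
  hF.congr fun n => by
    simp only [baseNames, List.mem_map, List.mem_append, h.mem_ports]

theorem baseFwds {xs ys : List Port} {L : List (LBinder V)} {γ : Naming} {r : Role}
    {zs : List Port} (hF : FreshNaming γ (baseNames r xs ys L) zs (xs ++ ys))
    (hn : (xs ++ ys).Nodup) :
    FwdsOK ((xs.map fun x => (x, γ.port r x)) ++ ys.map fun y => (y, γ.port r y)) := by
  have hsub : ∀ x ∈ xs ++ ys, (r, .inl x) ∈ baseNames r xs ys L := by
    intro x hx
    rw [baseNames, List.append_assoc]
    exact List.mem_map.2 ⟨x, List.mem_append_right _ hx, rfl⟩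
  exact .of_injOn hn ((hF.port_injOn r).mono hsub) fun x hx y hy => hF.ne (hsub y hy) hx

theorem box_rename_step {xs ys : List Port} {L L' : List (LBinder V)} {γ : Naming} {r : Role}
    {zs : List Port} (hF : FreshNaming γ (baseNames r xs ys L) zs (xs ++ ys)) {a : Act V}
    (h : LStep L a L') (ha : a.subj ∈ xs ++ ys) :
    Proc.Step (.box (L.map (LBinder.rename (γ.port r)))) (.queue (a.rename (γ.port r)))
      (.box (L'.map (LBinder.rename (γ.port r)))) := by
  refine .act (h.rename (hF.port_injOn r) ?_ fun b hb x hx => ?_)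
  · rw [Set.mem_ofPred_eq, baseNames, List.append_assoc]
    exact List.mem_map.2 ⟨_, List.mem_append_right _ ha, rfl⟩
  · rw [Set.mem_ofPred_eq, baseNames, List.append_assoc]
    exact List.mem_map.2 ⟨_, List.mem_append_left _ (List.mem_flatMap.2 ⟨b, hb, hx⟩), rfl⟩

-- Simulation of component transitions.

/-- The encoding of a component simulates its inputs and outputs by single queue actions. -/
theorem Enc.act_step {C C' : Comp V} {l : CLabel V} (h : Comp.Step C l C') {a : Act V}
    (hl : l = .act a) (hr : C.Run) {P : Proc V} (hP : Enc C P) :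
    ∃ Q, Proc.Step P (.queue a) Q ∧ Enc C' Q := by
  induction h generalizing a P with
  | @outBase xs ys L L' y v hL hy =>
    cases hl
    cases hr with | base hn =>
    cases hP with | @base _ _ _ γ r zs hF =>
    exact ⟨_, wrap_out (f := (y, γ.port r y)) (baseFwds hF hn) (List.mem_map.2 ⟨y, hy, rfl⟩)
      (fun hz => hF.fresh _ hz (List.mem_append_right _ hy))
      (box_rename_step hF hL (List.mem_append_right _ hy)), .base (hF.base_step hL)⟩
  | @inpBase xs ys L L' x v hL hx =>
    cases hl
    cases hr with | base hn =>
    cases hP with | @base _ _ _ γ r zs hF =>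
    exact ⟨_, wrap_inp (f := (x, γ.port r x)) (baseFwds hF hn) (List.mem_map.2 ⟨x, hx, rfl⟩)
      (fun hz => hF.fresh _ hz (List.mem_append_left _ hx))
      (box_rename_step hF hL (List.mem_append_left _ hx)), .base (hF.base_step hL)⟩
  | outChor => cases hl
  | inpChor => cases hl
  | internal => cases hl
  | @outComp xs ys D r Fi Fo R₁ R₂ G f C C' v hs hf hy ih =>
    cases hl
    cases hr with | comp h₁ h₂ h₃ h₄ h₅ h₆ =>
    cases hP with | @comp _ _ _ _ _ _ _ _ γ zs ps Rs Ms L hFi hFo hF hR hps hmem hMs hL =>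
    obtain ⟨A, P, B, rfl, hP, hup⟩ := hR.split
    have hC := h₆ _ (List.mem_append_right _ List.mem_cons_self)
    obtain ⟨Q, hPQ, hQ⟩ := ih rfl hC hP
    have hQR := parList_elem A B (parList Ms (.box L)) (roleProc_out hF
      (List.mem_append_right _ List.mem_cons_self) hC.nodup hs.out_mem hPQ)
    rw [← parList_append, ← parList_append] at hQR
    exact ⟨_, wrap_out (f := (f.dst, γ.port r f.src)) (hF.compFwds h₂ h₃ hFi hFo)
      (List.mem_map.2 ⟨f, hf, rfl⟩)
      (fun hz => hF.fresh _ hz (by simp [hy])) hQR,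
      .comp hFi hFo (hF.update hs.interface) (hup _ _ hs.interface hQ) hps hmem hMs hL⟩
  | @inpComp xs ys D r Fi Fo R₁ R₂ G f C C' v hs hf hx ih =>
    cases hl
    cases hr with | comp h₁ h₂ h₃ h₄ h₅ h₆ =>
    cases hP with | @comp _ _ _ _ _ _ _ _ γ zs ps Rs Ms L hFi hFo hF hR hps hmem hMs hL =>
    obtain ⟨A, P, B, rfl, hP, hup⟩ := hR.split
    have hC := h₆ _ (List.mem_append_right _ List.mem_cons_self)
    obtain ⟨Q, hPQ, hQ⟩ := ih rfl hC hP
    have hQR := parList_elem A B (parList Ms (.box L)) (roleProc_inp hF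
      (List.mem_append_right _ List.mem_cons_self) hC.nodup hs.inp_mem hPQ)
    rw [← parList_append, ← parList_append] at hQR
    exact ⟨_, wrap_inp (f := (f.src, γ.port r f.dst)) (hF.compFwds h₂ h₃ hFi hFo)
      (List.mem_map.2 ⟨f, hf, rfl⟩)
      (fun hz => hF.fresh _ hz (by simp [hx])) hQR,
      .comp hFi hFo (hF.update hs.interface) (hup _ _ hs.interface hQ) hps hmem hMs hL⟩

theorem Fill.live_of_monitors {D : List CBinder} {γ : Naming} (hγ : γ.InjBinders D)
    (hB : BindersOK D) {G : Proto V} (hr : G.Run D) {ps : List Role} {Ms : List (Proc V)}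
    (hmem : ∀ p, p ∈ ps ↔ p ∈ G.roles)
    (hMs : List.Forall₂ (fun p M => EncProto D γ p G M) ps Ms) {L : List (LBinder V)}
    (hL : Fill γ G (buildQueues D γ) L) : G.Live D ∧ L = queuesOf D γ G.transit := by
  -- Empty contents give `buildQueues` by definition, and appending to them is definitionally the
  -- identity.
  refine Fill.live (t := fun _ _ => []) hγ hB hL hr (Finset.Subset.refl _) fun p hp => ?_
  obtain ⟨ps₁, ps₂, rfl⟩ := List.append_of_mem ((hmem p).2 hp)
  obtain ⟨_, _, -, h, rfl⟩ := forall₂_append_left hMs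
  cases h with
  | cons h _ => exact ⟨_, h⟩

theorem Proto.Live.fill_buildQueues {D : List CBinder} {γ : Naming} (hγ : γ.InjBinders D)
    (hB : BindersOK D) {G : Proto V} (h : G.Live D) :
    Fill γ G (buildQueues D γ) (queuesOf D γ G.transit) :=
  h.fill hγ hB fun _ _ => []

/-- The encoding of a component simulates its internal moves by two internal moves. -/
theorem Enc.tau_step {C C' : Comp V} {l : CLabel V} (h : Comp.Step C l C') (hl : l = .tau)
    (hr : C.Run) {P : Proc V} (hP : Enc C P) :
    ∃ P₁ P₂ P', Proc.Step P .tau P₁ ∧ Proc.Step P₁ .tau P₂ ∧ Enc C' P' ∧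
      StructCong P₂ P' := by
  induction h generalizing P with
  | outBase => cases hl
  | inpBase => cases hl
  | outComp => cases hl
  | inpComp => cases hl
  | @internal xs ys D r s Fi Fo R₁ R₂ G C C' hs ih =>
    cases hr with | comp h₁ h₂ h₃ h₄ h₅ h₆ =>
    cases hP with | @comp _ _ _ _ _ _ _ _ γ zs ps Rs Ms L hFi hFo hF hR hps hmem hMs hL =>
    obtain ⟨A, P, B, rfl, hP, hup⟩ := hR.split
    obtain ⟨P₁, P₂, P', hP₁, hP₂, hP', hc⟩ :=
      ih rfl (h₆ _ (List.mem_append_right _ List.mem_cons_self)) hP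
    have hin : ∀ {X Y : Proc V}, Proc.Step X .tau Y →
        Proc.Step (parList ((A ++ roleProc γ s C X :: B) ++ Ms) (.box L)) .tau
          (parList ((A ++ roleProc γ s C Y :: B) ++ Ms) (.box L)) := by
      intro X Y hXY
      rw [parList_append (A ++ _ :: B), parList_append (A ++ _ :: B)]
      exact parList_elem A B _ (wrap_tau hXY)
    refine ⟨_, _, _, wrap_tau (hin hP₁), wrap_tau (hin hP₂),
      .comp hFi hFo (hF.update hs.interface) (hup _ _ hs.interface hP') hps hmem hMs hL,
      wrap_cong ?_⟩
    change StructCong (parList _ _) (parList _ _)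
    rw [parList_append (A ++ _ :: B), parList_append (A ++ _ :: B)]
    exact parList_cong_elem A B _ (wrap_cong hc)
  | @outChor xs ys D r Fi Fo R₁ R₂ G G' b C C' v hs hb hG ih =>
    clear ih
    cases hr with | comp h₁ h₂ h₃ h₄ h₅ h₆ =>
    cases hP with | @comp _ _ _ _ _ _ _ _ γ zs ps Rs Ms L hFi hFo hF hR hps hmem hMs hL =>
    obtain ⟨A, P, B, rfl, hP, hup⟩ := hR.split
    have hγ := hF.injBinders
    have hmC := List.mem_append_right R₁ (List.mem_cons_self (a := (b.send, C)) (l := R₂))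
    have hC := h₆ _ hmC
    obtain ⟨Q, hPQ, hQ⟩ := Enc.act_step hs rfl hC hP
    have hPQ' := roleProc_out hF hmC hC.nodup hs.out_mem hPQ
    obtain ⟨hlive, rfl⟩ := Fill.live_of_monitors hγ h₄ h₅ hmem hMs hL
    have ha : (PAct.send b.send b.label v).Allowed D := ⟨b, hb, rfl, rfl⟩
    obtain ⟨A', M, B', x, u, N, ps', Ms', rfl, ⟨b', hb', hl', hs', rfl, rfl⟩, hfire, hps',
      hmem', hMs', hcong⟩ := monitors_step hγ hG ha h₅ hlive hps hmem hMs
    obtain ⟨hlive', heff⟩ := hlive.step hG ha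
    -- The monitor may have been built from another binder `b'` with the same label; a label
    -- determines the sender port, so it listens where the component outputs.
    rw [((h₄.send_iff _ hb' _ hb).2 hl').2] at hfire
    have hbox : Proc.Step (.box (queuesOf D γ G.transit))
        (.queue (.inp (γ.lab b.send b.label) v)) (.box (queuesOf D γ G'.transit)) := by
      rw [show G'.transit = _ from heff]
      exact .act (queuesOf_push_step hγ h₄ hb v G.transit)
    -- The component hands the value to the sender's monitor; in `st₂` the monitor broadcasts it
    -- into the queues.
    have st₁ := parList_queue_prim A B (a := .out _ v) hPQ'
      (parList_elem A' B' (.box (queuesOf D γ G.transit)) hfire)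
    have st₂ := parList_last (A ++ roleProc γ b.send C Q :: B)
      (parList_prim_queue A' B' (a := .inp (γ.lab b.send b.label) v)
        (X := .out (γ.lab b.send b.label) (.val v) N) .out hbox)
    rw [← parList_append, ← parList_append] at st₁ st₂
    refine ⟨_, _, _, wrap_tau st₁, wrap_tau st₂,
      .comp hFi hFo (hF.update hs.interface) (hup _ _ hs.interface hQ) hps' hmem' hMs'
        (hlive'.fill_buildQueues hγ h₄), wrap_cong ?_⟩
    change StructCong (parList _ _) (parList _ _)
    rw [parList_append (A ++ _ :: B), parList_append (A ++ _ :: B)]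
    exact parList_cong_last _ (hcong _)
  | @inpChor xs ys D r Fi Fo R₁ R₂ G G' b C C' v hs hb hG ih =>
    clear ih
    cases hr with | comp h₁ h₂ h₃ h₄ h₅ h₆ =>
    cases hP with | @comp _ _ _ _ _ _ _ _ γ zs ps Rs Ms L hFi hFo hF hR hps hmem hMs hL =>
    obtain ⟨A, P, B, rfl, hP, hup⟩ := hR.split
    have hγ := hF.injBinders
    have hmC := List.mem_append_right R₁ (List.mem_cons_self (a := (b.recv, C)) (l := R₂))
    have hC := h₆ _ hmC
    obtain ⟨Q, hPQ, hQ⟩ := Enc.act_step hs rfl hC hP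
    have hPQ' := roleProc_inp hF hmC hC.nodup hs.inp_mem hPQ
    obtain ⟨hlive, rfl⟩ := Fill.live_of_monitors hγ h₄ h₅ hmem hMs hL
    have ha : (PAct.recv b.recv b.label v).Allowed D := trivial
    obtain ⟨A', M, B', x, u, N, ps', Ms', rfl, ⟨b', hb', hl', hr', rfl, rfl⟩, hfire, hps',
      hmem', hMs', hcong⟩ := monitors_step hγ hG ha h₅ hlive hps hmem hMs
    obtain ⟨hlive', heff⟩ := hlive.step hG ha
    -- Label and receiver determine the binder, so the monitor forwards to the very port on which
    -- the component inputs.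
    obtain rfl : b' = b := List.inj_on_of_nodup_map h₄.recv_once hb' hb (by rw [hl', hr'])
    have hbox : Proc.Step (.box (queuesOf D γ G.transit))
        (.queue (.out (γ.lab b'.recv b'.label) v)) (.box (queuesOf D γ G'.transit)) := by
      rw [show G.transit = _ from heff]
      exact .act (queuesOf_pop_step h₄ hb v G'.transit)
    -- The order is opposite to sending: the queue feeds the monitor, which in `st₂` feeds the
    -- component.
    have st₁ := parList_last (A ++ roleProc γ b'.recv C P :: B)
      (parList_prim_queue A' B' (a := .out _ v) hfire hbox)
    have st₂ := parList_queue_prim A B (a := .inp _ v) hPQ'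
      (parList_elem A' B' (.box (queuesOf D γ G'.transit))
        (Proc.Step.out (z := γ.port b'.recv b'.recvPort) (v := v) (P := N)))
    rw [← parList_append, ← parList_append] at st₁ st₂
    refine ⟨_, _, _, wrap_tau st₁, wrap_tau st₂,
      .comp hFi hFo (hF.update hs.interface) (hup _ _ hs.interface hQ) hps' hmem' hMs'
        (hlive'.fill_buildQueues hγ h₄), wrap_cong ?_⟩
    change StructCong (parList _ _) (parList _ _)
    rw [parList_append (A ++ _ :: B), parList_append (A ++ _ :: B)]
    exact parList_cong_last _ (hcong _)

end GC

theorem mainTheorem3 {V : Type*} (C₀ C C' : GC.Comp V)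
    (hC₀ : GC.Program C₀) (hreach : GC.Reaches C₀ C) (hstep : GC.Comp.Step C .tau C')
    (P : GC.Proc V) (hP : GC.Enc C P) :
    ∃ P₁ P₂ P' : GC.Proc V, GC.Proc.Step P .tau P₁ ∧ GC.Proc.Step P₁ .tau P₂ ∧
      GC.Enc C' P' ∧ GC.StructCong P₂ P' :=
  GC.Enc.tau_step hstep rfl (hC₀.run.of_reaches hreach) hP
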